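/- Call a cycle of a graph alternating with respect to a matching $M$ if its edges are alternately in $M$ and not in $M$, and call a matching alternating cycle-free if it has no alternating cycle; its size is its number of edges. A nice tree decomposition of a graph $G$ is a tree decomposition $(T,(X_i)_{i\in I})$ with a root $r\in I$ such that $|X_r|=1$; $|X_i|=1$ for every leaf $i$ (node without children); every node has at most two children; if $i$ has two children $j\neq k$, then $X_i=X_j=X_k$; and if $i$ has exactly one child $j$, then either $X_j\subset X_i$ and $|X_i|=|X_j|+1$, or $X_i\subset X_j$ and $|X_j|=|X_i|+1$. **Theorem 5.** There is an algorithm that, given a finite simple bipartite graph $G$ with $n$ nodes (as the list of its edges) together with a nice tree decomposition of $G$ of width $w=\max_i|X_i|-1$ with $O(n)$ bags (as a rooted tree with the list of the elements of each bag), computes the size of a maximum alternating cycle-free matching of $G$ in $$O\big(4^{w^2+w}\cdot w^3\cdot\log(w)\cdot n\big)$$ time on a unit-cost random access machine (with addition and subtraction as its arithmetic), where for $w\le 1$ the factor $w^3\log(w)$ is read as $2^3\log 2$. That is, one program computes the right value on all inputs, and for every constant $c$ there is a constant $C$ such that it halts after at most $C\cdot 4^{w^2+w}\cdot \max(w,2)^3\cdot\log(\max(w,2))\cdot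 n$ steps on all inputs with at most $c\,n$ bags. -/

import Mathlib

/-! ### Random access machine with unit-cost step count -/

namespace RAM

/-- Programs of a random access machine with structured control flow.  The machine has registers and
arrays, both holding natural numbers and both addressed by natural numbers; a program mentions
finitely many of the registers and finitely many of the arrays.  The only arithmetic is addition and
truncated subtraction, and the array cells are accessed by indirect addressing. -/
inductive Program : Type
  /-- do nothing -/
  | nop : Program
  /-- `const x k` : register `x` becomes the number `k` -/
  | const (x k : ℕ) : Program
  /-- `add x y z` : register `x` becomes the sum of registers `y` and `z` -/
  | add (x y z : ℕ) : Program
  /-- `sub x y z` : register `x` becomes the truncated difference of registers `y` and `z` -/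
  | sub (x y z : ℕ) : Program
  /-- `load x a y` : register `x` becomes the content of the cell of array `a` whose address is in
  register `y` -/
  | load (x a y : ℕ) : Program
  /-- `store a x y` : the cell of array `a` whose address is in register `x` becomes the content of
  register `y` -/
  | store (a x y : ℕ) : Program
  /-- `seq p q` : run `p`, then `q` -/
  | seq (p q : Program) : Program
  /-- `cond x p q` : run `p` if register `x` is nonzero, otherwise run `q` -/
  | cond (x : ℕ) (p q : Program) : Program
  /-- `loop x p` : as long as register `x` is nonzero, run `p` -/
  | loop (x : ℕ) (p : Program) : Program

/-- A state: the contents of the registers and of the cells of the arrays. -/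
structure State : Type where
  reg : ℕ → ℕ
  arr : ℕ → ℕ → ℕ

/-- Write a value into a register. -/
def State.setReg (s : State) (x v : ℕ) : State :=
  { s with reg := Function.update s.reg x v }

/-- Write a value into an array cell. -/
def State.setArr (s : State) (a i v : ℕ) : State :=
  { s with arr := Function.update s.arr a (Function.update (s.arr a) i v) }

/-- `Exec p s t s'` : started in state `s`, program `p` halts in state `s'` after exactly `t` steps.
Every elementary instruction and every test of a register takes one step. -/
inductive Exec : Program → State → ℕ → State → Prop
  | nop (s : State) : Exec Program.nop s 1 s
  | const (x k : ℕ) (s : State) : Exec (Program.const x k) s 1 (s.setReg x k)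
  | add (x y z : ℕ) (s : State) : Exec (Program.add x y z) s 1 (s.setReg x (s.reg y + s.reg z))
  | sub (x y z : ℕ) (s : State) : Exec (Program.sub x y z) s 1 (s.setReg x (s.reg y - s.reg z))
  | load (x a y : ℕ) (s : State) : Exec (Program.load x a y) s 1 (s.setReg x (s.arr a (s.reg y)))
  | store (a x y : ℕ) (s : State) :
      Exec (Program.store a x y) s 1 (s.setArr a (s.reg x) (s.reg y))
  | seq {p q : Program} {s s' s'' : State} {t t' : ℕ} :
      Exec p s t s' → Exec q s' t' s'' → Exec (Program.seq p q) s (t + t') s''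
  | cond_ne_zero {x : ℕ} {p q : Program} {s s' : State} {t : ℕ} :
      s.reg x ≠ 0 → Exec p s t s' → Exec (Program.cond x p q) s (1 + t) s'
  | cond_zero {x : ℕ} {p q : Program} {s s' : State} {t : ℕ} :
      s.reg x = 0 → Exec q s t s' → Exec (Program.cond x p q) s (1 + t) s'
  | loop_ne_zero {x : ℕ} {p : Program} {s s' s'' : State} {t t' : ℕ} :
      s.reg x ≠ 0 → Exec p s t s' → Exec (Program.loop x p) s' t' s'' →
      Exec (Program.loop x p) s (1 + t + t') s''
  | loop_zero {x : ℕ} {p : Program} {s : State} :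
      s.reg x = 0 → Exec (Program.loop x p) s 1 s

/-- The initial state on an input word: the input is in the first cells of array `0`, and every other
cell and every register holds `0`. -/
def State.init (input : List ℕ) : State where
  reg := fun _ => 0
  arr := fun a i => if a = 0 then input.getD i 0 else 0

/-- On the given input, the program halts after exactly `t` steps with output `y`, the output being
read from register `0`. -/
def Computes (p : Program) (input : List ℕ) (t y : ℕ) : Prop :=
  ∃ s : State, Exec p (State.init input) t s ∧ s.reg 0 = y

end RAM

/-! ### Alternating cycle-free matchings -/

namespace SimpleGraph

/-- An alternating cycle of `M`: a cycle of `G` whose edges are, cyclically, alternately in `M` and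
not in `M`. -/
def IsAlternatingCycle {V : Type*} {G : SimpleGraph V} (M : G.Subgraph) {v : V} (p : G.Walk v v) :
    Prop :=
  p.IsCycle ∧ Cycle.Chain (fun e f => e ∈ M.edgeSet ↔ f ∉ M.edgeSet) (p.edges : Cycle (Sym2 V))

/-- A matching of `G` without alternating cycles. -/
def IsAlternatingCycleFreeMatching {V : Type*} {G : SimpleGraph V} (M : G.Subgraph) : Prop :=
  M.IsMatching ∧ ∀ (v : V) (p : G.Walk v v), ¬ IsAlternatingCycle M p

/-- `k` is the size (number of edges) of a maximum alternating cycle-free matching of `G`. -/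
def IsMaxAlternatingCycleFreeMatchingSize {V : Type*} (G : SimpleGraph V) (k : ℕ) : Prop :=
  IsGreatest {m : ℕ | ∃ M : G.Subgraph, IsAlternatingCycleFreeMatching M ∧ M.edgeSet.ncard = m} k

/-! ### Tree decompositions -/

/-- A tree decomposition of `G`, with tree nodes `I`. -/
structure TreeDecomposition {V : Type*} (G : SimpleGraph V) (I : Type*) where
  /-- the tree -/
  tree : SimpleGraph I
  isTree : tree.IsTree
  /-- the bags -/
  bag : I → Finset V
  node_coverage : ∀ v : V, ∃ i : I, v ∈ bag i
  arc_coverage : ∀ u v : V, G.Adj u v → ∃ i : I, u ∈ bag i ∧ v ∈ bag i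
  coherence : ∀ (i j k : I) (p : tree.Walk i k), p.IsPath → j ∈ p.support →
    ∀ v : V, v ∈ bag i → v ∈ bag k → v ∈ bag j

namespace TreeDecomposition

variable {V I : Type*} {G : SimpleGraph V}

/-- The width: the largest size of a bag, minus one. -/
def width [Fintype I] (D : G.TreeDecomposition I) : ℕ :=
  (Finset.univ.sup fun i : I => (D.bag i).card) - 1

/-- `D.IsChild r i j` : in the tree rooted at `r`, node `j` is a child of node `i`. -/
def IsChild (D : G.TreeDecomposition I) (r i j : I) : Prop :=
  D.tree.Adj i j ∧ D.tree.dist r j = D.tree.dist r i + 1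

/-- The tree decomposition, rooted at `r`, is a nice tree decomposition. -/
structure IsNice (D : G.TreeDecomposition I) (r : I) : Prop where
  root : (D.bag r).card = 1
  leaf : ∀ i : I, (∀ j : I, ¬ D.IsChild r i j) → (D.bag i).card = 1
  at_most_two : ∀ i : I, {j : I | D.IsChild r i j}.encard ≤ 2
  join : ∀ i j k : I, D.IsChild r i j → D.IsChild r i k → j ≠ k →
    D.bag i = D.bag j ∧ D.bag i = D.bag k
  introduce_or_forget : ∀ i j : I, {k : I | D.IsChild r i k} = {j} →
    ((D.bag i).card = (D.bag j).card + 1 ∧ D.bag j ⊂ D.bag i) ∨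
    ((D.bag j).card = (D.bag i).card + 1 ∧ D.bag i ⊂ D.bag j)

end TreeDecomposition

/-! ### Input words -/

/-- `IsInputWord G D r x` : the word `x` is a presentation of the graph `G` together with its
tree decomposition `D` rooted at `r`.  It consists of the number of nodes of `G`, the number of edges,
the list of all edges, each listed once by its two endpoints (`edges`), the number of bags,
the root and, for each bag, the number of its children, the list of its children (`children`), its
size and the list of its elements (`elems`).  All lists are in arbitrary order. -/
def IsInputWord {n b : ℕ} (G : SimpleGraph (Fin n)) (D : G.TreeDecomposition (Fin b)) (r : Fin b)
    (x : List ℕ) : Prop :=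
  ∃ (edges : List (Fin n × Fin n)) (children : Fin b → List (Fin b)) (elems : Fin b → List (Fin n)),
    (edges.map fun e => s(e.1, e.2)).Nodup ∧
    (∀ u v : Fin n, s(u, v) ∈ (edges.map fun e => s(e.1, e.2)) ↔ G.Adj u v) ∧
    (∀ i, (children i).Nodup ∧ ∀ j, j ∈ children i ↔ D.IsChild r i j) ∧
    (∀ i, (elems i).Nodup ∧ ∀ v, v ∈ elems i ↔ v ∈ D.bag i) ∧
    x = [n, edges.length] ++ (edges.flatMap fun e => [(e.1 : ℕ), (e.2 : ℕ)]) ++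
      [b, (r : ℕ)] ++ (List.finRange b).flatMap fun i =>
        [(children i).length] ++ (children i).map (fun j => (j : ℕ)) ++
          ([(elems i).length] ++ (elems i).map (fun v => (v : ℕ)))

end SimpleGraph

/-! Fix a 2-colouring `σ` of the bipartite graph. An alternating cycle-free matching is the same
thing as the set of tight edges of a position function `π`. Here every edge must go weakly upwards
from colour 0 to colour 1, an edge is tight if its ends have equal positions, and every vertex has
at most one tight edge. In one direction, direct matching edges from colour 1 to colour 0 and the
others from 0 to 1. A directed cycle would yield an alternating cycle, so the digraph is acyclic,
and counting predecessors of colour 0 gives `π` (`exists_order`). Conversely, an alternating cycle,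
traversed in the right sense, never goes down and strictly rises at each non-matching edge, which is
absurd (`not_isAlternatingCycle_of_edgeOK`). The problem thus becomes to maximise the number of
tight edges over pairs `π`, `σ` subject to conditions on single edges and single vertices.

Such a problem can be solved along a rooted tree decomposition. An edge is processed at the moment
when one of its endpoints leaves the bags. The state at a bag records three labels of each of its
vertices: the rank of its position, its colour, and its number of processed tight edges. Every
processed edge is accounted for by exactly one child, either as an edge processed earlier or as one
newly processed inside the child's bag (`cnt_eq_sum`). A table entry is 0 for an infeasible state
and otherwise one more than a number of tight edges. Two facts are carried up the tree by
`Correct.of_children`. Nonzero entries come from partial solutions: solutions of the children are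
glued after moving their positions within ℚ so that they agree on the common bag
(`exists_extend_order`). Entries are also at least the value of the restriction of any global
solution. The root bag has one element, so all edges are processed there, and the largest root entry
minus one is the answer (`Correct.isMax`). All nodes are treated by one recursion, with at most two
children each.

For the machine, states are coded as numbers with 3K digits in base K, where K is the least number
that is at least 2 and exceeds all bag sizes; so there are K^(3K) codes. All the inner work is
expressed by combinators (`Ev`, `Stm`) whose running time is polynomial in a loop bound stored in
memory, and this bound is finally set to K^(3K). Only the outer loops over vertices, edges, bags and
digits contribute further factors, and those are linear. The total is O(n) times a power of K^(3K).
As K ≤ w + 2, that power is only 2^O(w log w), which is far below 4^(w² + w)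
(`Nat.exists_forall_pow_mul_le_four_pow`); no finer analysis of the recursion is needed. -/

namespace RAM

/-! ### Combinators for programs of running time polynomial in a stored bound -/

/-- The contents of all arrays. -/
abbrev Mem := ℕ → ℕ → ℕ

/-- A type of tuples of numbers, the variables that an expression may read. -/
class Ctx (Γ : Type) where
  size : ℕ
  Holds : Γ → (ℕ → ℕ) → Prop
  congr : ∀ {γ : Γ} {r r' : ℕ → ℕ}, (∀ x < size, r x = r' x) → Holds γ r → Holds γ r'

instance : Ctx Unit where
  size := 0
  Holds _ _ := True
  congr _ _ := trivial

instance {Γ : Type} [Ctx Γ] : Ctx (Γ × ℕ) where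
  size := Ctx.size Γ + 1
  Holds p r := Ctx.Holds p.1 r ∧ r (Ctx.size Γ) = p.2
  congr h hp := ⟨Ctx.congr (fun x hx => h x (Nat.lt_succ_of_lt hx)) hp.1,
    (h _ (Nat.lt_succ_self _)).symm.trans hp.2⟩

/-- The number that bounds the loops inside expressions. -/
def bnd (m : Mem) : ℕ := m 1 0

variable {Γ : Type} [Ctx Γ]

/-- `f` is computed by a program of running time polynomial in `bnd` that leaves the arrays unchanged,
reads its variables from given registers, and writes only registers from the result register on. -/
def Ev (f : Mem → Γ → ℕ) : Prop :=
  ∃ (q : (ℕ → ℕ) → ℕ → Program) (A : ℕ), ∀ (loc : ℕ → ℕ) (d : ℕ),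
    (∀ k < Ctx.size Γ, loc k < d) → ∀ (s : State) (γ : Γ), Ctx.Holds γ (fun k => s.reg (loc k)) →
      ∃ t s', Exec (q loc d) s t s' ∧ t ≤ (bnd s.arr + 2) ^ A ∧ s'.reg d = f s.arr γ ∧
        (∀ x < d, s'.reg x = s.reg x) ∧ s'.arr = s.arr

theorem Ev.const (k : ℕ) : Ev (fun _ (_ : Γ) => k) :=
  ⟨fun _ d => .const d k, 0, fun loc d _ s γ _ => ⟨1, _, .const d k s, by simp, by simp [State.setReg],
    fun x hx => by simp [State.setReg, Function.update_of_ne hx.ne], rfl⟩⟩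

theorem one_le_bound (N A : ℕ) : 1 ≤ (N + 2) ^ A := Nat.one_le_pow _ _ (by omega)

theorem bound_mono {N A B : ℕ} (h : A ≤ B) : (N + 2) ^ A ≤ (N + 2) ^ B :=
  Nat.pow_le_pow_right (by omega) h

/-- The base `N + 2` is at least 2, so constant factors are absorbed by the exponent. This keeps
every time bound a single power, with no leading constant to carry along. -/
theorem two_pow_mul_bound (N A k : ℕ) : 2 ^ k * (N + 2) ^ A ≤ (N + 2) ^ (A + k) := by
  rw [pow_add, mul_comm]
  exact Nat.mul_le_mul_left _ (Nat.pow_le_pow_left (by omega) k)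

theorem Ev.last : Ev (fun _ (p : Γ × ℕ) => p.2) := by
  -- There is no copy instruction; the variable is added to a cleared register, which is not its own
  -- because `loc k < d`.
  refine ⟨fun loc d => .seq (.const d 0) (.add d d (loc (Ctx.size Γ))), 1, fun loc d hd s γ h => ?_⟩
  have h0 : loc (Ctx.size Γ) < d := hd _ (Nat.lt_succ_self _)
  refine ⟨_, _, .seq (.const d 0 s) (.add ..), by simp, ?_, fun x hx => ?_, rfl⟩
  · have h2 : s.reg (loc (Ctx.size Γ)) = γ.2 := h.2
    simp [State.setReg, Function.update_of_ne h0.ne, h2]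
  · simp [State.setReg, Function.update_of_ne hx.ne]

theorem Ev.weaken {f : Mem → Γ → ℕ} (hf : Ev f) : Ev (fun m (p : Γ × ℕ) => f m p.1) := by
  obtain ⟨q, A, h⟩ := hf
  exact ⟨q, A, fun loc d hd s γ hγ => h loc d (fun k hk => hd k (Nat.lt_succ_of_lt hk)) s γ.1 hγ.1⟩

/-- Variables are found through `loc`, so skipping the middle variable only means redirecting one
value of `loc`. This is needed when the argument of a loop body is itself computed from the loop
variable. -/
theorem Ev.weaken_mid {h : Mem → Γ → ℕ → ℕ} (hf : Ev (fun m (p : Γ × ℕ) => h m p.1 p.2)) :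
    Ev (fun m (p : (Γ × ℕ) × ℕ) => h m p.1.1 p.2) := by
  obtain ⟨q, A, hq⟩ := hf
  refine ⟨fun loc d => q (Function.update loc (Ctx.size Γ) (loc (Ctx.size Γ + 1))) d, A,
    fun loc d hd s γ hγ => hq _ d (fun k hk => ?_) s (γ.1.1, γ.2) ⟨?_, ?_⟩⟩
  · by_cases h : k = Ctx.size Γ
    · subst h
      rw [Function.update_self]
      exact hd _ (Nat.lt_succ_self _)
    · rw [Function.update_of_ne h]
      exact hd _ (Nat.lt_succ_of_lt hk)
  · exact Ctx.congr (fun x hx => by simp [Function.update_of_ne hx.ne]) hγ.1.1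
  · simp only [Function.update_self]
    exact hγ.2

theorem Ev.of_eq {f g : Mem → Γ → ℕ} (hf : Ev f) (h : ∀ m γ, f m γ = g m γ) : Ev g := by
  have : f = g := by funext m γ; exact h m γ
  exact this ▸ hf

theorem Ev.load {f : Mem → Γ → ℕ} (a : ℕ) (hf : Ev f) : Ev (fun m γ => m a (f m γ)) := by
  obtain ⟨q, A, h⟩ := hf
  refine ⟨fun loc d => .seq (q loc d) (.load d a d), A + 1, fun loc d hd s γ hγ => ?_⟩
  obtain ⟨t, s', he, ht, hv, hr, ha⟩ := h loc d hd s γ hγ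
  refine ⟨_, _, .seq he (.load ..), ?_, ?_, fun x hx => ?_, ha⟩
  · have := two_pow_mul_bound (bnd s.arr) A 1
    have := one_le_bound (bnd s.arr) A
    omega
  · simp [State.setReg, hv, ha]
  · simp [State.setReg, Function.update_of_ne hx.ne, hr x hx]

theorem holds_congr {loc : ℕ → ℕ} {d : ℕ} (hd : ∀ k < Ctx.size Γ, loc k < d) {r r' : ℕ → ℕ}
    (h : ∀ x < d, r' x = r x) {γ : Γ} (hγ : Ctx.Holds γ (fun k => r (loc k))) :
    Ctx.Holds γ (fun k => r' (loc k)) :=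
  Ctx.congr (fun k hk => (h _ (hd k hk)).symm) hγ

/-- Running two evaluations in a row, the results being in registers `d` and `d + 1`. -/
theorem Ev.pair {f g : Mem → Γ → ℕ} (hf : Ev f) (hg : Ev g) :
    ∃ (q : (ℕ → ℕ) → ℕ → Program) (A : ℕ), ∀ (loc : ℕ → ℕ) (d : ℕ),
    (∀ k < Ctx.size Γ, loc k < d) → ∀ (s : State) (γ : Γ), Ctx.Holds γ (fun k => s.reg (loc k)) →
      ∃ t s', Exec (q loc d) s t s' ∧ t ≤ (bnd s.arr + 2) ^ A ∧ s'.reg d = f s.arr γ ∧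
        s'.reg (d + 1) = g s.arr γ ∧ (∀ x < d, s'.reg x = s.reg x) ∧ s'.arr = s.arr := by
  obtain ⟨q, A, h⟩ := hf
  obtain ⟨q', A', h'⟩ := hg
  refine ⟨fun loc d => .seq (q loc d) (q' loc (d + 1)), max A A' + 1, fun loc d hd s γ hγ => ?_⟩
  obtain ⟨t, s', he, ht, hv, hr, ha⟩ := h loc d hd s γ hγ
  obtain ⟨t', s'', he', ht', hv', hr', ha'⟩ := h' loc (d + 1) (fun k hk => (hd k hk).trans (by omega))
    s' γ (holds_congr hd hr hγ)
  refine ⟨_, _, .seq he he', ?_, ?_, by rw [hv', ha], fun x hx => ?_, ha'.trans ha⟩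
  · rw [ha] at ht'
    have := two_pow_mul_bound (bnd s.arr) (max A A') 1
    have := bound_mono (N := bnd s.arr) (le_max_left A A')
    have := bound_mono (N := bnd s.arr) (le_max_right A A')
    omega
  · rw [hr' d (by omega), hv]
  · rw [hr' x (by omega), hr x hx]

theorem Ev.add {f g : Mem → Γ → ℕ} (hf : Ev f) (hg : Ev g) : Ev (fun m γ => f m γ + g m γ) := by
  obtain ⟨q, A, h⟩ := hf.pair hg
  refine ⟨fun loc d => .seq (q loc d) (.add d d (d + 1)), A + 1, fun loc d hd s γ hγ => ?_⟩
  obtain ⟨t, s', he, ht, hv, hw, hr, ha⟩ := h loc d hd s γ hγ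
  refine ⟨_, _, .seq he (.add ..), ?_, ?_, fun x hx => ?_, ha⟩
  · have := two_pow_mul_bound (bnd s.arr) A 1
    have := one_le_bound (bnd s.arr) A
    omega
  · simp [State.setReg, hv, hw]
  · simp [State.setReg, Function.update_of_ne hx.ne, hr x hx]

theorem Ev.sub {f g : Mem → Γ → ℕ} (hf : Ev f) (hg : Ev g) : Ev (fun m γ => f m γ - g m γ) := by
  obtain ⟨q, A, h⟩ := hf.pair hg
  refine ⟨fun loc d => .seq (q loc d) (.sub d d (d + 1)), A + 1, fun loc d hd s γ hγ => ?_⟩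
  obtain ⟨t, s', he, ht, hv, hw, hr, ha⟩ := h loc d hd s γ hγ
  refine ⟨_, _, .seq he (.sub ..), ?_, ?_, fun x hx => ?_, ha⟩
  · have := two_pow_mul_bound (bnd s.arr) A 1
    have := one_le_bound (bnd s.arr) A
    omega
  · simp [State.setReg, hv, hw]
  · simp [State.setReg, Function.update_of_ne hx.ne, hr x hx]

theorem Ev.ite_ne {f g h : Mem → Γ → ℕ} (hf : Ev f) (hg : Ev g) (hh : Ev h) :
    Ev (fun m γ => if f m γ ≠ 0 then g m γ else h m γ) := by
  obtain ⟨q, A, hq⟩ := hf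
  obtain ⟨q₁, A₁, hq₁⟩ := hg
  obtain ⟨q₂, A₂, hq₂⟩ := hh
  refine ⟨fun loc d => .seq (q loc d) (.cond d (q₁ loc d) (q₂ loc d)), max A (max A₁ A₂) + 2,
    fun loc d hd s γ hγ => ?_⟩
  obtain ⟨t, s', he, ht, hv, hr, ha⟩ := hq loc d hd s γ hγ
  have hγ' := holds_congr hd hr hγ
  have k0 := two_pow_mul_bound (bnd s.arr) (max A (max A₁ A₂)) 2
  have k1 := bound_mono (N := bnd s.arr) (le_max_left A (max A₁ A₂))
  have k2 := bound_mono (N := bnd s.arr) ((le_max_left A₁ A₂).trans (le_max_right A _))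
  have k3 := bound_mono (N := bnd s.arr) ((le_max_right A₁ A₂).trans (le_max_right A _))
  have k4 := one_le_bound (bnd s.arr) A
  by_cases hc : f s.arr γ = 0
  · obtain ⟨t', s'', he', ht', hv', hr', ha'⟩ := hq₂ loc d hd s' γ hγ'
    rw [ha] at ht'
    exact ⟨_, _, .seq he (.cond_zero (hv.trans hc) he'), by omega, by simp [hv', ha, hc],
      fun x hx => by rw [hr' x hx, hr x hx], ha'.trans ha⟩
  · obtain ⟨t', s'', he', ht', hv', hr', ha'⟩ := hq₁ loc d hd s' γ hγ'
    rw [ha] at ht'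
    exact ⟨_, _, .seq he (.cond_ne_zero (hv ▸ hc) he'), by omega, by simp [hv', ha, hc],
      fun x hx => by rw [hr' x hx, hr x hx], ha'.trans ha⟩

/-- The context of a loop body: the loop variable is in register `e`. -/
theorem holds_snoc {loc : ℕ → ℕ} {r : ℕ → ℕ} {γ : Γ} {e i : ℕ}
    (hγ : Ctx.Holds γ (fun k => r (loc k))) (hi : r e = i) :
    Ctx.Holds (γ, i) (fun k => r (Function.update loc (Ctx.size Γ) e k)) := by
  refine ⟨Ctx.congr (fun x hx => ?_) hγ, ?_⟩
  · simp [Function.update_of_ne hx.ne]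
  · simpa using hi

theorem loc_snoc {loc : ℕ → ℕ} {d e d' : ℕ} (hd : ∀ k < Ctx.size Γ, loc k < d) (he : e < d')
    (hdd : d ≤ d') : ∀ k < Ctx.size (Γ × ℕ), Function.update loc (Ctx.size Γ) e k < d' := by
  intro k hk
  by_cases h : k = Ctx.size Γ
  · subst h; simpa using he
  · rw [Function.update_of_ne h]
    have : k < Ctx.size Γ + 1 := hk
    exact (hd k (by omega)).trans_le hdd

/-- Substitution: the value of `f` stays in register `d` and serves as the innermost variable of
`h`, which works from `d + 1` on; its result is then moved down to `d`. -/
theorem Ev.bind {f : Mem → Γ → ℕ} {h : Mem → Γ → ℕ → ℕ} (hf : Ev f)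
    (hh : Ev (fun m (p : Γ × ℕ) => h m p.1 p.2)) : Ev (fun m γ => h m γ (f m γ)) := by
  obtain ⟨q, A, hq⟩ := hf
  obtain ⟨q', A', hq'⟩ := hh
  refine ⟨fun loc d => .seq (q loc d) (.seq (q' (Function.update loc (Ctx.size Γ) d) (d + 1))
    (.seq (.const d 0) (.add d d (d + 1)))), max A A' + 2, fun loc d hd s γ hγ => ?_⟩
  obtain ⟨t, s', he, ht, hv, hr, ha⟩ := hq loc d hd s γ hγ
  obtain ⟨t', s'', he', ht', hv', hr', ha'⟩ := hq' (Function.update loc (Ctx.size Γ) d) (d + 1)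
    (loc_snoc hd (by omega) (by omega)) s' (γ, f s.arr γ) (holds_snoc (holds_congr hd hr hγ) hv)
  refine ⟨_, _, .seq he (.seq he' (.seq (.const ..) (.add ..))), ?_, ?_, fun x hx => ?_,
    ha'.trans ha⟩
  · rw [ha] at ht'
    have := two_pow_mul_bound (bnd s.arr) (max A A') 2
    have := bound_mono (N := bnd s.arr) (le_max_left A A')
    have := bound_mono (N := bnd s.arr) (le_max_right A A')
    have := one_le_bound (bnd s.arr) (max A A')
    omega
  · simp [State.setReg, hv', ha]
  · simp [State.setReg, Function.update_of_ne hx.ne, hr' x (by omega), hr x hx]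

/-- Repeated application. -/
def iter {α : Type*} (F : ℕ → α → α) : ℕ → α → α
  | 0, m => m
  | k + 1, m => F k (iter F k m)

theorem loop_bound (N g A : ℕ) (hg : g ≤ N) : g * ((N + 2) ^ A + 5) + 6 ≤ (N + 2) ^ (A + 4) := by
  have h1 := one_le_bound N A
  have h2 : (N + 2) ^ (A + 4) = (N + 2) ^ A * (N + 2) ^ 4 := pow_add ..
  have h3 : 6 * (N + 1) ≤ (N + 2) ^ 4 := by
    have : 4 * (N + 2) ≤ (N + 2) ^ 4 := by nlinarith [Nat.zero_le N, sq_nonneg N]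
    nlinarith [Nat.zero_le N, sq_nonneg N]
  rw [h2]
  nlinarith [Nat.mul_le_mul_left ((N + 2) ^ A) h3, Nat.mul_le_mul hg h1]

/-- The registers are: accumulator `d`, index `d + 1`, remaining rounds `d + 2`, the constant one `d
+ 3`, value of the body `d + 4`. The operation `o` may destroy what lies from `d + 4` on, since the
body recomputes it in each round. -/
theorem Ev.fold {h : Mem → Γ → ℕ → ℕ} (hh : Ev (fun m (p : Γ × ℕ) => h m p.1 p.2))
    {op : ℕ → ℕ → ℕ} {o : ℕ → Program}
    (ho : ∀ d s, ∃ t s', Exec (o d) s t s' ∧ t ≤ 2 ∧ s'.reg d = op (s.reg d) (s.reg (d + 4)) ∧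
      (∀ x < d + 4, x ≠ d → s'.reg x = s.reg x) ∧ s'.arr = s.arr) :
    Ev (fun m γ => iter (fun i acc => op acc (h m γ i)) (bnd m) 0) := by
  obtain ⟨q, A, hq⟩ := hh
  let body : (ℕ → ℕ) → ℕ → Program := fun loc d =>
    .seq (q (Function.update loc (Ctx.size Γ) (d + 1)) (d + 4)) (.seq (o d)
      (.seq (.add (d + 1) (d + 1) (d + 3)) (.sub (d + 2) (d + 2) (d + 3))))
  refine ⟨fun loc d => .seq (.const d 0) (.seq (.const (d + 1) 0) (.seq (.const (d + 2) 0)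
    (.seq (.load (d + 2) 1 (d + 2)) (.seq (.const (d + 3) 1) (.loop (d + 2) (body loc d)))))), A + 4,
    fun loc d hd s γ hγ => ?_⟩
  have key : ∀ (j : ℕ) (i : ℕ) (s₀ : State), i + j = bnd s.arr → s₀.arr = s.arr →
      (∀ x < d, s₀.reg x = s.reg x) → s₀.reg (d + 1) = i → s₀.reg (d + 2) = j → s₀.reg (d + 3) = 1 →
      s₀.reg d = iter (fun i acc => op acc (h s.arr γ i)) i 0 →
      ∃ t s', Exec (.loop (d + 2) (body loc d)) s₀ t s' ∧ t ≤ j * ((bnd s.arr + 2) ^ A + 5) + 1 ∧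
        s'.reg d = iter (fun i acc => op acc (h s.arr γ i)) (bnd s.arr) 0 ∧
        (∀ x < d, s'.reg x = s.reg x) ∧ s'.arr = s.arr := by
    intro j
    induction j with
    | zero =>
      intro i s₀ hij ha hr h1 h2 h3 h4
      refine ⟨_, _, .loop_zero h2, by omega, ?_, hr, ha⟩
      rw [h4]; congr 1
    | succ j ih =>
      intro i s₀ hij ha hr h1 h2 h3 h4
      obtain ⟨t, s₁, he, ht, hv, hr₁, ha₁⟩ := hq (Function.update loc (Ctx.size Γ) (d + 1)) (d + 4)
        (loc_snoc hd (by omega) (by omega)) s₀ (γ, i) (holds_snoc (holds_congr hd hr hγ) h1)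
      obtain ⟨t', s₂, he', ht', hv', hr₂, ha₂⟩ := ho d s₁
      obtain ⟨t'', s₃, he₃, ht₃, h₃⟩ := ih (i + 1)
        ((s₂.setReg (d + 1) (s₂.reg (d + 1) + s₂.reg (d + 3))).setReg (d + 2)
          (s₂.reg (d + 2) - s₂.reg (d + 3))) (by omega) (by simp [State.setReg, ha₂, ha₁, ha])
        (fun x hx => by
          simp only [State.setReg]
          rw [Function.update_of_ne (by omega), Function.update_of_ne (by omega),
            hr₂ x (by omega) (by omega), hr₁ x (by omega), hr x hx])
        (by
          simp only [State.setReg]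
          rw [Function.update_of_ne (by omega), Function.update_self, hr₂ _ (by omega) (by omega),
            hr₂ _ (by omega) (by omega), hr₁ _ (by omega), hr₁ _ (by omega), h1, h3])
        (by
          simp only [State.setReg]
          rw [Function.update_self, hr₂ _ (by omega) (by omega),
            hr₂ _ (by omega) (by omega), hr₁ _ (by omega), hr₁ _ (by omega), h2, h3]
          omega)
        (by
          simp only [State.setReg]
          rw [Function.update_of_ne (by omega), Function.update_of_ne (by omega),
            hr₂ _ (by omega) (by omega), hr₁ _ (by omega), h3])
        (by
          simp only [State.setReg]
          rw [Function.update_of_ne (by omega), Function.update_of_ne (by omega), hv', hv,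
            hr₁ _ (by omega), h4, ha]
          rfl)
      refine ⟨1 + (t + (t' + (1 + 1))) + t'', s₃,
        .loop_ne_zero (by omega) (.seq he (.seq he' (.seq (.add ..) (.sub ..)))) ?_, ?_, h₃⟩
      · convert he₃ using 2
        simp [State.setReg]
      · rw [ha] at ht
        rw [Nat.add_mul]
        omega
  obtain ⟨t, s', he, ht, hv, hr, ha⟩ := key (bnd s.arr) 0
    (((((s.setReg d 0).setReg (d + 1) 0).setReg (d + 2) 0).setReg (d + 2) (s.arr 1 0)).setReg (d + 3) 1)
    (by omega) rfl (fun x hx => by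
      simp only [State.setReg]
      iterate 5 rw [Function.update_of_ne (by omega)])
    (by simp [State.setReg]) (by simp [State.setReg, bnd])
    (by simp [State.setReg]) (by simp [State.setReg, iter])
  refine ⟨1 + (1 + (1 + (1 + (1 + t)))), s', .seq (.const ..) (.seq (.const ..) (.seq (.const ..)
    (.seq (.load ..) (.seq (.const ..) ?_)))), ?_, hv, hr, ha⟩
  · convert he using 2
    simp [State.setReg]
  · have := loop_bound (bnd s.arr) (bnd s.arr) A le_rfl
    omega

theorem Ev.sum {h : Mem → Γ → ℕ → ℕ} (hh : Ev (fun m (p : Γ × ℕ) => h m p.1 p.2)) :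
    Ev (fun m γ => ∑ i ∈ Finset.range (bnd m), h m γ i) := by
  refine (Ev.fold hh (op := (· + ·)) (o := fun d => .add d d (d + 4)) fun d s =>
    ⟨_, _, .add .., by omega, by simp [State.setReg],
      fun x _ hx => by simp [State.setReg, Function.update_of_ne hx], rfl⟩).of_eq fun m γ => ?_
  induction bnd m with
  | zero => rfl
  | succ k ih => rw [Finset.sum_range_succ, ← ih]; rfl

theorem Ev.sup {h : Mem → Γ → ℕ → ℕ} (hh : Ev (fun m (p : Γ × ℕ) => h m p.1 p.2)) :
    Ev (fun m γ => (Finset.range (bnd m)).sup fun i => h m γ i) := by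
  -- With truncated subtraction, max a x = a + (x - a).
  refine (Ev.fold hh (op := max) (o := fun d => .seq (.sub (d + 4) (d + 4) d) (.add d d (d + 4)))
    fun d s => ⟨_, _, .seq (.sub ..) (.add ..), by omega, ?_,
      fun x hx hx' => ?_, rfl⟩).of_eq fun m γ => ?_
  · simp only [State.setReg, Function.update_self]
    rw [Function.update_of_ne (by omega)]
    omega
  · simp only [State.setReg]
    rw [Function.update_of_ne hx', Function.update_of_ne (by omega)]
  · induction bnd m with
    | zero => rfl
    | succ k ih =>
      rw [Finset.range_add_one, Finset.sup_insert, ← ih]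
      exact max_comm _ _

open Classical in
/-- The truth value of `P` is computed by a program. -/
def EvP (P : Mem → Γ → Prop) : Prop := Ev (fun m γ => if P m γ then 1 else 0)

variable {P Q : Mem → Γ → Prop} {f g h : Mem → Γ → ℕ}

theorem EvP.of_iff (hP : EvP P) (h : ∀ m γ, P m γ ↔ Q m γ) : EvP Q := by
  have : P = Q := by funext m γ; exact propext (h m γ)
  exact this ▸ hP

theorem EvP.weaken_mid {P : Mem → Γ → ℕ → Prop} (hP : EvP (fun m (p : Γ × ℕ) => P m p.1 p.2)) :
    EvP (fun m (p : (Γ × ℕ) × ℕ) => P m p.1.1 p.2) := by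
  classical
  exact (Ev.weaken_mid (h := fun m γ i => if P m γ i then 1 else 0)
    (Ev.of_eq hP fun m p => by congr)).of_eq fun m γ => by congr

theorem EvP.lt (hf : Ev f) (hg : Ev g) : EvP (fun m γ => f m γ < g m γ) :=
  -- Subtracting from one twice turns any positive difference into 1 and keeps 0.
  ((Ev.const 1).sub ((Ev.const 1).sub (hg.sub hf))).of_eq fun m γ => by split_ifs <;> omega

theorem EvP.not (hP : EvP P) : EvP (fun m γ => ¬ P m γ) :=
  ((Ev.const 1).sub hP).of_eq fun m γ => by by_cases h : P m γ <;> simp [h]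

theorem EvP.and (hP : EvP P) (hQ : EvP Q) : EvP (fun m γ => P m γ ∧ Q m γ) :=
  ((Ev.add hP hQ).sub (Ev.const 1)).of_eq fun m γ => by
    by_cases h : P m γ <;> by_cases h' : Q m γ <;> simp [h, h']

theorem EvP.imp (hP : EvP P) (hQ : EvP Q) : EvP (fun m γ => P m γ → Q m γ) :=
  (hP.and hQ.not).not.of_iff fun m γ => by tauto

theorem EvP.or (hP : EvP P) (hQ : EvP Q) : EvP (fun m γ => P m γ ∨ Q m γ) :=
  (hP.not.and hQ.not).not.of_iff fun m γ => by tauto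

theorem EvP.iff (hP : EvP P) (hQ : EvP Q) : EvP (fun m γ => P m γ ↔ Q m γ) :=
  ((hP.imp hQ).and (hQ.imp hP)).of_iff fun m γ => by tauto

theorem EvP.le (hf : Ev f) (hg : Ev g) : EvP (fun m γ => f m γ ≤ g m γ) :=
  (EvP.lt hg hf).not.of_iff fun m γ => by omega

theorem EvP.eq (hf : Ev f) (hg : Ev g) : EvP (fun m γ => f m γ = g m γ) :=
  ((EvP.le hf hg).and (EvP.le hg hf)).of_iff fun m γ => by omega

theorem EvP.all {P : Mem → Γ → ℕ → Prop} (hP : EvP (fun m (p : Γ × ℕ) => P m p.1 p.2)) :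
    EvP (fun m γ => ∀ i < bnd m, P m γ i) := by
  classical
  refine ((Ev.const 1).sub (Ev.sum (h := fun m γ i => if ¬ P m γ i then 1 else 0) ?_)).of_eq
    fun m γ => ?_
  · exact hP.not.of_eq fun m p => by congr
  · split_ifs with h
    · rw [Finset.sum_eq_zero fun i hi => if_neg (not_not.2 (h i (Finset.mem_range.1 hi))), Nat.sub_zero]
    · push Not at h
      obtain ⟨i, hi, hP⟩ := h
      have := Finset.single_le_sum (f := fun i => if ¬ P m γ i then 1 else 0)
        (fun _ _ => Nat.zero_le _) (Finset.mem_range.2 hi)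
      simp only [if_pos hP] at this
      omega

theorem EvP.ex {P : Mem → Γ → ℕ → Prop} (hP : EvP (fun m (p : Γ × ℕ) => P m p.1 p.2)) :
    EvP (fun m γ => ∃ i < bnd m, P m γ i) :=
  (EvP.all (P := fun m γ i => ¬ P m γ i) hP.not).not.of_iff fun m γ => by push Not; rfl

theorem Ev.ite [∀ m γ, Decidable (P m γ)] (hP : EvP P) (hf : Ev f) (hg : Ev g) :
    Ev (fun m γ => if P m γ then f m γ else g m γ) :=
  (Ev.ite_ne hP hf hg).of_eq fun m γ => by by_cases h : P m γ <;> simp [h]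

theorem EvP.bind {P : Mem → Γ → ℕ → Prop} (hf : Ev f)
    (hP : EvP (fun m (p : Γ × ℕ) => P m p.1 p.2)) : EvP (fun m γ => P m γ (f m γ)) := by
  classical
  refine (Ev.bind (h := fun m γ i => if P m γ i then 1 else 0) hf
    (Ev.of_eq hP fun m p => by congr)).of_eq fun m γ => by congr

theorem Ev.bound : Ev (fun m (_ : Γ) => bnd m) := Ev.load 1 (Ev.const 0)

/-- Writing an array cell. -/
def write (m : Mem) (a i v : ℕ) : Mem := Function.update m a (Function.update (m a) i v)

/-- `F` is the effect on the arrays of a program of running time polynomial in `bnd`. -/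
def Stm (F : Mem → Γ → Mem) : Prop :=
  ∃ (q : (ℕ → ℕ) → ℕ → Program) (A : ℕ), ∀ (loc : ℕ → ℕ) (d : ℕ),
    (∀ k < Ctx.size Γ, loc k < d) → ∀ (s : State) (γ : Γ), Ctx.Holds γ (fun k => s.reg (loc k)) →
      ∃ t s', Exec (q loc d) s t s' ∧ t ≤ (bnd s.arr + 2) ^ A ∧
        (∀ x < d, s'.reg x = s.reg x) ∧ s'.arr = F s.arr γ

theorem Stm.store (a : ℕ) (hf : Ev f) (hg : Ev g) :
    Stm (fun m γ => write m a (f m γ) (g m γ)) := by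
  obtain ⟨q, A, h⟩ := hf.pair hg
  refine ⟨fun loc d => .seq (q loc d) (.store a d (d + 1)), A + 1, fun loc d hd s γ hγ => ?_⟩
  obtain ⟨t, s', he, ht, hv, hw, hr, ha⟩ := h loc d hd s γ hγ
  refine ⟨_, _, .seq he (.store ..), ?_, hr, ?_⟩
  · have := two_pow_mul_bound (bnd s.arr) A 1
    have := one_le_bound (bnd s.arr) A
    omega
  · simp [State.setArr, write, hv, hw, ha]

/-- The time of the second statement is measured by the bound that it finds, hence the condition
that the first one does not change the bound. -/
theorem Stm.seq {F F' : Mem → Γ → Mem} (hF : Stm F) (hF' : Stm F')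
    (hb : ∀ m γ, bnd (F m γ) = bnd m) : Stm (fun m γ => F' (F m γ) γ) := by
  obtain ⟨q, A, h⟩ := hF
  obtain ⟨q', A', h'⟩ := hF'
  refine ⟨fun loc d => .seq (q loc d) (q' loc d), max A A' + 1, fun loc d hd s γ hγ => ?_⟩
  obtain ⟨t, s', he, ht, hr, ha⟩ := h loc d hd s γ hγ
  obtain ⟨t', s'', he', ht', hr', ha'⟩ := h' loc d hd s' γ (holds_congr hd hr hγ)
  refine ⟨_, _, .seq he he', ?_, fun x hx => by rw [hr' x hx, hr x hx], by rw [ha', ha]⟩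
  rw [ha, hb] at ht'
  have := two_pow_mul_bound (bnd s.arr) (max A A') 1
  have := bound_mono (N := bnd s.arr) (le_max_left A A')
  have := bound_mono (N := bnd s.arr) (le_max_right A A')
  omega

/-- A loop whose body preserves `bnd`. -/
theorem Stm.exists_loop {F : Mem → Γ → ℕ → Mem} (hF : Stm (fun m (p : Γ × ℕ) => F m p.1 p.2)) (hg : Ev g)
    (hb : ∀ m γ i, bnd (F m γ i) = bnd m) :
    ∃ (q : (ℕ → ℕ) → ℕ → Program) (A : ℕ), ∀ (loc : ℕ → ℕ) (d : ℕ),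
      (∀ k < Ctx.size Γ, loc k < d) → ∀ (s : State) (γ : Γ), Ctx.Holds γ (fun k => s.reg (loc k)) →
      ∃ t s', Exec (q loc d) s t s' ∧ t ≤ (g s.arr γ + 1) * (bnd s.arr + 2) ^ A ∧
        (∀ x < d, s'.reg x = s.reg x) ∧ s'.arr = iter (fun i m => F m γ i) (g s.arr γ) s.arr := by
  obtain ⟨q, A, hq⟩ := hF
  obtain ⟨qg, B, hg⟩ := hg
  let body : (ℕ → ℕ) → ℕ → Program := fun loc d =>
    .seq (q (Function.update loc (Ctx.size Γ) (d + 1)) (d + 3))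
      (.seq (.add (d + 1) (d + 1) (d + 2)) (.sub d d (d + 2)))
  -- The number of rounds is evaluated once, before the loop, so the body is free to change the
  -- cells from which it was computed.
  refine ⟨fun loc d => .seq (qg loc d) (.seq (.const (d + 1) 0) (.seq (.const (d + 2) 1)
    (.loop d (body loc d)))), max A B + 3, fun loc d hd s γ hγ => ?_⟩
  set G := g s.arr γ with hG
  have hbi : ∀ i, bnd (iter (fun i m => F m γ i) i s.arr) = bnd s.arr := by
    intro i
    induction i with
    | zero => rfl
    | succ i ih => rw [iter, hb, ih]
  have key : ∀ (j : ℕ) (i : ℕ) (s₀ : State), i + j = G →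
      s₀.arr = iter (fun i m => F m γ i) i s.arr →
      (∀ x < d, s₀.reg x = s.reg x) → s₀.reg (d + 1) = i → s₀.reg d = j → s₀.reg (d + 2) = 1 →
      ∃ t s', Exec (.loop d (body loc d)) s₀ t s' ∧ t ≤ j * ((bnd s.arr + 2) ^ A + 3) + 1 ∧
        (∀ x < d, s'.reg x = s.reg x) ∧ s'.arr = iter (fun i m => F m γ i) G s.arr := by
    intro j
    induction j with
    | zero =>
      intro i s₀ hij ha hr h1 h2 h3
      refine ⟨_, _, .loop_zero h2, by omega, hr, ?_⟩
      rw [ha]; congr 1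
    | succ j ih =>
      intro i s₀ hij ha hr h1 h2 h3
      obtain ⟨t, s₁, he, ht, hr₁, ha₁⟩ := hq (Function.update loc (Ctx.size Γ) (d + 1)) (d + 3)
        (loc_snoc hd (by omega) (by omega)) s₀ (γ, i) (holds_snoc (holds_congr hd hr hγ) h1)
      obtain ⟨t'', s₃, he₃, ht₃, h₃⟩ := ih (i + 1)
        ((s₁.setReg (d + 1) (s₁.reg (d + 1) + s₁.reg (d + 2))).setReg d
          (s₁.reg d - s₁.reg (d + 2))) (by omega) (by simp [State.setReg, ha₁, ha, iter])
        (fun x hx => by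
          simp only [State.setReg]
          rw [Function.update_of_ne (by omega), Function.update_of_ne (by omega),
            hr₁ x (by omega), hr x hx])
        (by
          simp only [State.setReg]
          rw [Function.update_of_ne (by omega), Function.update_self,
            hr₁ _ (by omega), hr₁ _ (by omega), h1, h3])
        (by
          simp only [State.setReg]
          rw [Function.update_self, hr₁ _ (by omega), hr₁ _ (by omega), h2, h3]
          omega)
        (by
          simp only [State.setReg]
          rw [Function.update_of_ne (by omega), Function.update_of_ne (by omega),
            hr₁ _ (by omega), h3])
      refine ⟨1 + (t + (1 + 1)) + t'', s₃,
        .loop_ne_zero (by omega) (.seq he (.seq (.add ..) (.sub ..))) ?_, ?_, h₃⟩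
      · convert he₃ using 2
        simp [State.setReg]
      · rw [ha, hbi] at ht
        rw [Nat.add_mul]
        omega
  obtain ⟨t₀, s₀, he₀, ht₀, hv₀, hr₀, ha₀⟩ := hg loc d hd s γ hγ
  obtain ⟨t, s', he, ht, hr, ha⟩ := key G 0 ((s₀.setReg (d + 1) 0).setReg (d + 2) 1)
    (by omega) (by simp [State.setReg, ha₀, iter]) (fun x hx => by
      simp only [State.setReg]
      rw [Function.update_of_ne (by omega), Function.update_of_ne (by omega), hr₀ x hx])
    (by simp [State.setReg]) (by simp [State.setReg, hv₀, hG])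
    (by simp [State.setReg])
  refine ⟨_, s', .seq he₀ (.seq (.const ..) (.seq (.const ..) he)), ?_, hr, ha⟩
  have k0 : (bnd s.arr + 2) ^ (max A B + 3) = (bnd s.arr + 2) ^ 3 * (bnd s.arr + 2) ^ max A B := by
    rw [pow_add, mul_comm]
  have k1 := bound_mono (N := bnd s.arr) (le_max_left A B)
  have k2 := bound_mono (N := bnd s.arr) (le_max_right A B)
  have k3 := one_le_bound (bnd s.arr) (max A B)
  have k4 : 2 ^ 3 ≤ (bnd s.arr + 2) ^ 3 := Nat.pow_le_pow_left (by omega) 3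
  have k5 := Nat.mul_le_mul_right ((bnd s.arr + 2) ^ max A B) k4
  rw [k0]
  have k6 : G * ((bnd s.arr + 2) ^ A + 3) ≤ G * (4 * (bnd s.arr + 2) ^ max A B) :=
    Nat.mul_le_mul_left _ (by omega)
  calc _ ≤ 4 * (G + 1) * (bnd s.arr + 2) ^ max A B + 4 * (bnd s.arr + 2) ^ max A B := by
        rw [mul_add, mul_one, add_mul]; nlinarith
    _ ≤ (G + 1) * (8 * (bnd s.arr + 2) ^ max A B) := by nlinarith
    _ ≤ _ := Nat.mul_le_mul_left _ k5

theorem Stm.loop_bnd {F : Mem → Γ → ℕ → Mem} (hF : Stm (fun m (p : Γ × ℕ) => F m p.1 p.2))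
    (hb : ∀ m γ i, bnd (F m γ i) = bnd m) :
    Stm (fun m γ => iter (fun i m => F m γ i) (bnd m) m) := by
  obtain ⟨q, A, h⟩ := Stm.exists_loop hF Ev.bound hb
  refine ⟨q, A + 1, fun loc d hd s γ hγ => ?_⟩
  obtain ⟨t, s', he, ht, hr, ha⟩ := h loc d hd s γ hγ
  refine ⟨t, s', he, ht.trans ?_, hr, ha⟩
  rw [pow_succ']
  exact Nat.mul_le_mul_right _ (by omega)

/-- `F` is the effect on the arrays of a program whose running time is `W` up to a factor polynomial in
`bnd`. -/
def Phase (F : Mem → Mem) (W : Mem → ℕ) : Prop :=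
  ∃ (q : Program) (A : ℕ), ∀ s : State, ∃ t s', Exec q s t s' ∧
    t ≤ (W s.arr + 1) * (bnd s.arr + 2) ^ A ∧ s'.arr = F s.arr

theorem Phase.stm {F : Mem → Unit → Mem} (hF : Stm F) : Phase (fun m => F m ()) (fun _ => 0) := by
  obtain ⟨q, A, h⟩ := hF
  refine ⟨q id 0, A, fun s => ?_⟩
  obtain ⟨t, s', he, ht, -, ha⟩ := h id 0 (fun k hk => absurd hk (Nat.not_lt_zero k)) s () trivial
  exact ⟨t, s', he, by simpa using ht, ha⟩

theorem Phase.loop {F : Mem → ℕ → Mem} (hF : Stm (fun m (p : Unit × ℕ) => F m p.2)) {g : Mem → ℕ}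
    (hg : Ev (fun m (_ : Unit) => g m)) (hb : ∀ m i, bnd (F m i) = bnd m) :
    Phase (fun m => iter (fun i m => F m i) (g m) m) g := by
  obtain ⟨q, A, h⟩ := Stm.exists_loop (F := fun m _ i => F m i) hF hg (fun m _ i => hb m i)
  refine ⟨q id 0, A, fun s => ?_⟩
  obtain ⟨t, s', he, ht, -, ha⟩ := h id 0 (fun k hk => absurd hk (Nat.not_lt_zero k)) s () trivial
  exact ⟨t, s', he, ht, ha⟩

end RAM

/-! ### The recursion of the dynamic programme as a computable expression -/

namespace RAM

/-- The data that one step of the dynamic programme reads: the rooted tree with its bags, the adjacency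
matrix, the digits of the codes of states, and the table of the values found so far. -/
structure Data where
  N : ℕ
  nch : ℕ → ℕ
  child : ℕ → ℕ → ℕ
  size : ℕ → ℕ
  elem : ℕ → ℕ → ℕ
  adj : ℕ → ℕ → ℕ
  dig : ℕ → ℕ → ℕ
  tab : ℕ → ℕ → ℕ

namespace Data

variable (Δ : Data)

open Classical in
/-- Sum over the elements of the bag `j`. -/
noncomputable def sumBag (j : ℕ) (h : ℕ → ℕ) : ℕ :=
  ∑ q ∈ Finset.range Δ.N, if q < Δ.size j then h (Δ.elem j q) else 0

/-- All elements of the bag `j` satisfy `P`. -/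
def AllBag (j : ℕ) (P : ℕ → Prop) : Prop := ∀ q < Δ.N, q < Δ.size j → P (Δ.elem j q)

/-- `v` is an element of the bag `j`. -/
def InBag (j v : ℕ) : Prop := ∃ q < Δ.N, q < Δ.size j ∧ Δ.elem j q = v

open Classical in
/-- The labels that the code `c` gives to the element `v` of the bag `i`: the position for `κ = 0`, the
side for `κ = 1`, the number of tight edges for `κ = 2`. -/
noncomputable def lab (κ i c v : ℕ) : ℕ :=
  ∑ q ∈ Finset.range Δ.N, if q < Δ.size i ∧ Δ.elem i q = v then Δ.dig c (3 * q + κ) else 0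

/-- The edge `uv` is processed when going from the child `j` to `i`. -/
def New (i u v : ℕ) : Prop := Δ.adj u v ≠ 0 ∧ (¬ Δ.InBag i u ∨ ¬ Δ.InBag i v)

open Classical in
/-- The number of newly processed tight edges at `u`. -/
noncomputable def ndeg (i j e u : ℕ) : ℕ :=
  Δ.sumBag j fun v => if Δ.New i u v ∧ Δ.lab 0 j e u = Δ.lab 0 j e v then 1 else 0

/-- The state `e` of the child `j` agrees with the state `c` of `i`. -/
def ChildOK (i c j e : ℕ) : Prop :=
  Δ.tab j e ≠ 0 ∧
  Δ.AllBag j fun u =>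
    (Δ.InBag i u → Δ.lab 1 i c u = Δ.lab 1 j e u) ∧
    (¬ Δ.InBag i u → Δ.lab 2 j e u + Δ.ndeg i j e u ≤ 1) ∧
    Δ.AllBag j fun v =>
      (Δ.InBag i u → Δ.InBag i v →
        (Δ.lab 0 i c u < Δ.lab 0 i c v ↔ Δ.lab 0 j e u < Δ.lab 0 j e v)) ∧
      (Δ.New i u v →
        (Δ.lab 1 j e u = 0 ∧ Δ.lab 1 j e v = 1 ∧ Δ.lab 0 j e u ≤ Δ.lab 0 j e v) ∨
        (Δ.lab 1 j e v = 0 ∧ Δ.lab 1 j e u = 1 ∧ Δ.lab 0 j e v ≤ Δ.lab 0 j e u))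

open Classical in
/-- The number of newly processed tight edges. -/
noncomputable def gain (i j e : ℕ) : ℕ :=
  Δ.sumBag j fun u => if Δ.lab 1 j e u = 0 then Δ.ndeg i j e u else 0

/-- The codes `c₁`, `c₂` as a function of the number of the child. -/
def pick (c₁ c₂ a : ℕ) : ℕ := if a = 0 then c₁ else c₂

open Classical in
/-- Sum over the children of `i`, whose codes are `c₁` and `c₂`. -/
noncomputable def sumChild (i c₁ c₂ : ℕ) (h : ℕ → ℕ → ℕ) : ℕ :=
  ∑ a ∈ Finset.range Δ.N, if a < Δ.nch i then h (Δ.child i a) (pick c₁ c₂ a) else 0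

open Classical in
/-- The states `c₁`, `c₂` of the children of `i` agree with the state `c`. -/
def OK (i c c₁ c₂ : ℕ) : Prop :=
  (∀ a < Δ.N, a < Δ.nch i → Δ.ChildOK i c (Δ.child i a) (pick c₁ c₂ a)) ∧
  Δ.AllBag i fun u => Δ.lab 2 i c u ≤ 1 ∧
    Δ.lab 2 i c u = Δ.sumChild i c₁ c₂ fun j e =>
      if Δ.InBag j u then Δ.lab 2 j e u + Δ.ndeg i j e u else 0

open Classical in
/-- The table entry for the state `c` of the node `i`: `0` if there is no partial solution, and
otherwise one more than the largest number of processed tight edges. -/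
noncomputable def step (i c : ℕ) : ℕ :=
  (Finset.range Δ.N).sup fun c₁ => (Finset.range Δ.N).sup fun c₂ =>
    if Δ.OK i c c₁ c₂ then 1 + Δ.sumChild i c₁ c₂ fun j e => Δ.tab j e - 1 + Δ.gain i j e else 0

end Data

/-- Multiplication by a loop of length `N`. -/
def bmul (N a b : ℕ) : ℕ := ∑ l ∈ Finset.range N, if l < a then b else 0

/-- Division by a loop of length `N`. -/
def bdiv (N a b : ℕ) : ℕ := ∑ i ∈ Finset.range N, if bmul N (i + 1) b ≤ a then 1 else 0

/-- The data in the memory. Array `0` holds the input, array `1` the bound, array `2` the multiples of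
the number of vertices, array `3` the adjacency matrix, array `4` the offsets of the bags, array `5` the
base of the codes, array `6` its powers, array `9` the table. -/
def dataOf (m : Mem) : Data where
  N := bnd m
  nch i := m 0 (m 4 i)
  child i a := m 0 (m 4 i + 1 + a)
  size i := m 0 (m 4 i + 1 + m 0 (m 4 i))
  elem i q := m 0 (m 4 i + 2 + m 0 (m 4 i) + q)
  adj u v := m 3 (m 2 u + v)
  dig c j := bdiv (bnd m) c (m 6 j) - bmul (bnd m) (bdiv (bnd m) (bdiv (bnd m) c (m 6 j)) (m 5 0)) (m 5 0)
  tab i c := m 9 (bmul (bnd m) (bnd m) i + c)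

variable {Γ : Type} [Ctx Γ] {i j c e u v a c₁ c₂ : Mem → Γ → ℕ}

theorem Ev.bmul (hu : Ev u) (hv : Ev v) : Ev (fun m γ => bmul (bnd m) (u m γ) (v m γ)) :=
  Ev.sum (.ite (.lt .last hu.weaken) hv.weaken (.const 0))

theorem Ev.bdiv (hu : Ev u) (hv : Ev v) : Ev (fun m γ => bdiv (bnd m) (u m γ) (v m γ)) :=
  Ev.sum (.ite (.le (.bmul (.add .last (.const 1)) hv.weaken) hu.weaken) (.const 1) (.const 0))

theorem Ev.nch (hi : Ev i) : Ev (fun m γ => (dataOf m).nch (i m γ)) := .load 0 (.load 4 hi)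

theorem Ev.child (hi : Ev i) (ha : Ev a) : Ev (fun m γ => (dataOf m).child (i m γ) (a m γ)) :=
  .load 0 (.add (.add (.load 4 hi) (.const 1)) ha)

theorem Ev.size (hi : Ev i) : Ev (fun m γ => (dataOf m).size (i m γ)) :=
  .load 0 (.add (.add (.load 4 hi) (.const 1)) (.load 0 (.load 4 hi)))

theorem Ev.elem (hi : Ev i) (ha : Ev a) : Ev (fun m γ => (dataOf m).elem (i m γ) (a m γ)) :=
  .load 0 (.add (.add (.add (.load 4 hi) (.const 2)) (.load 0 (.load 4 hi))) ha)

theorem Ev.adj (hu : Ev u) (hv : Ev v) : Ev (fun m γ => (dataOf m).adj (u m γ) (v m γ)) :=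
  .load 3 (.add (.load 2 hu) hv)

theorem Ev.dig (hc : Ev c) (hj : Ev j) : Ev (fun m γ => (dataOf m).dig (c m γ) (j m γ)) :=
  have h : Ev _ := .bdiv hc (.load 6 hj)
  have hK : Ev (fun (m : Mem) (_ : Γ) => m 5 0) := .load 5 (.const 0)
  .sub h (.bmul (.bdiv h hK) hK)

theorem Ev.tab (hi : Ev i) (hc : Ev c) : Ev (fun m γ => (dataOf m).tab (i m γ) (c m γ)) :=
  .load 9 (.add (.bmul .bound hi) hc)

theorem Ev.sumBag (hj : Ev j) {h : Mem → Γ → ℕ → ℕ} (hh : Ev (fun m (p : Γ × ℕ) => h m p.1 p.2)) :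
    Ev (fun m γ => (dataOf m).sumBag (j m γ) (h m γ)) :=
  Ev.sum (.ite (.lt .last hj.weaken.size)
    (Ev.bind (f := fun m (p : Γ × ℕ) => (dataOf m).elem (j m p.1) p.2) (h := fun m p => h m p.1)
      (.elem hj.weaken .last) hh.weaken_mid) (.const 0))

theorem EvP.allBag (hj : Ev j) {P : Mem → Γ → ℕ → Prop}
    (hP : EvP (fun m (p : Γ × ℕ) => P m p.1 p.2)) :
    EvP (fun m γ => (dataOf m).AllBag (j m γ) (P m γ)) :=
  EvP.all (.imp (.lt .last hj.weaken.size)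
    (EvP.bind (f := fun m (p : Γ × ℕ) => (dataOf m).elem (j m p.1) p.2) (P := fun m p => P m p.1)
      (.elem hj.weaken .last) hP.weaken_mid))

theorem EvP.inBag (hj : Ev j) (hv : Ev v) : EvP (fun m γ => (dataOf m).InBag (j m γ) (v m γ)) :=
  EvP.ex (.and (.lt .last hj.weaken.size) (.eq (.elem hj.weaken .last) hv.weaken))

theorem Ev.lab (κ : ℕ) (hi : Ev i) (hc : Ev c) (hv : Ev v) :
    Ev (fun m γ => (dataOf m).lab κ (i m γ) (c m γ) (v m γ)) :=
  Ev.sum (.ite (.and (.lt .last hi.weaken.size) (.eq (.elem hi.weaken .last) hv.weaken))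
    (.dig hc.weaken (.add (.of_eq (.add .last (.add .last .last)) fun m p => by omega) (.const κ)))
    (.const 0))

theorem EvP.new (hi : Ev i) (hu : Ev u) (hv : Ev v) :
    EvP (fun m γ => (dataOf m).New (i m γ) (u m γ) (v m γ)) :=
  .and (.not (.eq (.adj hu hv) (.const 0))) (.or (.not (.inBag hi hu)) (.not (.inBag hi hv)))

open Classical in
theorem Ev.ndeg (hi : Ev i) (hj : Ev j) (he : Ev e) (hu : Ev u) :
    Ev (fun m γ => (dataOf m).ndeg (i m γ) (j m γ) (e m γ) (u m γ)) :=
  Ev.sumBag hj (.ite (.and (.new hi.weaken hu.weaken .last)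
    (.eq (.lab 0 hj.weaken he.weaken hu.weaken) (.lab 0 hj.weaken he.weaken .last)))
    (.const 1) (.const 0))

theorem EvP.childOK (hi : Ev i) (hc : Ev c) (hj : Ev j) (he : Ev e) :
    EvP (fun m γ => (dataOf m).ChildOK (i m γ) (c m γ) (j m γ) (e m γ)) := by
  have hi' := hi.weaken
  have hj' := hj.weaken
  have hc' := hc.weaken
  have he' := he.weaken
  have hi'' := hi'.weaken
  have hj'' := hj'.weaken
  have hc'' := hc'.weaken
  have he'' := he'.weaken
  have hu : Ev (fun _ (p : (Γ × ℕ) × ℕ) => p.1.2) := Ev.last.weaken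
  have l (κ) := Ev.lab κ hj'' he'' hu
  have l' (κ) := Ev.lab κ hj'' he'' Ev.last
  exact .and (.not (.eq (.tab hj he) (.const 0))) (EvP.allBag hj (.and
    (.imp (.inBag hi' .last) (.eq (.lab 1 hi' hc' .last) (.lab 1 hj' he' .last))) (.and
    (.imp (.not (.inBag hi' .last)) (.le (.add (.lab 2 hj' he' .last) (.ndeg hi' hj' he' .last))
      (.const 1)))
    (EvP.allBag hj' (.and
      (.imp (.inBag hi'' hu) (.imp (.inBag hi'' .last) (.iff
        (.lt (.lab 0 hi'' hc'' hu) (.lab 0 hi'' hc'' .last)) (.lt (l 0) (l' 0)))))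
      (.imp (.new hi'' hu .last) (.or
        (.and (.eq (l 1) (.const 0)) (.and (.eq (l' 1) (.const 1)) (.le (l 0) (l' 0))))
        (.and (.eq (l' 1) (.const 0)) (.and (.eq (l 1) (.const 1)) (.le (l' 0) (l 0)))))))))))

theorem Ev.gain (hi : Ev i) (hj : Ev j) (he : Ev e) :
    Ev (fun m γ => (dataOf m).gain (i m γ) (j m γ) (e m γ)) :=
  Ev.sumBag hj (.ite (.eq (.lab 1 hj.weaken he.weaken .last) (.const 0))
    (.ndeg hi.weaken hj.weaken he.weaken .last) (.const 0))

theorem Ev.pick (h₁ : Ev c₁) (h₂ : Ev c₂) (ha : Ev a) :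
    Ev (fun m γ => Data.pick (c₁ m γ) (c₂ m γ) (a m γ)) :=
  .ite (.eq ha (.const 0)) h₁ h₂

/-- The summand is assumed computable for arbitrary computable arguments, because it is applied to a
child and a code that are themselves computed from the loop variable. -/
theorem Ev.sumChild (hi : Ev i) (h₁ : Ev c₁) (h₂ : Ev c₂) {h : Mem → Γ → ℕ → ℕ → ℕ}
    (hh : ∀ {j e : Mem → Γ × ℕ → ℕ}, Ev j → Ev e → Ev (fun m p => h m p.1 (j m p) (e m p))) :
    Ev (fun m γ => (dataOf m).sumChild (i m γ) (c₁ m γ) (c₂ m γ) (h m γ)) :=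
  Ev.sum (.ite (.lt .last hi.weaken.nch) (hh (.child hi.weaken .last)
    (.pick h₁.weaken h₂.weaken .last)) (.const 0))

open Classical in
theorem EvP.ok (hi : Ev i) (hc : Ev c) (h₁ : Ev c₁) (h₂ : Ev c₂) :
    EvP (fun m γ => (dataOf m).OK (i m γ) (c m γ) (c₁ m γ) (c₂ m γ)) :=
  .and (EvP.all (.imp (.lt .last hi.weaken.nch) (.childOK hi.weaken hc.weaken
      (.child hi.weaken .last) (.pick h₁.weaken h₂.weaken .last))))
    (EvP.allBag hi (.and (.le (.lab 2 hi.weaken hc.weaken .last) (.const 1))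
      (.eq (.lab 2 hi.weaken hc.weaken .last) (Ev.sumChild hi.weaken h₁.weaken h₂.weaken
        fun hj he => .ite (.inBag hj Ev.last.weaken)
          (.add (.lab 2 hj he Ev.last.weaken) (.ndeg hi.weaken.weaken hj he Ev.last.weaken))
          (.const 0)))))

open Classical in
theorem Ev.step (hi : Ev i) (hc : Ev c) : Ev (fun m γ => (dataOf m).step (i m γ) (c m γ)) :=
  Ev.sup (Ev.sup (.ite
    (.ok hi.weaken.weaken hc.weaken.weaken Ev.last.weaken .last)
    (.add (.const 1) (Ev.sumChild hi.weaken.weaken Ev.last.weaken .last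
      fun hj he => .add (.sub (.tab hj he) (.const 1)) (.gain hi.weaken.weaken.weaken hj he)))
    (.const 0)))

end RAM

/-! ### Subtrees of a rooted tree decomposition and the vertices in them -/

namespace SimpleGraph.TreeDecomposition

variable {V I : Type*} {G : SimpleGraph V} (D : G.TreeDecomposition I) (r : I)

variable {D r}

theorem isChild_or_isChild_of_adj {x y : I} (h : D.tree.Adj x y) :
    D.IsChild r x y ∨ D.IsChild r y x := by
  rcases D.isTree.dist_eq_dist_add_one_of_adj r h with h' | h'
  · exact Or.inr ⟨h.symm, h'⟩
  · exact Or.inl ⟨h, h'⟩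

/-- A shortest path from the root to a parent of `j`, extended by `j`, is again shortest and thus a
path; in a tree there is only one path from the root to `j`. -/
theorem IsChild.parent_unique {i k j : I} (hi : D.IsChild r i j) (hk : D.IsChild r k j) : i = k := by
  have key : ∀ i, D.IsChild r i j → ∃ p : D.tree.Walk r j, p.IsPath ∧ p.penultimate = i := by
    intro i hi
    obtain ⟨q, hq, hq'⟩ := D.isTree.connected.exists_path_of_dist r i
    refine ⟨q.concat hi.1, Walk.isPath_of_length_eq_dist _ ?_, by simp⟩
    rw [Walk.length_concat, hq', hi.2]
  obtain ⟨p, hp, rfl⟩ := key i hi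
  obtain ⟨q, hq, rfl⟩ := key k hk
  rw [(D.isTree.existsUnique_path r j).unique hp hq]

variable (D r) in
/-- `D.Desc r j t` : `t` is a descendant of `j`, or `j` itself. -/
def Desc (j t : I) : Prop := Relation.ReflTransGen (D.IsChild r) j t

theorem Desc.dist_le {j t : I} (h : D.Desc r j t) : D.tree.dist r j ≤ D.tree.dist r t := by
  induction h with
  | refl => rfl
  | tail _ h ih => exact ih.trans (h.2 ▸ Nat.le_succ _)

theorem desc_root (t : I) : D.Desc r r t := by
  induction h : D.tree.dist r t generalizing t with
  | zero => rw [(D.isTree.connected.dist_eq_zero_iff).1 h]; exact .refl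
  | succ k ih =>
    obtain ⟨p, hp⟩ := D.isTree.connected.exists_walk_length_eq_dist r t
    have hnil : ¬ p.Nil := by
      rw [Walk.not_nil_iff_lt_length]; omega
    have hadj := p.adj_penultimate hnil
    have hd : D.tree.dist r p.penultimate ≤ k := by
      have := dist_le p.dropLast
      have := p.length_dropLast_add_one hnil
      omega
    rcases isChild_or_isChild_of_adj (r := r) hadj with h' | h'
    · exact (ih _ (by have := h'.2; omega)).tail h'
    · have := h'.2; omega

theorem Desc.eq_or_parent {j t x : I} (h : D.Desc r j t) (hx : D.IsChild r x t) :
    t = j ∨ D.Desc r j x := by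
  cases h with
  | refl => exact Or.inl rfl
  | tail h h' => exact Or.inr (h'.parent_unique hx ▸ h)

/-- By uniqueness of parents the ancestors of `t` form a chain, and depths along it are distinct. In
particular, the subtrees of siblings are disjoint. -/
theorem Desc.eq_of_dist_eq {j k t : I} (hj : D.Desc r j t) (hk : D.Desc r k t)
    (h : D.tree.dist r j = D.tree.dist r k) : j = k := by
  induction hj with
  | refl =>
    cases hk with
    | refl => rfl
    | tail h₁ h₂ =>
      have := Desc.dist_le h₁
      have := h₂.2
      omega
  | tail h₁ h₂ ih =>
    rcases hk.eq_or_parent h₂ with h' | h'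
    · have := Desc.dist_le h₁
      have := h₂.2
      subst h'
      omega
    · exact ih h'

/-- A node of `G` that occurs both inside and outside the subtree of `j` is in the bag of `j` and in the
bag of its parent. -/
theorem mem_bag_of_desc_of_not_desc {j t t' : I} {v : V} (ht : D.Desc r j t) (ht' : ¬ D.Desc r j t')
    (hv : v ∈ D.bag t) (hv' : v ∈ D.bag t') :
    v ∈ D.bag j ∧ ∀ i, D.IsChild r i j → v ∈ D.bag i := by
  obtain ⟨p, hp, -⟩ := D.isTree.existsUnique_path t t'
  -- The path between the two bags must leave the subtree of `j`, and the only way out is the edge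
  -- from `j` to its parent. Coherence then puts `v` into both of these bags.
  obtain ⟨d, hd, h₁, h₂⟩ := p.exists_boundary_dart {x | D.Desc r j x} ht ht'
  rcases isChild_or_isChild_of_adj (r := r) d.adj with h | h
  · exact absurd (Relation.ReflTransGen.tail h₁ h) h₂
  · rcases Desc.eq_or_parent h₁ h with h' | h'
    · refine ⟨h' ▸ D.coherence t d.fst t' p hp (p.dart_fst_mem_support_of_mem_darts hd) v hv hv',
        fun i hi => ?_⟩
      rw [← h'] at hi
      exact hi.parent_unique h ▸
        D.coherence t d.snd t' p hp (p.dart_snd_mem_support_of_mem_darts hd) v hv hv'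
    · exact absurd h' h₂

variable (D r) in
/-- The nodes of `G` in the bags of the subtree of `i`. -/
def below (i : I) : Set V := {v | ∃ t, D.Desc r i t ∧ v ∈ D.bag t}

theorem bag_subset_below {i : I} {v : V} (h : v ∈ D.bag i) : v ∈ D.below r i := ⟨i, .refl, h⟩

theorem IsChild.below_subset {i j : I} (h : D.IsChild r i j) {v : V} (hv : v ∈ D.below r j) :
    v ∈ D.below r i := by
  obtain ⟨t, ht, hv⟩ := hv
  exact ⟨t, ht.head h, hv⟩

theorem mem_below_iff {i : I} {v : V} :
    v ∈ D.below r i ↔ v ∈ D.bag i ∨ ∃ j, D.IsChild r i j ∧ v ∈ D.below r j := by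
  constructor
  · rintro ⟨t, ht, hv⟩
    rcases Relation.ReflTransGen.cases_head ht with rfl | ⟨j, hj, ht⟩
    · exact Or.inl hv
    · exact Or.inr ⟨j, hj, t, ht, hv⟩
  · rintro (h | ⟨j, hj, h⟩)
    · exact bag_subset_below h
    · exact hj.below_subset h

theorem IsChild.not_desc {i j : I} (h : D.IsChild r i j) : ¬ D.Desc r j i := fun h' => by
  have := h'.dist_le
  have := h.2
  omega

theorem IsChild.mem_bag_of_mem_below {i j : I} (h : D.IsChild r i j) {v : V} (hv : v ∈ D.below r j)
    (hi : v ∈ D.bag i) : v ∈ D.bag j := by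
  obtain ⟨t, ht, hv⟩ := hv
  exact (mem_bag_of_desc_of_not_desc ht h.not_desc hv hi).1

theorem IsChild.mem_bag_of_mem_below_of_mem_below {i j k : I} (hj : D.IsChild r i j)
    (hk : D.IsChild r i k) (hjk : j ≠ k) {v : V} (hv : v ∈ D.below r j) (hv' : v ∈ D.below r k) :
    v ∈ D.bag i := by
  obtain ⟨t, ht, hv⟩ := hv
  obtain ⟨t', ht', hv'⟩ := hv'
  refine (mem_bag_of_desc_of_not_desc ht (fun h => hjk ?_) hv hv').2 i hj
  exact h.eq_of_dist_eq ht' (hj.2.trans hk.2.symm)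

/-- A bag outside the subtree of `j` that covers the edge would force `v` into the bag of `i`. So
once a vertex has been dropped, all its neighbours have already appeared below. -/
theorem IsChild.mem_below_of_adj {i j : I} (h : D.IsChild r i j) {u v : V} (hv : v ∈ D.below r j)
    (hi : v ∉ D.bag i) (huv : G.Adj v u) : u ∈ D.below r j := by
  obtain ⟨t, ht, hv⟩ := hv
  obtain ⟨t', hv', hu⟩ := D.arc_coverage v u huv
  by_cases ht' : D.Desc r j t'
  · exact ⟨t', ht', hu⟩
  · exact absurd ((mem_bag_of_desc_of_not_desc ht ht' hv hv').2 i h) hi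

theorem mem_below_root (v : V) : v ∈ D.below r r := by
  obtain ⟨t, ht⟩ := D.node_coverage v
  exact ⟨t, desc_root t, ht⟩

end SimpleGraph.TreeDecomposition

/-! ### Moving positions within the rationals -/

/-- An order relation that is prescribed on a finite set of points of a dense order extends to all
points. -/
theorem exists_extend_order {V : Type*} [Fintype V] (X : Finset V) (f p : V → ℚ)
    (h : ∀ u ∈ X, ∀ v ∈ X, f u < f v ↔ p u < p v) :
    ∃ g : V → ℚ, (∀ x ∈ X, g x = p x) ∧ ∀ u v, f u < f v ↔ g u < g v := by
  classical
  suffices H : ∀ Y : Finset V, ∃ g : V → ℚ, (∀ x ∈ X, g x = p x) ∧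
      ∀ u ∈ X ∪ Y, ∀ v ∈ X ∪ Y, f u < f v ↔ g u < g v by
    obtain ⟨g, h₁, h₂⟩ := H Finset.univ
    exact ⟨g, h₁, fun u v => h₂ u (by simp) v (by simp)⟩
  intro Y
  induction Y using Finset.induction_on with
  | empty => exact ⟨p, fun _ _ => rfl, by simpa using h⟩
  | insert a Y _ ih =>
    obtain ⟨g, h₁, h₂⟩ := ih
    by_cases ha : a ∈ X ∪ Y
    · refine ⟨g, h₁, ?_⟩
      have : X ∪ insert a Y = X ∪ Y := by
        rw [Finset.union_insert, Finset.insert_eq_of_mem ha]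
      rwa [this]
    -- The new point takes the value of a point tied with it if there is one. Otherwise density of ℚ
    -- gives a value between the images of the finitely many lower and upper points.
    have hag : ∃ q : ℚ, ∀ x ∈ X ∪ Y, (f x < f a ↔ g x < q) ∧ (f a < f x ↔ q < g x) := by
      by_cases hx : ∃ x ∈ X ∪ Y, f x = f a
      · obtain ⟨x, hx, hfx⟩ := hx
        refine ⟨g x, fun y hy => ?_⟩
        rw [← hfx]
        exact ⟨h₂ y hy x hx, h₂ x hx y hy⟩
      · push Not at hx
        obtain ⟨q, hq₁, hq₂⟩ := Order.exists_between_finsets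
          (((X ∪ Y).filter fun x => f x < f a).image g)
          (((X ∪ Y).filter fun x => f a < f x).image g) (by
            simp only [Finset.mem_image, Finset.mem_filter]
            rintro _ ⟨x, ⟨hx, hxa⟩, rfl⟩ _ ⟨y, ⟨hy, hya⟩, rfl⟩
            exact (h₂ x hx y hy).1 (hxa.trans hya))
        have h3 : ∀ x ∈ X ∪ Y, f x < f a → g x < q := fun x hx hxa =>
          hq₁ _ (Finset.mem_image_of_mem g (Finset.mem_filter.2 ⟨hx, hxa⟩))
        have h4 : ∀ x ∈ X ∪ Y, f a < f x → q < g x := fun x hx hxa =>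
          hq₂ _ (Finset.mem_image_of_mem g (Finset.mem_filter.2 ⟨hx, hxa⟩))
        refine ⟨q, fun x hxm => ?_⟩
        rcases lt_trichotomy (f x) (f a) with h' | h' | h'
        · exact ⟨iff_of_true h' (h3 x hxm h'), iff_of_false h'.not_gt (h3 x hxm h').not_gt⟩
        · exact absurd h' (hx x hxm)
        · exact ⟨iff_of_false h'.not_gt (h4 x hxm h').not_gt, iff_of_true h' (h4 x hxm h')⟩
    obtain ⟨q, hq⟩ := hag
    have hne : ∀ x ∈ X ∪ Y, x ≠ a := fun x hx h => ha (h ▸ hx)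
    refine ⟨Function.update g a q, fun x hx => ?_, fun u hu v hv => ?_⟩
    · rw [Function.update_of_ne (hne x (Finset.mem_union_left _ hx)), h₁ x hx]
    · rw [Finset.union_insert, Finset.mem_insert] at hu hv
      rcases hu with rfl | hu <;> rcases hv with rfl | hv
      · simp
      · rw [Function.update_self, Function.update_of_ne (hne v hv)]
        exact (hq v hv).2
      · rw [Function.update_self, Function.update_of_ne (hne u hu)]
        exact (hq u hu).1
      · rw [Function.update_of_ne (hne u hu), Function.update_of_ne (hne v hv)]
        exact h₂ u hu v hv

theorem eq_iff_of_lt_iff {α β : Type*} [LinearOrder α] [LinearOrder β] {a b : α} {c d : β}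
    (h : a < b ↔ c < d) (h' : b < a ↔ d < c) : a = b ↔ c = d := by
  constructor
  · intro e
    exact le_antisymm (not_lt.1 fun k => (h'.2 k).ne e.symm) (not_lt.1 fun k => (h.2 k).ne e)
  · intro e
    exact le_antisymm (not_lt.1 fun k => (h'.1 k).ne e.symm) (not_lt.1 fun k => (h.1 k).ne e)

/-! ### Processed edges and the counting of tight ones -/

namespace SimpleGraph

variable {V I : Type*}

/-- The edge `uv` is compatible with the 2-colouring `σ` and the order `π`: its endpoint of colour `0`
is not above its endpoint of colour `1`. -/
def EdgeOK {α : Type*} [LinearOrder α] (π : V → α) (σ : V → ℕ) (u v : V) : Prop :=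
  (σ u = 0 ∧ σ v = 1 ∧ π u ≤ π v) ∨ (σ v = 0 ∧ σ u = 1 ∧ π v ≤ π u)

theorem EdgeOK.congr {α β : Type*} [LinearOrder α] [LinearOrder β] {π : V → α} {π' : V → β}
    {σ σ' : V → ℕ} {u v : V} (hu : σ u = σ' u) (hv : σ v = σ' v) (h₁ : π u < π v ↔ π' u < π' v)
    (h₂ : π v < π u ↔ π' v < π' u) (h : EdgeOK π σ u v) : EdgeOK π' σ' u v := by
  unfold EdgeOK at *
  rwa [← hu, ← hv, ← not_lt, ← not_lt, ← h₁, ← h₂, not_lt, not_lt]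

namespace TreeDecomposition

variable {G : SimpleGraph V} (D : G.TreeDecomposition I) (r : I)

/-- The nodes of `G` that were forgotten in the subtree of `i`. -/
def forgotten (i : I) : Set V := {v | v ∈ D.below r i ∧ v ∉ D.bag i}

/-- The edge `uv` has an endpoint that was forgotten in the subtree of `i`. -/
def Processed (i : I) (u v : V) : Prop := G.Adj u v ∧ (u ∈ D.forgotten r i ∨ v ∈ D.forgotten r i)

/-- The edge `uv` has an endpoint outside the bag of `i`. -/
def NewEdge (i : I) (u v : V) : Prop := G.Adj u v ∧ (u ∉ D.bag i ∨ v ∉ D.bag i)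

open Classical in
/-- The number of processed edges at `u` whose endpoints are at the same position. -/
noncomputable def tdeg {α : Type*} [Fintype V] (i : I) (π : V → α) (u : V) : ℕ :=
  ∑ v, if D.Processed r i u v ∧ π u = π v then 1 else 0

open Classical in
/-- The number of processed edges whose endpoints are at the same position. -/
noncomputable def cnt {α : Type*} [Fintype V] (i : I) (π : V → α) (σ : V → ℕ) : ℕ :=
  ∑ u, if σ u = 0 then D.tdeg r i π u else 0

open Classical in
/-- The number of edges at `u` that are newly processed in going from `j` to `i` and whose endpoints are
at the same position. -/
noncomputable def ndeg {α : Type*} (i j : I) (p : V → α) (u : V) : ℕ :=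
  ∑ v ∈ D.bag j, if D.NewEdge i u v ∧ p u = p v then 1 else 0

open Classical in
/-- The number of newly processed edges whose endpoints are at the same position. -/
noncomputable def gain {α : Type*} (i j : I) (p : V → α) (s : V → ℕ) : ℕ :=
  ∑ u ∈ D.bag j, if s u = 0 then D.ndeg i j p u else 0

variable {D r}

theorem tdeg_congr {α β : Type*} [Fintype V] {i : I} {π : V → α} {π' : V → β}
    (h : ∀ u v, π u = π v ↔ π' u = π' v) (u : V) : D.tdeg r i π u = D.tdeg r i π' u := by
  classical
  unfold tdeg
  exact Finset.sum_congr rfl fun v _ => if_congr (and_congr_right fun _ => h u v) rfl rfl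

theorem tdeg_eq_zero {α : Type*} [Fintype V] {i : I} {π : V → α} {u : V} (hu : u ∉ D.below r i)
    (hadj : ∀ v ∈ D.forgotten r i, G.Adj v u → u ∈ D.below r i) : D.tdeg r i π u = 0 := by
  refine Finset.sum_eq_zero fun v _ => if_neg fun h => ?_
  rcases h.1.2 with h' | h'
  · exact hu h'.1
  · exact hu (hadj v h' h.1.1.symm)

theorem IsChild.forgotten_subset {i j : I} (h : D.IsChild r i j) {v : V} (hv : v ∈ D.forgotten r j) :
    v ∈ D.forgotten r i :=
  ⟨h.below_subset hv.1, fun hi => hv.2 (h.mem_bag_of_mem_below hv.1 hi)⟩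

theorem IsChild.not_mem_bag_of_forgotten {i j : I} (h : D.IsChild r i j) {v : V}
    (hv : v ∈ D.forgotten r j) : v ∉ D.bag i := (h.forgotten_subset hv).2

theorem IsChild.tdeg_eq_zero {α : Type*} [Fintype V] {i j : I} (h : D.IsChild r i j) {π : V → α}
    {u : V} (hu : u ∉ D.below r j) : D.tdeg r j π u = 0 :=
  TreeDecomposition.tdeg_eq_zero hu fun _ hv huv =>
    h.mem_below_of_adj hv.1 (h.not_mem_bag_of_forgotten hv) huv

theorem Processed.mem_below {i j : I} (h : D.IsChild r i j) {u v : V} (hp : D.Processed r j u v) :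
    u ∈ D.below r j ∧ v ∈ D.below r j := by
  rcases hp.2 with h' | h'
  · exact ⟨h'.1, h.mem_below_of_adj h'.1 (h.not_mem_bag_of_forgotten h') hp.1⟩
  · exact ⟨h.mem_below_of_adj h'.1 (h.not_mem_bag_of_forgotten h') hp.1.symm, h'.1⟩

/-- A vertex forgotten at `i` is not in the bag of `i`, hence lies below some child, and its
neighbours lie below the same child. Processing at `i` is thereby described in terms of the children
alone. -/
theorem processed_iff {i : I} {u v : V} : D.Processed r i u v ↔
    ∃ j, D.IsChild r i j ∧ u ∈ D.below r j ∧ v ∈ D.below r j ∧ D.NewEdge i u v := by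
  have key : ∀ u v, G.Adj u v → u ∈ D.forgotten r i →
      ∃ j, D.IsChild r i j ∧ u ∈ D.below r j ∧ v ∈ D.below r j ∧ D.NewEdge i u v := by
    intro u v huv hu
    rcases mem_below_iff.1 hu.1 with h | ⟨j, hj, h⟩
    · exact absurd h hu.2
    · exact ⟨j, hj, h, hj.mem_below_of_adj h hu.2 huv, huv, Or.inl hu.2⟩
  constructor
  · rintro ⟨huv, hu | hv⟩
    · exact key u v huv hu
    · obtain ⟨j, hj, h₁, h₂, h₃, h₄⟩ := key v u huv.symm hv
      exact ⟨j, hj, h₂, h₁, huv, h₄.symm⟩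
  · rintro ⟨j, hj, hu, hv, huv, h | h⟩
    · exact ⟨huv, Or.inl ⟨hj.below_subset hu, h⟩⟩
    · exact ⟨huv, Or.inr ⟨hj.below_subset hv, h⟩⟩

/-- In the subtree of a child `j` of `i`, an edge that is new for `i` was either processed below `j` or
joins two elements of the bag of `j`. -/
theorem IsChild.processed_iff_not_bag {i j : I} {u v : V} (hu : u ∈ D.below r j)
    (hv : v ∈ D.below r j) (h : D.NewEdge i u v) :
    D.Processed r j u v ↔ ¬ (u ∈ D.bag j ∧ v ∈ D.bag j) := by
  constructor
  · rintro ⟨_, h | h⟩ h'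
    · exact h.2 h'.1
    · exact h.2 h'.2
  · intro h'
    refine ⟨h.1, ?_⟩
    by_cases h₁ : u ∈ D.bag j
    · exact Or.inr ⟨hv, fun h₂ => h' ⟨h₁, h₂⟩⟩
    · exact Or.inl ⟨hu, h₁⟩

theorem IsChild.newEdge_of_processed {i j : I} (h : D.IsChild r i j) {u v : V}
    (hp : D.Processed r j u v) : D.NewEdge i u v :=
  ⟨hp.1, hp.2.imp (fun h' => h.not_mem_bag_of_forgotten h') fun h' => h.not_mem_bag_of_forgotten h'⟩

section Count

variable {α β : Type*} {i : I} {ch : Finset I} {π : V → α} {π' : I → V → α} {p : I → V → β}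

-- A new edge has an endpoint outside the bag of `i`, which lies below only one child, so at most
-- one summand is nonzero. For that child, being processed already and lying inside its bag exclude
-- each other. The functions `π`, `π' j`, `p j` (positions at `i`, positions at the child, labels in
-- its bag) are compared only with respect to ties, which leaves room to change the actual values.
open Classical in
theorem ite_processed_eq_sum (hch : ∀ j, j ∈ ch ↔ D.IsChild r i j)
    (hπ : ∀ j ∈ ch, ∀ u ∈ D.below r j, ∀ v ∈ D.below r j, π u = π v ↔ π' j u = π' j v)
    (hp : ∀ j ∈ ch, ∀ u ∈ D.bag j, ∀ v ∈ D.bag j, π' j u = π' j v ↔ p j u = p j v) (u v : V) :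
    (if D.Processed r i u v ∧ π u = π v then 1 else 0) =
      ∑ j ∈ ch, ((if D.Processed r j u v ∧ π' j u = π' j v then 1 else 0) +
        if u ∈ D.bag j then if v ∈ D.bag j then
          if D.NewEdge i u v ∧ p j u = p j v then 1 else 0 else 0 else 0) := by
  by_cases h : D.Processed r i u v
  · obtain ⟨j, hj, hu, hv, hn⟩ := processed_iff.1 h
    rw [Finset.sum_eq_single j]
    · have h₁ := hπ j ((hch j).2 hj) u hu v hv
      have h₂ := IsChild.processed_iff_not_bag hu hv hn
      by_cases hb : u ∈ D.bag j ∧ v ∈ D.bag j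
      · have h₃ := hp j ((hch j).2 hj) u hb.1 v hb.2
        simp [h, h₂, hb, hn, h₁, h₃]
      · have h₄ : (if u ∈ D.bag j then if v ∈ D.bag j then
          if D.NewEdge i u v ∧ p j u = p j v then 1 else 0 else 0 else 0) = 0 := by
          split_ifs <;> tauto
        rw [h₄]
        simp [h, h₂.2 hb, h₁]
    · intro k hk hkj
      have hk' := (hch k).1 hk
      have hno : ¬ (u ∈ D.below r k ∧ v ∈ D.below r k) := by
        rintro ⟨hu', hv'⟩
        rcases hn.2 with h' | h'
        · exact h' (hj.mem_bag_of_mem_below_of_mem_below hk' hkj.symm hu hu')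
        · exact h' (hj.mem_bag_of_mem_below_of_mem_below hk' hkj.symm hv hv')
      rw [if_neg fun h' => hno (h'.1.mem_below hk'), zero_add]
      split_ifs with h₁ h₂ h₃
      · exact absurd ⟨bag_subset_below h₁, bag_subset_below h₂⟩ hno
      all_goals rfl
    · exact fun h' => absurd ((hch j).2 hj) h'
  · rw [if_neg fun h' => h h'.1, eq_comm]
    refine Finset.sum_eq_zero fun j hj => ?_
    have hj' := (hch j).1 hj
    rw [if_neg, zero_add]
    · split_ifs with h₁ h₂ h₃
      · exact absurd (processed_iff.2 ⟨j, hj', bag_subset_below h₁, bag_subset_below h₂, h₃.1⟩) h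
      all_goals rfl
    · rintro ⟨h', -⟩
      have hb := h'.mem_below hj'
      exact h (processed_iff.2 ⟨j, hj', hb.1, hb.2, hj'.newEdge_of_processed h'⟩)

open Classical in
theorem tdeg_eq_sum [Fintype V] (hch : ∀ j, j ∈ ch ↔ D.IsChild r i j)
    (hπ : ∀ j ∈ ch, ∀ u ∈ D.below r j, ∀ v ∈ D.below r j, π u = π v ↔ π' j u = π' j v)
    (hp : ∀ j ∈ ch, ∀ u ∈ D.bag j, ∀ v ∈ D.bag j, π' j u = π' j v ↔ p j u = p j v) (u : V) :
    D.tdeg r i π u = ∑ j ∈ ch, (D.tdeg r j (π' j) u + if u ∈ D.bag j then D.ndeg i j (p j) u else 0) := by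
  unfold tdeg
  simp only [ite_processed_eq_sum hch hπ hp]
  rw [Finset.sum_comm]
  refine Finset.sum_congr rfl fun j _ => ?_
  rw [Finset.sum_add_distrib]
  congr 1
  by_cases h : u ∈ D.bag j
  · simp only [h, if_true, ndeg]
    rw [← Finset.sum_filter]
    exact Finset.sum_congr (by ext; simp) fun _ _ => rfl
  · simp [h]

theorem cnt_eq_sum [Fintype V] (hch : ∀ j, j ∈ ch ↔ D.IsChild r i j)
    (hπ : ∀ j ∈ ch, ∀ u ∈ D.below r j, ∀ v ∈ D.below r j, π u = π v ↔ π' j u = π' j v)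
    (hp : ∀ j ∈ ch, ∀ u ∈ D.bag j, ∀ v ∈ D.bag j, π' j u = π' j v ↔ p j u = p j v)
    {σ : V → ℕ} {σ' s : I → V → ℕ} (hσ : ∀ j ∈ ch, ∀ u ∈ D.below r j, σ u = σ' j u)
    (hs : ∀ j ∈ ch, ∀ u ∈ D.bag j, σ' j u = s j u) :
    D.cnt r i π σ = ∑ j ∈ ch, (D.cnt r j (π' j) (σ' j) + D.gain i j (p j) (s j)) := by
  classical
  unfold cnt
  have h₁ : ∀ u, (if σ u = 0 then D.tdeg r i π u else 0) =
      ∑ j ∈ ch, ((if σ' j u = 0 then D.tdeg r j (π' j) u else 0) +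
        if u ∈ D.bag j then if s j u = 0 then D.ndeg i j (p j) u else 0 else 0) := by
    intro u
    rw [tdeg_eq_sum hch hπ hp, ← mul_boole, Finset.sum_mul]
    refine Finset.sum_congr rfl fun j hj => ?_
    by_cases hu : u ∈ D.below r j
    · rw [hσ j hj u hu]
      by_cases hb : u ∈ D.bag j
      · rw [← hs j hj u hb]
        by_cases h : σ' j u = 0 <;> simp [h, hb]
      · by_cases h : σ' j u = 0 <;> simp [h, hb]
    · have hb : u ∉ D.bag j := fun h => hu (bag_subset_below h)
      simp [hb, ((hch j).1 hj).tdeg_eq_zero hu]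
  simp only [h₁]
  rw [Finset.sum_comm]
  refine Finset.sum_congr rfl fun j _ => ?_
  rw [Finset.sum_add_distrib]
  congr 1
  rw [gain, ← Finset.sum_filter]
  exact Finset.sum_congr (by ext; simp) fun _ _ => rfl

end Count

end TreeDecomposition

end SimpleGraph

/-! ### Correctness of the recursion -/

namespace SimpleGraph.TreeDecomposition

variable {V I : Type*} {G : SimpleGraph V} {D : G.TreeDecomposition I} {r : I}

/-- The codes of states with the labels they stand for, and the table of values. -/
structure Tables (V I : Type*) where
  N : ℕ
  lab : ℕ → I → ℕ → V → ℕ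
  tab : I → ℕ → ℕ

variable (D r) (T : Tables V I)

open Classical in
/-- The codes `γ` of states of the children of `i` agree with the state `c` of `i`. -/
structure Compat (ch : Finset I) (i : I) (c : ℕ) (γ : I → ℕ) : Prop where
  lt : ∀ j ∈ ch, γ j < T.N
  ne_zero : ∀ j ∈ ch, T.tab j (γ j) ≠ 0
  side : ∀ j ∈ ch, ∀ u ∈ D.bag j, u ∈ D.bag i → T.lab 1 i c u = T.lab 1 j (γ j) u
  deg_le : ∀ j ∈ ch, ∀ u ∈ D.bag j, u ∉ D.bag i →
    T.lab 2 j (γ j) u + D.ndeg i j (T.lab 0 j (γ j)) u ≤ 1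
  order : ∀ j ∈ ch, ∀ u ∈ D.bag j, ∀ v ∈ D.bag j, u ∈ D.bag i → v ∈ D.bag i →
    (T.lab 0 i c u < T.lab 0 i c v ↔ T.lab 0 j (γ j) u < T.lab 0 j (γ j) v)
  edge : ∀ j ∈ ch, ∀ u ∈ D.bag j, ∀ v ∈ D.bag j, D.NewEdge i u v →
    EdgeOK (T.lab 0 j (γ j)) (T.lab 1 j (γ j)) u v
  le_one : ∀ u ∈ D.bag i, T.lab 2 i c u ≤ 1
  deg : ∀ u ∈ D.bag i, T.lab 2 i c u = ∑ j ∈ ch,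
    if u ∈ D.bag j then T.lab 2 j (γ j) u + D.ndeg i j (T.lab 0 j (γ j)) u else 0

/-- The value of the states `γ` of the children of `i`. -/
noncomputable def value (ch : Finset I) (i : I) (γ : I → ℕ) : ℕ :=
  1 + ∑ j ∈ ch, (T.tab j (γ j) - 1 + D.gain i j (T.lab 0 j (γ j)) (T.lab 1 j (γ j)))

/-- The table entries of `i` are the best values of the states of its children. -/
structure IsStep (ch : Finset I) (i : I) : Prop where
  exists_value : ∀ c < T.N, T.tab i c ≠ 0 → ∃ γ, D.Compat T ch i c γ ∧ T.tab i c = D.value T ch i γ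
  value_le : ∀ c < T.N, ∀ γ, D.Compat T ch i c γ → D.value T ch i γ ≤ T.tab i c

/-- `c` stands for the restriction of `π` and `σ` to the bag of `i`. -/
structure Represents [Fintype V] (i : I) (c : ℕ) (π : V → ℚ) (σ : V → ℕ) : Prop where
  order : ∀ u ∈ D.bag i, ∀ v ∈ D.bag i, T.lab 0 i c u < T.lab 0 i c v ↔ π u < π v
  side : ∀ u ∈ D.bag i, T.lab 1 i c u = σ u
  deg : ∀ u ∈ D.bag i, T.lab 2 i c u = D.tdeg r i π u

/-- A solution for the processed edges of the subtree of `i`. -/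
structure PartialSolution [Fintype V] (i : I) (π : V → ℚ) (σ : V → ℕ) : Prop where
  edge : ∀ u v, D.Processed r i u v → EdgeOK π σ u v
  deg : ∀ v, D.tdeg r i π v ≤ 1

/-- The table entries of `i` are at most the values of partial solutions, and at least the values of
restrictions of solutions. -/
structure Correct [Fintype V] (i : I) : Prop where
  exists_solution : ∀ c < T.N, T.tab i c ≠ 0 → ∃ π σ, D.Represents r T i c π σ ∧
    D.PartialSolution r i π σ ∧ T.tab i c = D.cnt r i π σ + 1
  cnt_lt : ∀ π σ, (∀ u v, G.Adj u v → EdgeOK π σ u v) → (∀ u, σ u ≤ 1) →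
    (∀ i u, D.tdeg r i π u ≤ 1) → ∀ c < T.N, D.Represents r T i c π σ →
      D.cnt r i π σ + 1 ≤ T.tab i c

variable {D r T}

section Reorder

variable [Fintype V] {i : I} {c : ℕ} {π π' : V → ℚ} {σ : V → ℕ}

theorem cnt_congr (h : ∀ u v, π u < π v ↔ π' u < π' v) : D.cnt r i π σ = D.cnt r i π' σ := by
  unfold cnt
  exact Finset.sum_congr rfl fun u _ => by
    rw [tdeg_congr fun u v => eq_iff_of_lt_iff (h u v) (h v u)]

theorem Represents.reorder (h : ∀ u v, π u < π v ↔ π' u < π' v) (hr : D.Represents r T i c π σ) :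
    D.Represents r T i c π' σ :=
  ⟨fun u hu v hv => (hr.order u hu v hv).trans (h u v), hr.side, fun u hu => by
    rw [hr.deg u hu, tdeg_congr fun u v => eq_iff_of_lt_iff (h u v) (h v u)]⟩

theorem PartialSolution.reorder (h : ∀ u v, π u < π v ↔ π' u < π' v)
    (hr : D.PartialSolution r i π σ) : D.PartialSolution r i π' σ :=
  ⟨fun u v huv => (hr.edge u v huv).congr rfl rfl (h u v) (h v u), fun u => by
    rw [← tdeg_congr fun u v => eq_iff_of_lt_iff (h u v) (h v u)]; exact hr.deg u⟩

end Reorder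

/-- Gluing. The children's solutions agree on the bag of `i` only up to order. Each is first
rearranged to take the labels of `c` as its positions there; then they coincide wherever they
overlap, as the parts below different children meet only inside that bag. -/
theorem Correct.of_children_exists [Fintype V] {i : I} {ch : Finset I}
    (hch : ∀ j, j ∈ ch ↔ D.IsChild r i j)
    (hstep : D.IsStep T ch i) (ih : ∀ j ∈ ch, D.Correct r T j) {c : ℕ} (hc : c < T.N)
    (h0 : T.tab i c ≠ 0) : ∃ π σ, D.Represents r T i c π σ ∧
    D.PartialSolution r i π σ ∧ T.tab i c = D.cnt r i π σ + 1 := by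
  classical
  obtain ⟨γ, hγ, hval⟩ := hstep.exists_value c hc h0
  have h₁ : ∀ j, ∃ (π : V → ℚ) (σ : V → ℕ), j ∈ ch →
      ((∀ x ∈ D.bag i, x ∈ D.bag j → π x = T.lab 0 i c x) ∧
      D.Represents r T j (γ j) π σ ∧ D.PartialSolution r j π σ ∧
      T.tab j (γ j) = D.cnt r j π σ + 1) := by
    intro j
    by_cases hj : j ∈ ch
    · obtain ⟨π, σ, hr, hp, ht⟩ := (ih j hj).exists_solution _ (hγ.lt j hj) (hγ.ne_zero j hj)
      obtain ⟨π', h₁, h₂⟩ := exists_extend_order (D.bag i ∩ D.bag j) π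
        (fun x => (T.lab 0 i c x : ℚ)) (by
          intro u hu v hv
          rw [Finset.mem_inter] at hu hv
          rw [← hr.order u hu.2 v hv.2, Nat.cast_lt, hγ.order j hj u hu.2 v hv.2 hu.1 hv.1])
      exact ⟨π', σ, fun _ => ⟨fun x hx hx' => h₁ x (Finset.mem_inter.2 ⟨hx, hx'⟩), hr.reorder h₂,
        hp.reorder h₂, by rw [ht, cnt_congr h₂]⟩⟩
    -- Arbitrary values, so that a choice can be made for all nodes at once.
    · exact ⟨0, 0, fun h => absurd h hj⟩
  choose π' σ' h' using h₁
  -- Outside the bag of `i` a vertex lies below at most one child, so the child picked by `choose`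
  -- is the only candidate. Vertices not below `i` play no role.
  let π : V → ℚ := fun v => if v ∈ D.bag i then (T.lab 0 i c v : ℚ) else
    if h : ∃ j ∈ ch, v ∈ D.below r j then π' h.choose v else 0
  let σ : V → ℕ := fun v => if v ∈ D.bag i then T.lab 1 i c v else
    if h : ∃ j ∈ ch, v ∈ D.below r j then σ' h.choose v else 0
  have hπσ : ∀ j ∈ ch, ∀ v ∈ D.below r j, π v = π' j v ∧ σ v = σ' j v := by
    intro j hj v hv
    have hj' := (hch j).1 hj
    by_cases hi : v ∈ D.bag i
    · have hb := hj'.mem_bag_of_mem_below hv hi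
      have := h' j hj
      simp only [π, σ, if_pos hi]
      exact ⟨(this.1 v hi hb).symm, by rw [← this.2.1.side v hb, hγ.side j hj v hb hi]⟩
    · have hex : ∃ j ∈ ch, v ∈ D.below r j := ⟨j, hj, hv⟩
      have hcj : hex.choose = j := by
        by_contra hne
        exact hi (((hch _).1 hex.choose_spec.1).mem_bag_of_mem_below_of_mem_below hj' hne
          hex.choose_spec.2 hv)
      simp only [π, σ, if_neg hi, dif_pos hex, hcj, and_self]
  have hπ : ∀ j ∈ ch, ∀ u ∈ D.below r j, ∀ v ∈ D.below r j, π u = π v ↔ π' j u = π' j v :=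
    fun j hj u hu v hv => by rw [(hπσ j hj u hu).1, (hπσ j hj v hv).1]
  have hlt : ∀ j ∈ ch, ∀ u ∈ D.bag j, ∀ v ∈ D.bag j,
      T.lab 0 j (γ j) u < T.lab 0 j (γ j) v ↔ π' j u < π' j v :=
    fun j hj u hu v hv => (h' j hj).2.1.order u hu v hv
  have hp : ∀ j ∈ ch, ∀ u ∈ D.bag j, ∀ v ∈ D.bag j,
      π' j u = π' j v ↔ T.lab 0 j (γ j) u = T.lab 0 j (γ j) v :=
    fun j hj u hu v hv => (eq_iff_of_lt_iff (hlt j hj u hu v hv) (hlt j hj v hv u hu)).symm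
  have hdeg := tdeg_eq_sum (D := D) (r := r) hch hπ hp
  -- A vertex outside the bag of `i` either leaves the bags just now, where `deg_le` bounds its
  -- degree, or is outside the child's bag, where the child's partial solution does.
  have hterm : ∀ j ∈ ch, ∀ u, (D.tdeg r j (π' j) u +
      if u ∈ D.bag j then D.ndeg i j (T.lab 0 j (γ j)) u else 0) ≤ 1 ∨ u ∈ D.bag i := by
    intro j hj u
    by_cases hi : u ∈ D.bag i
    · exact Or.inr hi
    · left
      by_cases hb : u ∈ D.bag j
      · rw [if_pos hb, ← (h' j hj).2.1.deg u hb]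
        exact hγ.deg_le j hj u hb hi
      · rw [if_neg hb]
        exact (h' j hj).2.2.1.deg u
  have hbag : ∀ u ∈ D.bag i, T.lab 2 i c u = D.tdeg r i π u := by
    intro u hu
    rw [hdeg u, hγ.deg u hu]
    refine Finset.sum_congr rfl fun j hj => ?_
    by_cases hb : u ∈ D.bag j
    · rw [if_pos hb, if_pos hb, (h' j hj).2.1.deg u hb]
    · rw [if_neg hb, if_neg hb, add_zero, ((hch j).1 hj).tdeg_eq_zero]
      exact fun h => hb (((hch j).1 hj).mem_bag_of_mem_below h hu)
  refine ⟨π, σ, ⟨fun u hu v hv => ?_, fun u hu => ?_, hbag⟩, ⟨fun u v huv => ?_, fun u => ?_⟩, ?_⟩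
  · simp only [π, if_pos hu, if_pos hv, Nat.cast_lt]
  · simp only [σ, if_pos hu]
  · obtain ⟨j, hj, hu, hv, hn⟩ := processed_iff.1 huv
    have hj' := (hch j).2 hj
    have hu' := hπσ j hj' u hu
    have hv' := hπσ j hj' v hv
    have hok : EdgeOK (π' j) (σ' j) u v := by
      by_cases hb : u ∈ D.bag j ∧ v ∈ D.bag j
      · have hr := (h' j hj').2.1
        exact (hγ.edge j hj' u hb.1 v hb.2 hn).congr (hr.side u hb.1) (hr.side v hb.2)
          (hr.order u hb.1 v hb.2) (hr.order v hb.2 u hb.1)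
      · exact (h' j hj').2.2.1.edge u v ((IsChild.processed_iff_not_bag hu hv hn).2 hb)
    refine hok.congr hu'.2.symm hv'.2.symm ?_ ?_ <;> rw [hu'.1, hv'.1]
  · by_cases hi : u ∈ D.bag i
    · rw [← hbag u hi]
      exact hγ.le_one u hi
    · rw [hdeg u]
      by_cases hex : ∃ j ∈ ch, u ∈ D.below r j
      · obtain ⟨j, hj, hu⟩ := hex
        rw [Finset.sum_eq_single_of_mem j hj]
        · exact (hterm j hj u).resolve_right hi
        · intro k hk hkj
          have hu' : u ∉ D.below r k := fun hu' =>
            hi (((hch k).1 hk).mem_bag_of_mem_below_of_mem_below ((hch j).1 hj) hkj hu' hu)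
          rw [((hch k).1 hk).tdeg_eq_zero hu', if_neg fun h => hu' (bag_subset_below h),
            add_zero]
      · push Not at hex
        rw [Finset.sum_eq_zero]
        · exact zero_le_one
        · intro k hk
          rw [((hch k).1 hk).tdeg_eq_zero (hex k hk), if_neg fun h => hex k hk (bag_subset_below h),
            add_zero]
  · rw [hval, value, cnt_eq_sum hch hπ hp (s := fun j => T.lab 1 j (γ j))
      (fun j hj u hu => (hπσ j hj u hu).2)
      (fun j hj u hu => ((h' j hj).2.1.side u hu).symm), add_comm]
    refine congrArg (· + 1) (Finset.sum_congr rfl fun j hj => ?_)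
    rw [(h' j hj).2.2.2, Nat.add_sub_cancel]

/-- Replacing positions by ranks within the bag keeps the order and leaves fewer values than the
base of the codes, so finitely many labels suffice although positions are rational. -/
theorem card_filter_lt_iff {α : Type*} [LinearOrder α] (X : Finset V) (π : V → α) {u v : V}
    (hu : u ∈ X) : (X.filter fun x => π x < π u).card < (X.filter fun x => π x < π v).card ↔
      π u < π v := by
  constructor
  · intro h
    by_contra hle
    refine absurd (Finset.card_le_card ?_) (not_le.2 h)
    intro x hx
    rw [Finset.mem_filter] at hx ⊢
    exact ⟨hx.1, hx.2.trans_le (not_lt.1 hle)⟩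
  · intro h
    refine Finset.card_lt_card ((Finset.ssubset_iff_of_subset fun x hx => ?_).2 ⟨u, ?_, ?_⟩)
    · rw [Finset.mem_filter] at hx ⊢
      exact ⟨hx.1, hx.2.trans h⟩
    · exact Finset.mem_filter.2 ⟨hu, h⟩
    · simp

variable (D T) in
/-- Every labelling of a bag has a code. -/
def Surjective : Prop := ∀ (i : I) (g : ℕ → V → ℕ), (∀ v ∈ D.bag i, g 0 v < (D.bag i).card) →
  (∀ v ∈ D.bag i, g 1 v ≤ 1) → (∀ v ∈ D.bag i, g 2 v ≤ 1) →
  ∃ c < T.N, ∀ v ∈ D.bag i, ∀ κ < 3, T.lab κ i c v = g κ v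

theorem Surjective.exists_represents [Fintype V] (h : D.Surjective T) {π : V → ℚ} {σ : V → ℕ}
    (hσ : ∀ u, σ u ≤ 1) (i : I) (hdeg : ∀ u, D.tdeg r i π u ≤ 1) :
    ∃ c < T.N, D.Represents r T i c π σ := by
  obtain ⟨c, hc, hl⟩ := h i (fun κ v => if κ = 0 then ((D.bag i).filter fun x => π x < π v).card else
    if κ = 1 then σ v else D.tdeg r i π v) (fun v hv => by
      refine Finset.card_lt_card ((Finset.ssubset_iff_of_subset (Finset.filter_subset _ _)).2
        ⟨v, hv, by simp⟩)) (fun v _ => hσ v) (fun v _ => hdeg v)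
  refine ⟨c, hc, fun u hu v hv => ?_, fun u hu => hl u hu 1 (by omega), fun u hu => hl u hu 2 (by omega)⟩
  rw [hl u hu 0 (by omega), hl v hv 0 (by omega)]
  exact card_filter_lt_iff _ _ hu

/-- For the remaining inequality one global solution is restricted to the bags of all children. The
codes of these restrictions are automatically compatible with `c`, and the counts add up, so nothing
has to be glued. -/
theorem Correct.of_children [Fintype V] {i : I} {ch : Finset I}
    (hch : ∀ j, j ∈ ch ↔ D.IsChild r i j) (hsurj : D.Surjective T)
    (hstep : D.IsStep T ch i) (ih : ∀ j ∈ ch, D.Correct r T j) : D.Correct r T i := by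
  classical
  refine ⟨fun c hc h0 => Correct.of_children_exists hch hstep ih hc h0,
    fun π σ hadj hσ hdeg c hc hrep => ?_⟩
  choose γ hγ hr using fun j => hsurj.exists_represents (r := r) hσ j (hdeg j)
  have hp : ∀ j ∈ ch, ∀ u ∈ D.bag j, ∀ v ∈ D.bag j,
      π u = π v ↔ T.lab 0 j (γ j) u = T.lab 0 j (γ j) v := fun j _ u hu v hv =>
    (eq_iff_of_lt_iff ((hr j).order u hu v hv) ((hr j).order v hv u hu)).symm
  have hsum := tdeg_eq_sum (D := D) (r := r) (π' := fun _ => π) hch (fun _ _ _ _ _ _ => Iff.rfl) hp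
  have hle : ∀ j ∈ ch, D.cnt r j π σ + 1 ≤ T.tab j (γ j) := fun j hj =>
    (ih j hj).cnt_lt π σ hadj hσ hdeg _ (hγ j) (hr j)
  have hcompat : D.Compat T ch i c γ := by
    refine ⟨fun j _ => hγ j, fun j hj => ?_, fun j hj u hu hi => ?_, fun j hj u hu hi => ?_,
      fun j hj u hu v hv hi hi' => ?_, fun j hj u hu v hv hn => ?_, fun u hu => ?_, fun u hu => ?_⟩
    · have := hle j hj
      omega
    · rw [hrep.side u hi, (hr j).side u hu]
    · refine le_trans ?_ (hdeg i u)
      rw [hsum u, (hr j).deg u hu]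
      refine le_trans (le_of_eq ?_) (Finset.single_le_sum (f := fun j => D.tdeg r j π u +
        if u ∈ D.bag j then D.ndeg i j (T.lab 0 j (γ j)) u else 0) (fun _ _ => Nat.zero_le _) hj)
      simp only [if_pos hu]
    · rw [hrep.order u hi v hi', (hr j).order u hu v hv]
    · exact (hadj u v hn.1).congr ((hr j).side u hu).symm ((hr j).side v hv).symm
        ((hr j).order u hu v hv).symm ((hr j).order v hv u hu).symm
    · rw [hrep.deg u hu]
      exact hdeg i u
    · rw [hrep.deg u hu, hsum u]
      refine Finset.sum_congr rfl fun j hj => ?_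
      by_cases hb : u ∈ D.bag j
      · rw [if_pos hb, if_pos hb, (hr j).deg u hb]
      · rw [if_neg hb, if_neg hb, add_zero, ((hch j).1 hj).tdeg_eq_zero]
        exact fun h => hb (((hch j).1 hj).mem_bag_of_mem_below h hu)
  refine le_trans ?_ (hstep.value_le c hc γ hcompat)
  rw [value, add_comm, cnt_eq_sum (π' := fun _ => π) (σ' := fun _ => σ) hch
    (fun _ _ _ _ _ _ => Iff.rfl) hp (s := fun j => T.lab 1 j (γ j)) (fun _ _ _ _ => rfl)
      (fun j _ u hu => ((hr j).side u hu).symm)]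
  refine Nat.add_le_add_left (Finset.sum_le_sum fun j hj => ?_) 1
  have := hle j hj
  omega

end SimpleGraph.TreeDecomposition

/-! ### Alternating cycle-free matchings as tight edges of an order -/

namespace SimpleGraph

variable {V : Type*} {G : SimpleGraph V}

section Ordered

variable {α : Type*} [LinearOrder α] {π : V → α} {σ : V → ℕ}

/-- Along a walk whose edges are alternately in `M` and not in `M`, and that goes up with its first edge,
the position does not decrease. -/
theorem Walk.le_of_isChain {M : G.Subgraph} (hM : ∀ u v, M.Adj u v ↔ G.Adj u v ∧ π u = π v)
    (hadj : ∀ u v, G.Adj u v → EdgeOK π σ u v) {u w : V} (p : G.Walk u w)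
    (hc : p.edges.IsChain fun e f => e ∈ M.edgeSet ↔ f ∉ M.edgeSet)
    (h0 : ∀ e ∈ p.edges.head?, e ∈ M.edgeSet ↔ σ u = 1) :
    π u ≤ π w ∧ ((∃ e ∈ p.edges, e ∉ M.edgeSet) → π u < π w) := by
  induction p with
  | nil => simp
  | @cons u x w h p ih =>
    rw [Walk.edges_cons] at hc h0
    have h1 : s(u, x) ∈ M.edgeSet ↔ σ u = 1 := h0 _ (by simp)
    have hux := hadj u x h
    -- Colours alternate along the walk just as membership in `M` does, so the condition on the
    -- first edge passes to the rest of the walk: edges outside `M` are always traversed from colour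
    -- 0 to colour 1, that is, upwards.
    have hσ : σ u = 1 ↔ σ x ≠ 1 := by
      rcases hux with h | h <;> omega
    rw [List.isChain_cons] at hc
    have ih' := ih hc.2 fun e he => by
      have := hc.1 e he
      tauto
    rw [Subgraph.mem_edgeSet, hM] at h1
    have hle : π u ≤ π x ∧ (s(u, x) ∉ M.edgeSet → π u < π x) := by
      rw [Subgraph.mem_edgeSet, hM]
      by_cases h2 : π u = π x
      · exact ⟨h2.le, fun h' => absurd ⟨h, h2⟩ h'⟩
      · have h3 : σ u ≠ 1 := fun h' => h2 (h1.2 h').2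
        rcases hux with h4 | h4
        · exact ⟨h4.2.2, fun _ => lt_of_le_of_ne h4.2.2 h2⟩
        · exact absurd h4.2.1 h3
    refine ⟨hle.1.trans ih'.1, ?_⟩
    rw [Walk.edges_cons]
    rintro ⟨e, he, heM⟩
    rcases List.mem_cons.1 he with rfl | he
    · exact (hle.2 heM).trans_le ih'.1
    · exact hle.1.trans_lt (ih'.2 ⟨e, he, heM⟩)

/-- A closed walk returns to its initial position, but an alternating cycle contains an edge outside
`M`, at which the position strictly rises or strictly falls, always in the same sense. -/
theorem not_isAlternatingCycle_of_edgeOK {M : G.Subgraph}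
    (hM : ∀ u v, M.Adj u v ↔ G.Adj u v ∧ π u = π v)
    (hadj : ∀ u v, G.Adj u v → EdgeOK π σ u v) {v : V} (p : G.Walk v v) :
    ¬ IsAlternatingCycle M p := by
  rintro ⟨hcyc, hch⟩
  have hlen := hcyc.three_le_length
  cases p with
  | nil => simp at hlen
  | @cons _ x _ h p =>
    rw [Walk.edges_cons, Cycle.chain_coe_cons] at hch
    have hch' : (Walk.cons h p).edges.IsChain fun e f => e ∈ M.edgeSet ↔ f ∉ M.edgeSet := by
      rw [Walk.edges_cons]
      exact (List.isChain_append (l₁ := s(v, x) :: p.edges)).1 hch |>.1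
    have hex : ∃ e ∈ (Walk.cons h p).edges, e ∉ M.edgeSet := by
      cases p with
      | nil => simp at hlen
      | @cons _ y _ h' p =>
        simp only [Walk.edges_cons, List.isChain_cons_cons] at hch'
        by_cases h1 : s(v, x) ∈ M.edgeSet
        · exact ⟨s(x, y), by simp, hch'.1.1 h1⟩
        · exact ⟨s(v, x), by simp, h1⟩
    by_cases h0 : s(v, x) ∈ M.edgeSet ↔ σ v = 1
    · exact lt_irrefl _ ((Walk.le_of_isChain hM hadj _ hch' (by simpa using h0)).2 hex)
    -- If the cycle runs downwards, the order and the colours are reversed instead of the cycle.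
    · have hM' : ∀ u v, M.Adj u v ↔ G.Adj u v ∧ OrderDual.toDual (π u) = OrderDual.toDual (π v) :=
        fun u v => (hM u v).trans (and_congr_right fun _ => OrderDual.toDual_inj.symm)
      have hadj' : ∀ u v, G.Adj u v →
          EdgeOK (fun u => OrderDual.toDual (π u)) (fun u => 1 - σ u) u v := by
        intro u v huv
        rcases hadj u v huv with h | h
        · exact Or.inr ⟨by simp [h.2.1], by simp [h.1], OrderDual.toDual_le_toDual.2 h.2.2⟩
        · exact Or.inl ⟨by simp [h.2.1], by simp [h.1], OrderDual.toDual_le_toDual.2 h.2.2⟩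
      have hv : σ v = 0 ∨ σ v = 1 := by
        rcases hadj v x h with h | h <;> omega
      refine lt_irrefl _ ((Walk.le_of_isChain hM' hadj' _ hch' ?_).2 hex)
      simp only [Walk.edges_cons, List.head?_cons, Option.mem_some_iff, forall_eq']
      rcases hv with hv | hv <;> simp only [hv] at h0 ⊢ <;> simpa using h0

end Ordered

/-- The edges of `M`, directed from colour `1` to colour `0`, and the other edges, directed from colour
`0` to colour `1`. -/
def Arc (M : G.Subgraph) (σ : V → ℕ) (u v : V) : Prop := G.Adj u v ∧ (M.Adj u v ↔ σ u = 1)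

section Acyclic

variable {M : G.Subgraph} {σ : V → ℕ}

theorem exists_walk_of_reflTransGen_arc {u v : V} (h : Relation.ReflTransGen (Arc M σ) u v) :
    ∃ p : G.Walk u v, ∀ d ∈ p.darts, Arc M σ d.fst d.snd := by
  induction h with
  | refl => exact ⟨.nil, by simp⟩
  | tail _ h ih =>
    obtain ⟨p, hp⟩ := ih
    refine ⟨p.concat h.1, fun d hd => ?_⟩
    rw [Walk.darts_concat, List.concat_eq_append, List.mem_append, List.mem_singleton] at hd
    rcases hd with hd | rfl
    · exact hp d hd
    · exact h

theorem isChain_edges_of_arc (hσ : ∀ u v, G.Adj u v → (σ u = 1 ↔ σ v ≠ 1)) {u v : V} (p : G.Walk u v)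
    (hp : ∀ d ∈ p.darts, Arc M σ d.fst d.snd) :
    p.edges.IsChain fun e f => e ∈ M.edgeSet ↔ f ∉ M.edgeSet := by
  induction p with
  | nil => simp
  | @cons u x w h p ih =>
    rw [Walk.edges_cons, List.isChain_cons]
    refine ⟨fun e he => ?_, ih fun d hd => hp d (by simp [hd])⟩
    cases p with
    | nil => simp at he
    | @cons _ y _ h' p =>
      simp only [Walk.edges_cons, List.head?_cons, Option.mem_some_iff] at he
      subst he
      have h1 : Arc M σ u x := hp ⟨(u, x), h⟩ (by simp)
      have h2 : Arc M σ x y := hp ⟨(x, y), h'⟩ (by simp)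
      rw [Subgraph.mem_edgeSet, Subgraph.mem_edgeSet, h1.2, h2.2]
      exact hσ u x h

/-- A directed walk from `b` back to `a` can be shortened to a path; closing it with the matching
edge gives an alternating cycle. -/
theorem not_reflTransGen_arc (hσ : ∀ u v, G.Adj u v → (σ u = 1 ↔ σ v ≠ 1))
    (hM : ∀ (v : V) (p : G.Walk v v), ¬ IsAlternatingCycle M p) {a b : V} (hab : M.Adj a b)
    (ha : σ a = 1) : ¬ Relation.ReflTransGen (Arc M σ) b a := by
  classical
  intro h
  obtain ⟨p, hp⟩ := exists_walk_of_reflTransGen_arc h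
  have harc : Arc M σ a b := ⟨hab.adj_sub, iff_of_true hab ha⟩
  obtain ⟨q, hpath, hq⟩ : ∃ q : G.Walk b a, q.IsPath ∧ ∀ d ∈ q.darts, Arc M σ d.fst d.snd :=
    ⟨p.bypass, p.bypass_isPath, fun d hd => hp d (p.darts_bypass_subset_darts hd)⟩
  refine hM a (.cons harc.1 q) ⟨(Walk.cons_isCycle_iff _ _).2 ⟨hpath, fun he => ?_⟩, ?_⟩
  -- The path does not use the closing edge: traversed from `a` to `b` it would revisit the start,
  -- and traversed from `b` to `a` it would be a matching edge leaving colour 0, which is no arc.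
  · obtain ⟨d, hd, hde⟩ := List.mem_map.1 he
    have hd' := hq d hd
    rcases (Sym2.eq_iff (x := d.fst) (y := d.snd)).1 hde with ⟨h₁, h₂⟩ | ⟨h₁, h₂⟩
    · have h3 : d.snd ∈ q.support.tail := by
        rw [← Walk.map_snd_darts]
        exact List.mem_map_of_mem hd
      have h4 := hpath.support_nodup
      rw [← Walk.cons_tail_support, List.nodup_cons] at h4
      exact h4.1 (h₂ ▸ h3)
    · rw [h₁, h₂] at hd'
      exact (hσ a b harc.1).1 ha (hd'.2.1 hab.symm)
  · rw [Walk.edges_cons, Cycle.chain_coe_cons]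
    -- The first edge is appended once more, so that the chain condition also covers the wrap-around
    -- of the cycle.
    have := isChain_edges_of_arc (M := M) hσ (.cons harc.1 (q.concat harc.1)) (by
      intro d hd
      simp only [Walk.darts_cons, Walk.darts_concat, List.mem_cons, List.concat_eq_append,
        List.mem_append, List.not_mem_nil, or_false] at hd
      rcases hd with rfl | hd | rfl
      · exact harc
      · exact hq d hd
      · exact harc)
    rwa [Walk.edges_cons, Walk.edges_concat, List.concat_eq_append] at this

theorem not_transGen_arc (hσ : ∀ u v, G.Adj u v → (σ u = 1 ↔ σ v ≠ 1))
    (hM : ∀ (v : V) (p : G.Walk v v), ¬ IsAlternatingCycle M p) (u : V) :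
    ¬ Relation.TransGen (Arc M σ) u u := by
  have key : ∀ u, σ u = 1 → ¬ Relation.TransGen (Arc M σ) u u := by
    intro u hu h
    obtain ⟨v, huv, hvu⟩ := Relation.TransGen.head'_iff.1 h
    exact not_reflTransGen_arc hσ hM (huv.2.2 hu) hu hvu
  intro h
  obtain ⟨v, huv, hvu⟩ := Relation.TransGen.head'_iff.1 h
  by_cases hu : σ u = 1
  · exact key u hu h
  · exact key v (by_contra fun h => hu ((hσ u v huv.1).2 h)) (Relation.TransGen.tail' hvu huv)

/-- An alternating cycle-free matching is the set of the edges on which a suitable order of the vertices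
is constant. -/
theorem exists_order [Fintype V] (hM : IsAlternatingCycleFreeMatching M)
    (hσ : ∀ u v, G.Adj u v → (σ u = 1 ↔ σ v ≠ 1)) (hσ1 : ∀ u, σ u ≤ 1) :
    ∃ π : V → ℚ, (∀ u v, G.Adj u v → EdgeOK π σ u v) ∧
      ∀ u v, M.Adj u v ↔ G.Adj u v ∧ π u = π v := by
  classical
  -- The position of `x` will be the number of colour-0 vertices from which `x` is reached by at
  -- least one arc. The only arc into the colour-0 end of a matching edge comes from its partner, so
  -- both ends have the same such vertices. Along any other edge from `b` of colour 0 to `a`, the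
  -- vertex `b` itself is gained, by acyclicity.
  let pre : V → Finset V := fun x =>
    Finset.univ.filter fun z => σ z = 0 ∧ Relation.TransGen (Arc M σ) z x
  have hpre : ∀ a b, M.Adj a b → σ a = 1 → pre b = pre a := by
    intro a b hab ha
    ext z
    simp only [pre, Finset.mem_filter, Finset.mem_univ, true_and]
    refine and_congr_right fun hz => ⟨fun h => ?_, fun h => h.tail ⟨hab.adj_sub, iff_of_true hab ha⟩⟩
    obtain ⟨y, hzy, hyb⟩ := Relation.TransGen.tail'_iff.1 h
    have hb : σ b ≠ 1 := (hσ a b hab.adj_sub).1 ha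
    have hy : M.Adj y b := hyb.2.2 ((hσ y b hyb.1).2 hb)
    obtain rfl : y = a := by
      obtain ⟨w, -, hw⟩ := hM.1 hab.snd_mem
      exact (hw y hy.symm).trans (hw a hab.symm).symm
    rcases Relation.reflTransGen_iff_eq_or_transGen.1 hzy with h | h
    · subst h; omega
    · exact h
  have hlt : ∀ b a, G.Adj b a → σ b = 0 → ¬ M.Adj b a → pre b ⊂ pre a := by
    intro b a hba hb hn
    have harc : Arc M σ b a := ⟨hba, iff_of_false hn (by omega)⟩
    refine (Finset.ssubset_iff_of_subset fun z hz => ?_).2 ⟨b, ?_, ?_⟩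
    · simp only [pre, Finset.mem_filter, Finset.mem_univ, true_and] at hz ⊢
      exact ⟨hz.1, hz.2.tail harc⟩
    · simpa only [pre, Finset.mem_filter, Finset.mem_univ, true_and] using
        ⟨hb, Relation.TransGen.single harc⟩
    · simp only [pre, Finset.mem_filter, Finset.mem_univ, true_and, not_and]
      exact fun _ => not_transGen_arc hσ hM.2 b
  have hcase : ∀ b a, G.Adj b a → σ b = 0 →
      σ a = 1 ∧ (pre b).card ≤ (pre a).card ∧ (M.Adj b a ↔ (pre b).card = (pre a).card) := by
    intro b a hba hb
    have ha : σ a = 1 := by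
      by_contra h
      have := (hσ b a hba).2 h
      omega
    by_cases hm : M.Adj b a
    · have := hpre a b hm.symm ha
      exact ⟨ha, by rw [this], iff_of_true hm (by rw [this])⟩
    · have := Finset.card_lt_card (hlt b a hba hb hm)
      exact ⟨ha, this.le, iff_of_false hm this.ne⟩
  refine ⟨fun x => ((pre x).card : ℚ), fun u v huv => ?_, fun u v => ?_⟩
  · by_cases hu : σ u = 0
    · obtain ⟨h₁, h₂, -⟩ := hcase u v huv hu
      exact Or.inl ⟨hu, h₁, Nat.cast_le.2 h₂⟩
    · have hv : σ v = 0 := by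
        have := hσ u v huv
        have := hσ1 u
        have := hσ1 v
        omega
      obtain ⟨h₁, h₂, -⟩ := hcase v u huv.symm hv
      exact Or.inr ⟨hv, h₁, Nat.cast_le.2 h₂⟩
  · by_cases huv : G.Adj u v
    · simp only [huv, true_and, Nat.cast_inj]
      by_cases hu : σ u = 0
      · exact (hcase u v huv hu).2.2
      · have hv : σ v = 0 := by
          have := hσ u v huv
          have := hσ1 u
          have := hσ1 v
          omega
        rw [M.adj_comm, (hcase v u huv.symm hv).2.2, eq_comm]
    · exact iff_of_false (fun h => huv h.adj_sub) fun h => huv h.1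

end Acyclic

/-- The edges on which `π` is constant. -/
def tightSubgraph {α : Type*} (G : SimpleGraph V) (π : V → α) : G.Subgraph where
  verts := {u | ∃ v, G.Adj u v ∧ π u = π v}
  Adj u v := G.Adj u v ∧ π u = π v
  adj_sub h := h.1
  edge_vert h := ⟨_, h⟩
  symm := ⟨fun _ _ h => ⟨h.1.symm, h.2.symm⟩⟩

namespace TreeDecomposition

variable {I : Type*} {D : G.TreeDecomposition I} {r : I}

/-- An unprocessed edge would have both ends in the root bag, which is too small for that. -/
theorem processed_root (hroot : (D.bag r).card ≤ 1) {u v : V} : D.Processed r r u v ↔ G.Adj u v := by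
  refine ⟨And.left, fun h => ⟨h, ?_⟩⟩
  by_contra! hcon
  have hu : u ∈ D.bag r := by_contra fun hu => hcon.1 ⟨mem_below_root u, hu⟩
  have hv : v ∈ D.bag r := by_contra fun hv => hcon.2 ⟨mem_below_root v, hv⟩
  exact h.ne (Finset.card_le_one.1 hroot u hu v hv)

variable [Fintype V]

open Classical in
theorem tdeg_eq_card {i : I} {π : V → ℚ} {u : V} :
    D.tdeg r i π u = (Finset.univ.filter fun v => D.Processed r i u v ∧ π u = π v).card := by
  rw [tdeg, Finset.card_filter]
  exact Finset.sum_congr rfl fun v _ => by congr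

/-- Every edge has exactly one endpoint of colour 0, and that is where `cnt` counts it. -/
theorem cnt_root (hroot : (D.bag r).card ≤ 1) {π : V → ℚ} {σ : V → ℕ}
    (hadj : ∀ u v, G.Adj u v → EdgeOK π σ u v) {M : G.Subgraph}
    (hM : ∀ u v, M.Adj u v ↔ G.Adj u v ∧ π u = π v) : D.cnt r r π σ = M.edgeSet.ncard := by
  classical
  have h1 : M.edgeSet = (fun p : V × V => s(p.1, p.2)) ''
      (((Finset.univ : Finset (V × V)).filter fun p => σ p.1 = 0 ∧ M.Adj p.1 p.2 : Finset (V × V)) :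
        Set (V × V)) := by
    ext e
    induction e using Sym2.ind with
    | _ u v =>
      simp only [Subgraph.mem_edgeSet, Set.mem_image, Finset.coe_filter, Finset.mem_univ, true_and,
        Set.mem_ofPred_eq, Prod.exists]
      constructor
      · intro h
        rcases hadj u v h.adj_sub with h' | h'
        · exact ⟨u, v, ⟨h'.1, h⟩, rfl⟩
        · exact ⟨v, u, ⟨h'.1, h.symm⟩, Sym2.eq_swap⟩
      · rintro ⟨a, b, ⟨-, h⟩, he⟩
        rw [← Subgraph.mem_edgeSet, ← he]
        exact h
  rw [h1, Set.InjOn.ncard_image, Set.ncard_coe_finset, Finset.card_filter, Fintype.sum_prod_type]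
  · unfold cnt tdeg
    refine Finset.sum_congr rfl fun u _ => ?_
    by_cases hu : σ u = 0
    · simp only [hu, if_true, true_and, processed_root hroot, hM]
    · simp [hu]
  · rintro ⟨a, b⟩ h ⟨a', b'⟩ h' he
    simp only [Finset.coe_filter, Finset.mem_univ, true_and, Set.mem_ofPred_eq] at h h'
    rcases Sym2.eq_iff.1 he with ⟨h₁, h₂⟩ | ⟨h₁, h₂⟩
    · simp only at h₁ h₂; rw [h₁, h₂]
    · simp only at h₁ h₂
      subst h₁ h₂
      rcases hadj a b h.2.adj_sub with h'' | h'' <;> omega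

/-- The table of the root gives the size of a maximum alternating cycle-free matching. -/
theorem Correct.isMax {T : Tables V I} (h : D.Correct r T r) (hsurj : D.Surjective T)
    (hroot : (D.bag r).card ≤ 1) (hbip : G.IsBipartite) :
    G.IsMaxAlternatingCycleFreeMatchingSize ((Finset.range T.N).sup (T.tab r) - 1) := by
  classical
  obtain ⟨col⟩ := hbip
  let σ : V → ℕ := fun v => (col v : ℕ)
  have hσ1 : ∀ u, σ u ≤ 1 := fun u => by
    have := (col u).isLt
    simp only [σ]; omega
  have hσ : ∀ u v, G.Adj u v → (σ u = 1 ↔ σ v ≠ 1) := by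
    intro u v huv
    have h1 := col.valid huv
    have h2 : σ u ≠ σ v := fun h => h1 (Fin.ext h)
    have := hσ1 u
    have := hσ1 v
    omega
  have hle : ∀ M : G.Subgraph, IsAlternatingCycleFreeMatching M →
      M.edgeSet.ncard + 1 ≤ (Finset.range T.N).sup (T.tab r) := by
    intro M hM
    obtain ⟨π, hadj, hπ⟩ := exists_order hM hσ hσ1
    have hdeg : ∀ i u, D.tdeg r i π u ≤ 1 := by
      intro i u
      rw [tdeg_eq_card, Finset.card_le_one]
      intro a ha b hb
      simp only [Finset.mem_filter, Finset.mem_univ, true_and] at ha hb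
      have ha' := (hπ u a).2 ⟨ha.1.1, ha.2⟩
      have hb' := (hπ u b).2 ⟨hb.1.1, hb.2⟩
      obtain ⟨w, -, hw⟩ := hM.1 ha'.fst_mem
      exact (hw a ha').trans (hw b hb').symm
    obtain ⟨c, hc, hrep⟩ := hsurj.exists_represents (r := r) hσ1 r (hdeg r)
    have h1 := h.cnt_lt π σ hadj hσ1 hdeg c hc hrep
    rw [cnt_root hroot hadj hπ] at h1
    exact h1.trans (Finset.le_sup (f := T.tab r) (Finset.mem_range.2 hc))
  refine ⟨?_, ?_⟩
  -- The empty matching makes the supremum positive. Hence the best entry is feasible and the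
  -- truncated subtraction of one loses nothing.
  · have hbot : IsAlternatingCycleFreeMatching (⊥ : G.Subgraph) := by
      refine ⟨by simp [Subgraph.IsMatching], ?_⟩
      rintro v p ⟨hp, hc⟩
      have hlen := hp.three_le_length
      match p with
      | .nil => simp at hlen
      | .cons h .nil => simp at hlen
      | .cons h (.cons h' q) =>
        rw [Walk.edges_cons, Walk.edges_cons, Cycle.chain_coe_cons] at hc
        simp only [List.cons_append, List.isChain_cons_cons, Subgraph.edgeSet_bot] at hc
        simpa using hc.1
    have hpos := hle ⊥ hbot
    have hne : (Finset.range T.N).Nonempty := by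
      by_contra hne
      rw [Finset.not_nonempty_iff_eq_empty.1 hne] at hpos
      simp at hpos
    obtain ⟨c, hc, hsup⟩ := Finset.exists_mem_eq_sup _ hne (T.tab r)
    rw [hsup] at hpos ⊢
    -- The solution brings its own 2-colouring `s`, which need not be the `σ` fixed above; the
    -- matching depends only on `π`.
    obtain ⟨π, s, -, hsol, htab⟩ := h.exists_solution c (Finset.mem_range.1 hc) (by omega)
    have hadj : ∀ u v, G.Adj u v → EdgeOK π s u v :=
      fun u v huv => hsol.edge u v ((processed_root hroot).2 huv)
    have hM : ∀ u v, (G.tightSubgraph π).Adj u v ↔ G.Adj u v ∧ π u = π v := fun _ _ => Iff.rfl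
    refine ⟨G.tightSubgraph π, ⟨?_, fun v p => not_isAlternatingCycle_of_edgeOK hM hadj p⟩, ?_⟩
    · rintro u ⟨v, huv⟩
      refine ⟨v, huv, fun w hw => ?_⟩
      have := hsol.deg u
      rw [tdeg_eq_card, Finset.card_le_one] at this
      simp only [Finset.mem_filter, Finset.mem_univ, true_and, processed_root hroot] at this
      exact this w hw v huv
    · rw [htab, ← cnt_root hroot hadj hM, Nat.add_sub_cancel]
  · rintro _ ⟨M, hM, rfl⟩
    have := hle M hM
    omega

end TreeDecomposition

end SimpleGraph

/-! ### From the numerical data to the graph and its decomposition -/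

open SimpleGraph TreeDecomposition

theorem List.sum_range_ite_lt_length {α : Type*} (l : List α) {N : ℕ} (hN : l.length ≤ N)
    {f : ℕ → ℕ} {g : α → ℕ} (hfg : ∀ q (hq : q < l.length), f q = g l[q]) :
    (∑ q ∈ Finset.range N, if q < l.length then f q else 0) = (l.map g).sum := by
  rw [← Finset.sum_filter]
  have : (Finset.range N).filter (· < l.length) = Finset.range l.length := by
    ext q
    simp only [Finset.mem_filter, Finset.mem_range]
    omega
  rw [this, Finset.sum_range, ← Fin.sum_univ_fun_getElem]
  exact Finset.sum_congr rfl fun q _ => hfg q q.2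

namespace RAM.Data

variable {n b : ℕ} {G : SimpleGraph (Fin n)}

/-- The data describe the graph `G` and its tree decomposition `D`. -/
structure Reads (Δ : Data) (D : G.TreeDecomposition (Fin b)) (r : Fin b)
    (children : Fin b → List (Fin b)) (elems : Fin b → List (Fin n)) (K : ℕ) : Prop where
  children_nodup : ∀ i, (children i).Nodup
  mem_children : ∀ i j, j ∈ children i ↔ D.IsChild r i j
  length_children : ∀ i, (children i).length ≤ 2
  elems_nodup : ∀ i, (elems i).Nodup
  mem_elems : ∀ i v, v ∈ elems i ↔ v ∈ D.bag i
  length_elems : ∀ i, (elems i).length < K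
  two_le : 2 ≤ K
  N_eq : Δ.N = K ^ (3 * K)
  nch : ∀ i : Fin b, Δ.nch i = (children i).length
  child : ∀ (i : Fin b) (a : ℕ) (h : a < (children i).length), Δ.child i a = (children i)[a]
  size : ∀ i : Fin b, Δ.size i = (elems i).length
  elem : ∀ (i : Fin b) (q : ℕ) (h : q < (elems i).length), Δ.elem i q = (elems i)[q]
  adj : ∀ u v : Fin n, Δ.adj u v ≠ 0 ↔ G.Adj u v
  dig : ∀ c < Δ.N, ∀ j < 3 * K, Δ.dig c j = c / K ^ j % K

/-- The labels and the table of the data. -/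
noncomputable def tables (Δ : Data) (n b : ℕ) : Tables (Fin n) (Fin b) where
  N := Δ.N
  lab κ i c v := Δ.lab κ i c v
  tab i c := Δ.tab i c

namespace Reads

variable {Δ : Data} {D : G.TreeDecomposition (Fin b)} {r : Fin b}
  {children : Fin b → List (Fin b)} {elems : Fin b → List (Fin n)} {K : ℕ}
  (h : Δ.Reads D r children elems K)

include h

theorem K_le_N : K ≤ Δ.N := by
  rw [h.N_eq]
  exact Nat.le_self_pow (by have := h.two_le; omega) K

theorem length_elems_le (i : Fin b) : (elems i).length ≤ Δ.N :=
  (h.length_elems i).le.trans h.K_le_N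

theorem length_children_le (i : Fin b) : (children i).length ≤ Δ.N :=
  (h.length_children i).trans (h.two_le.trans h.K_le_N)

theorem toFinset_elems (i : Fin b) : (elems i).toFinset = D.bag i := by
  ext v
  rw [List.mem_toFinset, h.mem_elems]

theorem sumBag (i : Fin b) {f : ℕ → ℕ} {g : Fin n → ℕ} (hf : ∀ v : Fin n, f v = g v) :
    Δ.sumBag i f = ∑ v ∈ D.bag i, g v := by
  classical
  rw [← h.toFinset_elems, List.sum_toFinset _ (h.elems_nodup i),
    ← List.sum_range_ite_lt_length (elems i) (h.length_elems_le i) (f := fun q => f (Δ.elem i q))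
      (fun q hq => by rw [h.elem i q hq, hf]), Data.sumBag]
  refine Finset.sum_congr rfl fun q _ => ?_
  rw [h.size]

theorem allBag (i : Fin b) {P : ℕ → Prop} {Q : Fin n → Prop} (hP : ∀ v : Fin n, P v ↔ Q v) :
    Δ.AllBag i P ↔ ∀ v ∈ D.bag i, Q v := by
  unfold AllBag
  constructor
  · intro H v hv
    obtain ⟨q, hq, rfl⟩ := List.mem_iff_getElem.1 ((h.mem_elems i v).2 hv)
    rw [← hP, ← h.elem i q hq]
    exact H q (hq.trans_le (h.length_elems_le i)) (by rwa [h.size])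
  · intro H q _ hq
    rw [h.size] at hq
    rw [h.elem i q hq, hP]
    exact H _ ((h.mem_elems i _).1 (List.getElem_mem hq))

theorem inBag (i : Fin b) (v : Fin n) : Δ.InBag i v ↔ v ∈ D.bag i := by
  rw [← h.mem_elems, List.mem_iff_getElem]
  constructor
  · rintro ⟨q, -, hq, he⟩
    rw [h.size] at hq
    rw [h.elem i q hq] at he
    exact ⟨q, hq, Fin.ext he⟩
  · rintro ⟨q, hq, rfl⟩
    exact ⟨q, hq.trans_le (h.length_elems_le i), by rwa [h.size], h.elem i q hq⟩

theorem lab_getElem (κ : ℕ) (i : Fin b) (c : ℕ) {q : ℕ} (hq : q < (elems i).length) :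
    Δ.lab κ i c ((elems i)[q] : Fin n) = Δ.dig c (3 * q + κ) := by
  rw [lab, Finset.sum_eq_single q]
  · rw [if_pos ⟨by rwa [h.size], h.elem i q hq⟩]
  · intro q' _ hne
    rw [if_neg]
    rintro ⟨hq', he⟩
    rw [h.size] at hq'
    rw [h.elem i q' hq'] at he
    exact hne ((h.elems_nodup i).getElem_inj_iff.1 (Fin.ext he))
  · intro hq'
    exact absurd (Finset.mem_range.2 (hq.trans_le (h.length_elems_le i))) hq'

theorem new (i : Fin b) (u v : Fin n) : Δ.New i u v ↔ D.NewEdge i u v := by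
  rw [New, NewEdge, h.adj, h.inBag, h.inBag]

theorem ndeg (i j : Fin b) (e : ℕ) (u : Fin n) :
    Δ.ndeg i j e u = D.ndeg i j ((Δ.tables n b).lab 0 j e) u := by
  classical
  refine h.sumBag j fun v => ?_
  rw [h.new]
  by_cases hv : D.NewEdge i u v ∧ Δ.lab 0 j e u = Δ.lab 0 j e v
  · exact (if_pos hv).trans (if_pos hv).symm
  · exact (if_neg hv).trans (if_neg hv).symm

theorem gain (i j : Fin b) (e : ℕ) :
    Δ.gain i j e = D.gain i j ((Δ.tables n b).lab 0 j e) ((Δ.tables n b).lab 1 j e) := by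
  classical
  refine h.sumBag j fun v => ?_
  rw [h.ndeg]
  rfl

theorem toFinset_children (i j : Fin b) : j ∈ (children i).toFinset ↔ D.IsChild r i j := by
  rw [List.mem_toFinset, h.mem_children]

theorem sumChild {i : Fin b} {c₁ c₂ : ℕ} {γ : Fin b → ℕ}
    (hγ : ∀ a (ha : a < (children i).length), γ (children i)[a] = pick c₁ c₂ a)
    {f : ℕ → ℕ → ℕ} {g : Fin b → ℕ} (hf : ∀ j : Fin b, f j (γ j) = g j) :
    Δ.sumChild i c₁ c₂ f = ∑ j ∈ (children i).toFinset, g j := by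
  classical
  rw [List.sum_toFinset _ (h.children_nodup i),
    ← List.sum_range_ite_lt_length (children i) (h.length_children_le i)
      (f := fun a => f (Δ.child i a) (pick c₁ c₂ a))
      (fun a ha => by rw [h.child i a ha, ← hγ a ha, hf]), Data.sumChild]
  refine Finset.sum_congr rfl fun q _ => ?_
  rw [h.nch]

/-- The program quantifies over a pair of codes and the combinatorial recursion over a function on
nodes; the two are matched through the index of a child in its list. -/
theorem ok_iff {i : Fin b} {c c₁ c₂ : ℕ} {γ : Fin b → ℕ}
    (hγ : ∀ a (ha : a < (children i).length), γ (children i)[a] = pick c₁ c₂ a)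
    (hlt : ∀ j ∈ children i, γ j < Δ.N) :
    Δ.OK i c c₁ c₂ ↔ D.Compat (Δ.tables n b) (children i).toFinset i c γ := by
  classical
  have h₁ : (∀ a < Δ.N, a < Δ.nch i → Δ.ChildOK i c (Δ.child i a) (pick c₁ c₂ a)) ↔
      ∀ j ∈ (children i).toFinset, Δ.ChildOK i c j (γ j) := by
    constructor
    · intro H j hj
      obtain ⟨a, ha, rfl⟩ := List.mem_iff_getElem.1 (List.mem_toFinset.1 hj)
      rw [← h.child i a ha, hγ a ha]
      exact H a (ha.trans_le (h.length_children_le i)) (by rwa [h.nch])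
    · intro H a _ ha
      rw [h.nch] at ha
      rw [h.child i a ha, ← hγ a ha]
      exact H _ (List.mem_toFinset.2 (List.getElem_mem ha))
  have h₂ := h.allBag i (P := fun u => Δ.lab 2 i c u ≤ 1 ∧
    Δ.lab 2 i c u = Δ.sumChild i c₁ c₂ fun j e =>
      if Δ.InBag j u then Δ.lab 2 j e u + Δ.ndeg i j e u else 0)
    (Q := fun u => (Δ.tables n b).lab 2 i c u ≤ 1 ∧
      (Δ.tables n b).lab 2 i c u = ∑ j ∈ (children i).toFinset, if u ∈ D.bag j then
        (Δ.tables n b).lab 2 j (γ j) u + D.ndeg i j ((Δ.tables n b).lab 0 j (γ j)) u else 0)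
    (fun u => by
      rw [h.sumChild hγ]
      · rfl
      · intro j
        rw [h.ndeg]
        exact if_congr (h.inBag j u) rfl rfl)
  have h₃ : ∀ j : Fin b, Δ.ChildOK i c j (γ j) ↔ (Δ.tables n b).tab j (γ j) ≠ 0 ∧
      ∀ u ∈ D.bag j, (u ∈ D.bag i → (Δ.tables n b).lab 1 i c u = (Δ.tables n b).lab 1 j (γ j) u) ∧
        (u ∉ D.bag i →
          (Δ.tables n b).lab 2 j (γ j) u + D.ndeg i j ((Δ.tables n b).lab 0 j (γ j)) u ≤ 1) ∧
        ∀ v ∈ D.bag j, (u ∈ D.bag i → v ∈ D.bag i →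
            ((Δ.tables n b).lab 0 i c u < (Δ.tables n b).lab 0 i c v ↔
              (Δ.tables n b).lab 0 j (γ j) u < (Δ.tables n b).lab 0 j (γ j) v)) ∧
          (D.NewEdge i u v →
            EdgeOK ((Δ.tables n b).lab 0 j (γ j)) ((Δ.tables n b).lab 1 j (γ j)) u v) := by
    intro j
    refine and_congr Iff.rfl (h.allBag j fun u => ?_)
    rw [h.inBag, h.ndeg]
    refine and_congr Iff.rfl (and_congr Iff.rfl (h.allBag j fun v => ?_))
    rw [h.inBag, h.new]
    rfl
  rw [OK, h₁, h₂]
  simp only [h₃]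
  constructor
  · rintro ⟨H₁, H₂⟩
    exact ⟨fun j hj => hlt j (List.mem_toFinset.1 hj), fun j hj => (H₁ j hj).1,
      fun j hj u hu => ((H₁ j hj).2 u hu).1, fun j hj u hu => ((H₁ j hj).2 u hu).2.1,
      fun j hj u hu v hv => (((H₁ j hj).2 u hu).2.2 v hv).1,
      fun j hj u hu v hv => (((H₁ j hj).2 u hu).2.2 v hv).2,
      fun u hu => (H₂ u hu).1, fun u hu => (H₂ u hu).2.trans
        (Finset.sum_congr rfl fun _ _ => by congr)⟩
  · intro H
    exact ⟨fun j hj => ⟨H.ne_zero j hj, fun u hu => ⟨H.side j hj u hu, H.deg_le j hj u hu,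
      fun v hv => ⟨H.order j hj u hu v hv, H.edge j hj u hu v hv⟩⟩⟩,
      fun u hu => ⟨H.le_one u hu, (H.deg u hu).trans (Finset.sum_congr rfl fun _ _ => by congr)⟩⟩

theorem value {i : Fin b} {c₁ c₂ : ℕ} {γ : Fin b → ℕ}
    (hγ : ∀ a (ha : a < (children i).length), γ (children i)[a] = pick c₁ c₂ a) :
    (1 + Δ.sumChild i c₁ c₂ fun j e => Δ.tab j e - 1 + Δ.gain i j e) =
      D.value (Δ.tables n b) (children i).toFinset i γ := by
  rw [TreeDecomposition.value, h.sumChild hγ]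
  intro j
  rw [h.gain]
  rfl

theorem isStep {i : Fin b} (hi : ∀ c < Δ.N, Δ.tab i c = Δ.step i c) :
    D.IsStep (Δ.tables n b) (children i).toFinset i := by
  classical
  refine ⟨fun c hc h0 => ?_, fun c hc γ hγ => ?_⟩
  · change Δ.tab i c ≠ 0 at h0
    change ∃ γ, _ ∧ Δ.tab i c = _
    rw [hi c hc] at h0 ⊢
    have hne : (Finset.range Δ.N).Nonempty := ⟨c, Finset.mem_range.2 hc⟩
    unfold step at h0 ⊢
    obtain ⟨c₁, hc₁, h₁⟩ := Finset.exists_mem_eq_sup _ hne fun c₁ => (Finset.range Δ.N).sup fun c₂ =>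
      if Δ.OK i c c₁ c₂ then 1 + Δ.sumChild i c₁ c₂ fun j e => Δ.tab j e - 1 + Δ.gain i j e else 0
    obtain ⟨c₂, hc₂, h₂⟩ := Finset.exists_mem_eq_sup _ hne fun c₂ =>
      if Δ.OK i c c₁ c₂ then 1 + Δ.sumChild i c₁ c₂ fun j e => Δ.tab j e - 1 + Δ.gain i j e else 0
    rw [h₁, h₂] at h0 ⊢
    have hok : Δ.OK i c c₁ c₂ := by
      by_contra hok
      rw [if_neg hok] at h0
      exact h0 rfl
    rw [if_pos hok]
    have hγ : ∀ a (ha : a < (children i).length),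
        (fun j => pick c₁ c₂ ((children i).idxOf j)) (children i)[a] = pick c₁ c₂ a := by
      intro a ha
      simp only [(h.children_nodup i).idxOf_getElem a ha]
    have hlt : ∀ j ∈ children i, (fun j => pick c₁ c₂ ((children i).idxOf j)) j < Δ.N := by
      intro j _
      have h₁ := Finset.mem_range.1 hc₁
      have h₂ := Finset.mem_range.1 hc₂
      simp only [pick]
      split_ifs <;> assumption
    exact ⟨_, (h.ok_iff hγ hlt).1 hok, h.value hγ⟩
  · change _ ≤ Δ.tab i c
    rw [hi c hc]
    obtain ⟨c₁, c₂, hc₁, hc₂, hp⟩ : ∃ c₁ c₂, c₁ < Δ.N ∧ c₂ < Δ.N ∧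
        ∀ a (ha : a < (children i).length), γ (children i)[a] = pick c₁ c₂ a := by
      have hN : 0 < Δ.N := by have := h.K_le_N; have := h.two_le; omega
      have hlen := h.length_children i
      have hm : ∀ a (ha : a < (children i).length), γ (children i)[a] < Δ.N :=
        fun a ha => hγ.lt _ (List.mem_toFinset.2 (List.getElem_mem ha))
      -- Two codes suffice, as there are at most two children; the code of a missing child is never
      -- read and may be 0.
      refine ⟨if ha : 0 < (children i).length then γ (children i)[0] else 0,
        if ha : 1 < (children i).length then γ (children i)[1] else 0, ?_, ?_, fun a ha => ?_⟩
      · split_ifs with ha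
        · exact hm 0 ha
        · exact hN
      · split_ifs with ha
        · exact hm 1 ha
        · exact hN
      · obtain rfl | rfl : a = 0 ∨ a = 1 := by omega
        · simp [pick, ha]
        · simp [pick, ha]
    have hok := (h.ok_iff hp fun j hj => hγ.lt j (List.mem_toFinset.2 hj)).2 hγ
    have h₁ := Finset.le_sup (f := fun c₂ => if Δ.OK i c c₁ c₂ then
      1 + Δ.sumChild i c₁ c₂ fun j e => Δ.tab j e - 1 + Δ.gain i j e else 0) (Finset.mem_range.2 hc₂)
    have h₂ := Finset.le_sup (f := fun c₁ => (Finset.range Δ.N).sup fun c₂ => if Δ.OK i c c₁ c₂ then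
      1 + Δ.sumChild i c₁ c₂ fun j e => Δ.tab j e - 1 + Δ.gain i j e else 0) (Finset.mem_range.2 hc₁)
    simp only [if_pos hok] at h₁
    rw [← h.value hp]
    exact h₁.trans h₂

/-- The three labels of the `q`-th element of a bag are the digits `3q`, `3q + 1`, `3q + 2`. All
labels are below `K`, so the number with these digits in base `K` is the required code; unused
digits are 0. -/
theorem surjective : D.Surjective (Δ.tables n b) := by
  intro i g h0 h1 h2
  have hK := h.two_le
  have hlen := h.length_elems i
  have hcard : (D.bag i).card = (elems i).length := by
    rw [← h.toFinset_elems, List.toFinset_card_of_nodup (h.elems_nodup i)]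
  have hg : ∀ v ∈ D.bag i, ∀ κ < 3, g κ v < K := by
    intro v hv κ hκ
    have := h0 v hv
    have := h1 v hv
    have := h2 v hv
    interval_cases κ <;> omega
  let f : Fin (3 * K) → Fin K := fun j =>
    if hj : j.1 / 3 < (elems i).length then
      ⟨g (j.1 % 3) (elems i)[j.1 / 3], hg _ ((h.mem_elems i _).1 (List.getElem_mem hj)) _
        (Nat.mod_lt _ (by omega))⟩ else ⟨0, by omega⟩
  have hc : (finFunctionFinEquiv f : ℕ) < Δ.N := by
    rw [h.N_eq]
    exact (finFunctionFinEquiv f).isLt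
  refine ⟨finFunctionFinEquiv f, hc, fun v hv κ hκ => ?_⟩
  obtain ⟨q, hq, rfl⟩ := List.mem_iff_getElem.1 ((h.mem_elems i v).2 hv)
  have hj : 3 * q + κ < 3 * K := by omega
  change Δ.lab κ i _ _ = _
  rw [h.lab_getElem κ i _ hq, h.dig _ hc _ hj]
  have h3 := finFunctionFinEquiv_symm_apply_val (finFunctionFinEquiv f) ⟨3 * q + κ, hj⟩
  rw [Equiv.symm_apply_apply] at h3
  rw [← h3]
  have hdiv : (3 * q + κ) / 3 = q := by omega
  have hmod : (3 * q + κ) % 3 = κ := by omega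
  simp only [f, hdiv, hmod, dif_pos hq]

/-- If the table satisfies the recursion, then its values are right. -/
theorem correct (htab : ∀ i : Fin b, ∀ c < Δ.N, Δ.tab i c = Δ.step i c) (i : Fin b) :
    D.Correct r (Δ.tables n b) i := by
  have hb : ∀ i, D.tree.dist r i ≤ b := by
    intro i
    obtain ⟨p, hp, hlen⟩ := D.isTree.connected.exists_path_of_dist r i
    have := hp.length_lt
    rw [Fintype.card_fin] at this
    omega
  -- Induction from the leaves upwards: depth is bounded by `b` and children are deeper.
  induction hk : b - D.tree.dist r i using Nat.strong_induction_on generalizing i with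
  | _ k ih =>
    refine Correct.of_children (h.toFinset_children i) h.surjective (h.isStep (htab i)) fun j hj => ?_
    have h1 := ((h.toFinset_children i j).1 hj).2
    have := hb j
    exact ih (b - D.tree.dist r j) (by omega) j rfl

theorem isMax (htab : ∀ i : Fin b, ∀ c < Δ.N, Δ.tab i c = Δ.step i c)
    (hroot : (D.bag r).card ≤ 1) (hbip : G.IsBipartite) :
    G.IsMaxAlternatingCycleFreeMatchingSize ((Finset.range Δ.N).sup (Δ.tab r) - 1) :=
  (h.correct htab r).isMax h.surjective hroot hbip

end Reads

end RAM.Data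

/-! ### The phases of the program -/

namespace RAM

theorem write_of_ne {m : Mem} {a a' i v : ℕ} (h : a' ≠ a) : write m a i v a' = m a' :=
  Function.update_of_ne h _ _

theorem write_apply {m : Mem} {a i v i' : ℕ} : write m a i v a i' = if i' = i then v else m a i' := by
  rw [write, Function.update_self, Function.update_apply]

theorem bnd_write {m : Mem} {a i v : ℕ} (h : 1 ≠ a) : bnd (write m a i v) = bnd m := by
  rw [bnd, write_of_ne h, bnd]

theorem iter_frame {F : ℕ → Mem → Mem} {a : ℕ} (h : ∀ i m, F i m a = m a) (k : ℕ) (m : Mem) :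
    iter F k m a = m a := by
  induction k with
  | zero => rfl
  | succ k ih => rw [iter, h, ih]

/-- `F` is the effect on the arrays of a program, whose running time is at most `(L + 1) * (S + 2) ^ A`
for some constant `A` if the condition `P` holds for the initial arrays, `L` and `S`. -/
def Runs (F : Mem → Mem) (P : Mem → ℕ → ℕ → Prop) : Prop :=
  ∃ (q : Program) (A : ℕ), ∀ (s : State) (L S : ℕ), P s.arr L S → ∃ t s', Exec q s t s' ∧
    t ≤ (L + 1) * (S + 2) ^ A ∧ s'.arr = F s.arr

theorem Phase.runs {F : Mem → Mem} {W : Mem → ℕ} (h : Phase F W) :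
    Runs F (fun m L S => W m ≤ L ∧ bnd m ≤ S) := by
  obtain ⟨q, A, h⟩ := h
  refine ⟨q, A, fun s L S hP => ?_⟩
  obtain ⟨t, s', he, ht, ha⟩ := h s
  exact ⟨t, s', he, ht.trans (Nat.mul_le_mul (by omega) (Nat.pow_le_pow_left (by omega) A)), ha⟩

/-- The condition of the second part is imposed on the memory that it finds. Unlike in `Stm.seq`,
the stored bound may therefore change between parts, as long as `L` and `S` dominate throughout. -/
theorem Runs.seq {F F' : Mem → Mem} {P P' : Mem → ℕ → ℕ → Prop} (h : Runs F P) (h' : Runs F' P') :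
    Runs (fun m => F' (F m)) (fun m L S => P m L S ∧ P' (F m) L S) := by
  obtain ⟨q, A, h⟩ := h
  obtain ⟨q', A', h'⟩ := h'
  refine ⟨.seq q q', max A A' + 1, fun s L S hP => ?_⟩
  obtain ⟨t, s', he, ht, ha⟩ := h s L S hP.1
  obtain ⟨t', s'', he', ht', ha'⟩ := h' s' L S (ha ▸ hP.2)
  refine ⟨_, _, .seq he he', ?_, by rw [ha', ha]⟩
  have h1 := Nat.mul_le_mul_left (L + 1) (bound_mono (N := S) (le_max_left A A'))
  have h2 := Nat.mul_le_mul_left (L + 1) (bound_mono (N := S) (le_max_right A A'))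
  have h3 := Nat.mul_le_mul_left (L + 1) (two_pow_mul_bound S (max A A') 1)
  calc _ ≤ (L + 1) * (S + 2) ^ max A A' + (L + 1) * (S + 2) ^ max A A' := by omega
    _ = (L + 1) * (2 ^ 1 * (S + 2) ^ max A A') := by ring
    _ ≤ _ := h3

/-- The multiples of the number of vertices. -/
def rows (m : Mem) : Mem := iter (fun u m => write m 2 (u + 1) (m 2 u + m 0 0)) (m 0 0) m

/-- Entering the edge whose endpoints are in the cells `x` and `y` of the input. -/
def enter (x y : ℕ) (m : Mem) : Mem := write m 3 (m 2 (m 0 x) + m 0 y) 1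

/-- Entering the `t`-th edge in both directions. -/
def adjStep (t : ℕ) (m : Mem) : Mem :=
  enter (3 + (t + t)) (2 + (t + t)) (enter (2 + (t + t)) (3 + (t + t)) m)

/-- The adjacency matrix. -/
def adjs (m : Mem) : Mem := iter adjStep (m 0 1) m

/-- The number of bags. -/
def nbag (m : Mem) : ℕ := m 0 (2 + (m 0 1 + m 0 1))

/-- The first offset. -/
def offInit (m : Mem) : Mem := write m 4 0 (4 + (m 0 1 + m 0 1))

/-- The offsets of the bags. -/
def offs (m : Mem) : Mem :=
  iter (fun i m => write m 4 (i + 1) (m 4 i + 2 + (dataOf m).nch i + (dataOf m).size i)) (nbag m) m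

/-- The least admissible base of the codes. -/
def baseInit (m : Mem) : Mem := write m 5 0 2

/-- The base of the codes, which exceeds the sizes of all bags. -/
def base (m : Mem) : Mem :=
  iter (fun i m => write m 5 0 (m 5 0 + ((dataOf m).size i + 1 - m 5 0))) (nbag m) m

/-- The bound of the loops becomes the base. -/
def bndBase (m : Mem) : Mem := write m 1 0 (m 5 0)

/-- The zeroth power of the base. -/
def powInit (m : Mem) : Mem := write m 6 0 1

/-- The powers of the base. -/
def pows (m : Mem) : Mem :=
  iter (fun j m => write m 6 (j + 1) (bmul (bnd m) (m 5 0) (m 6 j))) (m 5 0 + (m 5 0 + m 5 0)) m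

/-- The bound of the loops becomes the number of codes. -/
def bndPow (m : Mem) : Mem := write m 1 0 (m 6 (m 5 0 + (m 5 0 + m 5 0)))

/-- The queue of nodes contains the root. -/
def queueInit (m : Mem) : Mem := write (write m 7 0 (m 0 (3 + (m 0 1 + m 0 1)))) 8 0 1

/-- Writing the `a`-th child of the `k`-th node behind the end of the queue. -/
def queuePut (a k : ℕ) (m : Mem) : Mem := write m 7 (m 8 0 + a) ((dataOf m).child (m 7 k) a)

/-- The queue grows by the number of children of its `k`-th node. -/
def queueGrow (k : ℕ) (m : Mem) : Mem :=
  write m 8 0 (m 8 0 + if k < m 8 0 then (dataOf m).nch (m 7 k) else 0)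

/-- Appending the children of the `k`-th node to the queue. -/
def queueStep (k : ℕ) (m : Mem) : Mem := queueGrow k (queuePut 1 k (queuePut 0 k m))

/-- The nodes of the tree, parents before children. -/
def queue (m : Mem) : Mem := iter queueStep (nbag m) m

/-- Computing the table entries of the `k`-th last node of the queue. -/
noncomputable def tabStep (k : ℕ) (m : Mem) : Mem :=
  iter (fun c m => write m 9 (bmul (bnd m) (bnd m) (m 7 (m 8 0 - 1 - k)) + c)
    ((dataOf m).step (m 7 (m 8 0 - 1 - k)) c)) (bnd m) m

/-- Computing the table. -/
noncomputable def tabs (m : Mem) : Mem := iter tabStep (m 8 0) m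

theorem bnd_iter_write {F : ℕ → Mem → Mem} (h : ∀ i m, F i m 1 = m 1) (k : ℕ) (m : Mem) :
    bnd (iter F k m) = bnd m := by
  rw [bnd, iter_frame h, bnd]

theorem phase_rows : Phase rows (fun m => m 0 0) :=
  Phase.loop (F := fun m u => write m 2 (u + 1) (m 2 u + m 0 0))
    (.store 2 (.add .last (.const 1)) (.add (.load 2 .last) (.load 0 (.const 0))))
    (.load 0 (.const 0)) (fun _ _ => bnd_write (by omega))

theorem bnd_enter {x y : ℕ} {m : Mem} : bnd (enter x y m) = bnd m := bnd_write (by omega)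

theorem Stm.enter {Γ : Type} [Ctx Γ] {x y : Mem → Γ → ℕ} (hx : Ev x) (hy : Ev y) :
    Stm (fun m γ => enter (x m γ) (y m γ) m) :=
  .store 3 (.add (.load 2 (.load 0 hx)) (.load 0 hy)) (.const 1)

theorem bnd_adjStep {t : ℕ} {m : Mem} : bnd (adjStep t m) = bnd m := bnd_enter.trans bnd_enter

theorem Ev.cell (k : ℕ) : Ev (fun _ (p : Unit × ℕ) => k + (p.2 + p.2)) :=
  .add (.const k) (.add .last .last)

theorem Stm.enter_cell (k l : ℕ) :
    Stm (fun m (p : Unit × ℕ) => RAM.enter (k + (p.2 + p.2)) (l + (p.2 + p.2)) m) :=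
  .enter (.cell k) (.cell l)

theorem Stm.adjStep : Stm (fun m (p : Unit × ℕ) => adjStep p.2 m) :=
  Stm.seq (Stm.enter_cell 2 3) (Stm.enter_cell 3 2) (fun _ _ => bnd_enter)

theorem phase_adjs : Phase adjs (fun m => m 0 1) :=
  Phase.loop (F := fun m t => RAM.adjStep t m) .adjStep (.load 0 (.const 1)) (fun _ _ => bnd_adjStep)

theorem ev_nbag {Γ : Type} [Ctx Γ] : Ev (fun m (_ : Γ) => nbag m) :=
  .load 0 (.add (.const 2) (.add (.load 0 (.const 1)) (.load 0 (.const 1))))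

theorem phase_offInit : Phase offInit (fun _ => 0) :=
  Phase.stm (F := fun m _ => offInit m) (.store 4 (.const 0)
    (.add (.const 4) (.add (.load 0 (.const 1)) (.load 0 (.const 1)))))

theorem phase_offs : Phase offs nbag :=
  Phase.loop (F := fun m i => write m 4 (i + 1) (m 4 i + 2 + (dataOf m).nch i + (dataOf m).size i))
    (.store 4 (.add .last (.const 1)) (.add (.add (.add (.load 4 .last) (.const 2)) (.nch .last))
      (.size .last))) ev_nbag (fun _ _ => bnd_write (by omega))

theorem phase_baseInit : Phase baseInit (fun _ => 0) :=
  Phase.stm (F := fun m _ => baseInit m) (.store 5 (.const 0) (.const 2))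

theorem phase_base : Phase base nbag :=
  have h : Ev (fun m (_ : Unit × ℕ) => m 5 0) := .load 5 (.const 0)
  Phase.loop (F := fun m i => write m 5 0 (m 5 0 + ((dataOf m).size i + 1 - m 5 0)))
    (.store 5 (.const 0) (.add h (.sub (.add (.size .last) (.const 1)) h)))
    ev_nbag (fun _ _ => bnd_write (by omega))

theorem phase_bndBase : Phase bndBase (fun _ => 0) :=
  Phase.stm (F := fun m _ => bndBase m) (.store 1 (.const 0) (.load 5 (.const 0)))

theorem phase_powInit : Phase powInit (fun _ => 0) :=
  Phase.stm (F := fun m _ => powInit m) (.store 6 (.const 0) (.const 1))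

theorem phase_pows : Phase pows (fun m => m 5 0 + (m 5 0 + m 5 0)) :=
  have h {Γ : Type} [Ctx Γ] : Ev (fun m (_ : Γ) => m 5 0) := .load 5 (.const 0)
  Phase.loop (F := fun m j => write m 6 (j + 1) (bmul (bnd m) (m 5 0) (m 6 j)))
    (.store 6 (.add .last (.const 1)) (.bmul h (.load 6 .last)))
    (.add h (.add h h)) (fun _ _ => bnd_write (by omega))

theorem phase_bndPow : Phase bndPow (fun _ => 0) :=
  have h : Ev (fun m (_ : Unit) => m 5 0) := .load 5 (.const 0)
  Phase.stm (F := fun m _ => bndPow m) (.store 1 (.const 0) (.load 6 (.add h (.add h h))))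

theorem phase_queueInit : Phase queueInit (fun _ => 0) :=
  have h : Ev (fun m (_ : Unit) => m 0 1) := .load 0 (.const 1)
  Phase.stm (F := fun m _ => queueInit m) (Stm.seq
    (F := fun m _ => write m 7 0 (m 0 (3 + (m 0 1 + m 0 1)))) (F' := fun m _ => write m 8 0 1)
    (.store 7 (.const 0) (.load 0 (.add (.const 3) (.add h h)))) (.store 8 (.const 0) (.const 1))
    (fun _ _ => bnd_write (by omega)))

theorem bnd_queuePut {a k : ℕ} {m : Mem} : bnd (queuePut a k m) = bnd m := bnd_write (by omega)

theorem bnd_queueGrow {k : ℕ} {m : Mem} : bnd (queueGrow k m) = bnd m := bnd_write (by omega)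

theorem bnd_queueStep {k : ℕ} {m : Mem} : bnd (queueStep k m) = bnd m :=
  bnd_queueGrow.trans (bnd_queuePut.trans bnd_queuePut)

theorem Stm.queuePut (a : ℕ) : Stm (fun m (p : Unit × ℕ) => queuePut a p.2 m) :=
  .store 7 (.add (.load 8 (.const 0)) (.const a)) (.child (.load 7 .last) (.const a))

theorem Stm.queueGrow : Stm (fun m (p : Unit × ℕ) => queueGrow p.2 m) :=
  .store 8 (.const 0) (.add (.load 8 (.const 0))
    (.ite (.lt .last (.load 8 (.const 0))) (.nch (.load 7 .last)) (.const 0)))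

theorem Stm.queuePut_queuePut :
    Stm (fun m (p : Unit × ℕ) => RAM.queuePut 1 p.2 (RAM.queuePut 0 p.2 m)) :=
  Stm.seq (Stm.queuePut 0) (Stm.queuePut 1) (fun _ _ => bnd_queuePut)

theorem Stm.queueStep : Stm (fun m (p : Unit × ℕ) => queueStep p.2 m) :=
  Stm.seq Stm.queuePut_queuePut Stm.queueGrow (fun _ _ => bnd_queuePut.trans bnd_queuePut)

theorem phase_queue : Phase queue nbag :=
  Phase.loop (F := fun m k => RAM.queueStep k m) .queueStep ev_nbag (fun _ _ => bnd_queueStep)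

theorem phase_tabs : Phase tabs (fun m => m 8 0) := by
  have hi : Ev (fun m (p : (Unit × ℕ) × ℕ) => m 7 (m 8 0 - 1 - p.1.2)) :=
    .load 7 (.sub (.sub (.load 8 (.const 0)) (.const 1)) Ev.last.weaken)
  refine Phase.loop (F := fun m k => tabStep k m) (Stm.loop_bnd (Γ := Unit × ℕ)
    (F := fun m p c => write m 9 (bmul (bnd m) (bnd m) (m 7 (m 8 0 - 1 - p.2)) + c)
      ((dataOf m).step (m 7 (m 8 0 - 1 - p.2)) c))
    (.store 9 (.add (.bmul .bound hi) .last) (.step hi .last))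
    (fun _ _ _ => bnd_write (by omega)))
    (.load 8 (.const 0)) (fun _ _ => ?_)
  exact bnd_iter_write (fun _ _ => write_of_ne (by omega)) _ _

end RAM

/-! ### The layout of the input word and the effect of the preparatory phases -/

theorem List.getD_flatMap {α β : Type*} (l : List α) (f : α → List β) (d : β) (i : ℕ)
    (hi : i < l.length) (j : ℕ) (hj : j < (f l[i]).length) :
    (l.flatMap f).getD (((l.take i).flatMap f).length + j) d = (f l[i]).getD j d := by
  induction l generalizing i with
  | nil => simp at hi
  | cons a l ih =>
    cases i with
    | zero =>
      simp only [take_zero, flatMap_nil, length_nil, zero_add, flatMap_cons, getElem_cons_zero] at hj ⊢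
      exact getD_append _ _ _ _ hj
    | succ i =>
      simp only [take_succ_cons, flatMap_cons, length_append, getElem_cons_succ] at hj ⊢
      rw [getD_append_right _ _ _ _ (by omega), ← ih i (by simpa using hi) hj]
      congr 1
      omega

theorem List.length_flatMap_take_succ {α β : Type*} (l : List α) (f : α → List β) (i : ℕ)
    (hi : i < l.length) : ((l.take (i + 1)).flatMap f).length =
      ((l.take i).flatMap f).length + (f l[i]).length := by
  rw [List.take_succ_eq_append_getElem hi, flatMap_append, length_append]
  simp

namespace RAM

variable {n b : ℕ}

/-- The word `w` contains the lists of the edges and of the children and elements of the bags; the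
children and elements of the bag `i` start at the address `off i`. -/
structure Layout (w : ℕ → ℕ) (edges : List (Fin n × Fin n)) (children : Fin b → List (Fin b))
    (elems : Fin b → List (Fin n)) (r : Fin b) (off : ℕ → ℕ) : Prop where
  order : w 0 = n
  length_edges : w 1 = edges.length
  fst : ∀ t (h : t < edges.length), w (2 + (t + t)) = edges[t].1
  snd : ∀ t (h : t < edges.length), w (3 + (t + t)) = edges[t].2
  bags : w (2 + (edges.length + edges.length)) = b
  root : w (3 + (edges.length + edges.length)) = r
  off_zero : off 0 = 4 + (edges.length + edges.length)
  off_succ : ∀ i : Fin b, off (i + 1) = off i + 2 + (children i).length + (elems i).length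
  nch : ∀ i : Fin b, w (off i) = (children i).length
  child : ∀ (i : Fin b) (a : ℕ) (h : a < (children i).length), w (off i + 1 + a) = (children i)[a]
  size : ∀ i : Fin b, w (off i + 1 + (children i).length) = (elems i).length
  elem : ∀ (i : Fin b) (q : ℕ) (h : q < (elems i).length),
    w (off i + 2 + (children i).length + q) = (elems i)[q]

theorem exists_layout (edges : List (Fin n × Fin n)) (children : Fin b → List (Fin b))
    (elems : Fin b → List (Fin n)) (r : Fin b) :
    ∃ off, Layout (fun k => ([n, edges.length] ++
      (edges.flatMap fun e => [(e.1 : ℕ), (e.2 : ℕ)]) ++ [b, (r : ℕ)] ++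
      (List.finRange b).flatMap fun i => [(children i).length] ++ List.map (fun j : Fin b => (j : ℕ)) (children i) ++
          ([(elems i).length] ++ List.map (fun v : Fin n => (v : ℕ)) (elems i))).getD k 0)
      edges children elems r off := by
  set E := edges.flatMap fun e => [(e.1 : ℕ), (e.2 : ℕ)] with hE
  set f : Fin b → List ℕ := fun i => [(children i).length] ++ List.map (fun j : Fin b => (j : ℕ)) (children i) ++
          ([(elems i).length] ++ List.map (fun v : Fin n => (v : ℕ)) (elems i)) with hf
  have hl (l : List (Fin n × Fin n)) :
      (l.flatMap fun e => [(e.1 : ℕ), (e.2 : ℕ)]).length = l.length + l.length := by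
    induction l with
    | nil => rfl
    | cons a l ih => simp only [List.flatMap_cons, List.length_append, ih, List.length_cons,
        List.length_nil]; omega
  have hEl : E.length = edges.length + edges.length := hl edges
  have hfl (i : Fin b) : (f i).length = 2 + (children i).length + (elems i).length := by
    simp only [hf, List.length_append, List.length_map, List.length_cons, List.length_nil]
    omega
  have edge (t : ℕ) (ht : t < edges.length) (a : ℕ) (ha : a < 2) :
      ([n, edges.length] ++ E ++ [b, (r : ℕ)] ++ (List.finRange b).flatMap f).getD (2 + (t + t) + a) 0 =
        [(edges[t].1 : ℕ), (edges[t].2 : ℕ)].getD a 0 := by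
    rw [List.append_assoc, List.append_assoc, List.getD_append_right _ _ _ _ (by simp; omega),
      List.getD_append _ _ _ _ (by simp; omega), hE,
      ← List.getD_flatMap edges (fun e => [(e.1 : ℕ), (e.2 : ℕ)]) 0 t ht a ha, hl, List.length_take]
    congr 1
    simp
    omega
  have mid (a : ℕ) (ha : a < 2) :
      ([n, edges.length] ++ E ++ [b, (r : ℕ)] ++ (List.finRange b).flatMap f).getD
        (2 + (edges.length + edges.length) + a) 0 = [b, (r : ℕ)].getD a 0 := by
    rw [List.append_assoc, List.getD_append_right _ _ _ _ (by simp; omega),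
      List.getD_append _ _ _ _ (by simp; omega)]
    congr 1
    simp
    omega
  have bag (i : Fin b) (a : ℕ) (ha : a < (f i).length) :
      ([n, edges.length] ++ E ++ [b, (r : ℕ)] ++ (List.finRange b).flatMap f).getD
        (4 + (edges.length + edges.length) + (((List.finRange b).take i).flatMap f).length + a) 0 =
        (f i).getD a 0 := by
    have := List.getD_flatMap (List.finRange b) f 0 i (by simp) a (by simpa using ha)
    rw [List.getElem_finRange] at this
    rw [List.getD_append_right _ _ _ _ (by simp; omega)]
    refine Eq.trans ?_ this
    congr 1
    simp
    omega
  -- Four cells hold the numbers of vertices, edges and bags and the root; each edge takes two more,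
  -- and then come the blocks of the earlier bags.
  refine ⟨fun i => 4 + (edges.length + edges.length) +
    (((List.finRange b).take i).flatMap f).length, rfl, rfl, fun t ht => edge t ht 0 (by omega),
    fun t ht => ?_, mid 0 (by omega), ?_, rfl, fun i => ?_, fun i => ?_, fun i a h => ?_, fun i => ?_,
    fun i q h => ?_⟩
  · have := edge t ht 1 (by omega)
    rw [show 3 + (t + t) = 2 + (t + t) + 1 by omega]
    exact this
  · have := mid 1 (by omega)
    rw [show 3 + (edges.length + edges.length) = 2 + (edges.length + edges.length) + 1 by omega]
    exact this
  · have := List.length_flatMap_take_succ (List.finRange b) f i (by simp)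
    rw [List.getElem_finRange] at this
    simp only [this, Fin.cast_mk, Fin.eta, hfl]
    omega
  · exact bag i 0 (by rw [hfl]; omega)
  · rw [add_assoc, bag i (1 + a) (by rw [hfl]; omega), hf]
    simp only [List.append_assoc]
    rw [List.getD_append_right _ _ _ _ (by simp), List.getD_append _ _ _ _ (by simpa using h)]
    simp [h]
  · rw [add_assoc, bag i (1 + _) (by rw [hfl]; omega), hf]
    simp only [List.append_assoc]
    rw [List.getD_append_right _ _ _ _ (by simp), List.getD_append_right _ _ _ _ (by simp)]
    simp
  · rw [add_assoc, add_assoc, bag i _ (by rw [hfl]; omega), hf]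
    simp only [List.append_assoc]
    rw [List.getD_append_right _ _ _ _ (by simp; omega),
      List.getD_append_right _ _ _ _ (by simp; omega), List.getD_append_right _ _ _ _ (by simp; omega),
      show 2 + ((children i).length + q) - [(children i).length].length -
        (List.map (fun j : Fin b => (j : ℕ)) (children i)).length - [(elems i).length].length = q by simp; omega]
    simp [h]

theorem dataOf_nch (m : Mem) (i : ℕ) : (dataOf m).nch i = m 0 (m 4 i) := rfl

theorem dataOf_size (m : Mem) (i : ℕ) : (dataOf m).size i = m 0 (m 4 i + 1 + m 0 (m 4 i)) := rfl

theorem rows_apply {m : Mem} (h : m 2 0 = 0) {u : ℕ} (hu : u ≤ m 0 0) : rows m 2 u = u * m 0 0 := by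
  have key (k : ℕ) : ∀ u ≤ k, iter (fun u m => write m 2 (u + 1) (m 2 u + m 0 0)) k m 2 u = u * m 0 0 := by
    induction k with
    | zero => intro u hu; rw [Nat.le_zero.1 hu, Nat.zero_mul]; exact h
    | succ k ih =>
      intro u hu
      rw [iter, write_apply]
      split
      · rw [ih k le_rfl, iter_frame fun _ _ => write_of_ne (by omega)]
        subst u
        ring
      · exact ih u (by omega)
  exact key _ u hu

theorem rows_of_ne {m : Mem} {a : ℕ} (h : a ≠ 2) : rows m a = m a :=
  iter_frame (fun _ _ => write_of_ne h) _ _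

theorem adjStep_of_ne {m : Mem} {a t : ℕ} (h : a ≠ 3) : adjStep t m a = m a := by
  rw [adjStep, enter, write_of_ne h, enter, write_of_ne h]

theorem adjs_of_ne {m : Mem} {a : ℕ} (h : a ≠ 3) : adjs m a = m a :=
  iter_frame (fun _ _ => adjStep_of_ne h) _ _

theorem adjs_apply {m : Mem} (h : ∀ x, m 3 x = 0) (x : ℕ) : adjs m 3 x ≠ 0 ↔ ∃ t < m 0 1,
    x = m 2 (m 0 (2 + (t + t))) + m 0 (3 + (t + t)) ∨
    x = m 2 (m 0 (3 + (t + t))) + m 0 (2 + (t + t)) := by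
  rw [adjs]
  induction m 0 1 with
  | zero => simp [iter, h]
  | succ k ih =>
    have h0 (a : ℕ) (ha : a ≠ 3) := iter_frame (F := adjStep) (a := a) (fun _ _ => adjStep_of_ne ha) k m
    rw [iter, adjStep, enter, enter, write_apply, write_of_ne (by omega), write_of_ne (by omega),
      write_apply, h0 0 (by omega), h0 2 (by omega), Nat.exists_lt_succ_right, ← ih]
    by_cases h2 : x = m 2 (m 0 (3 + (k + k))) + m 0 (2 + (k + k))
    · simp [h2]
    · by_cases h3 : x = m 2 (m 0 (2 + (k + k))) + m 0 (3 + (k + k)) <;> simp [h2, h3]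

theorem offInit_of_ne {m : Mem} {a : ℕ} (h : a ≠ 4) : offInit m a = m a := write_of_ne h

theorem offs_of_ne {m : Mem} {a : ℕ} (h : a ≠ 4) : offs m a = m a :=
  iter_frame (fun _ _ => write_of_ne h) _ _

theorem baseInit_of_ne {m : Mem} {a : ℕ} (h : a ≠ 5) : baseInit m a = m a := write_of_ne h

theorem base_of_ne {m : Mem} {a : ℕ} (h : a ≠ 5) : base m a = m a :=
  iter_frame (fun _ _ => write_of_ne h) _ _

theorem bndBase_of_ne {m : Mem} {a : ℕ} (h : a ≠ 1) : bndBase m a = m a := write_of_ne h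

theorem powInit_of_ne {m : Mem} {a : ℕ} (h : a ≠ 6) : powInit m a = m a := write_of_ne h

theorem pows_of_ne {m : Mem} {a : ℕ} (h : a ≠ 6) : pows m a = m a :=
  iter_frame (fun _ _ => write_of_ne h) _ _

theorem bndPow_of_ne {m : Mem} {a : ℕ} (h : a ≠ 1) : bndPow m a = m a := write_of_ne h

theorem queueInit_of_ne {m : Mem} {a : ℕ} (h : a ≠ 7) (h' : a ≠ 8) : queueInit m a = m a := by
  rw [queueInit, write_of_ne h', write_of_ne h]

theorem queueStep_of_ne {m : Mem} {a k : ℕ} (h : a ≠ 7) (h' : a ≠ 8) : queueStep k m a = m a := by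
  rw [queueStep, queueGrow, write_of_ne h', queuePut, write_of_ne h, queuePut, write_of_ne h]

theorem queue_of_ne {m : Mem} {a : ℕ} (h : a ≠ 7) (h' : a ≠ 8) : queue m a = m a :=
  iter_frame (fun _ _ => queueStep_of_ne h h') _ _

theorem tabStep_of_ne {m : Mem} {a k : ℕ} (h : a ≠ 9) : tabStep k m a = m a :=
  iter_frame (fun _ _ => write_of_ne h) _ _

theorem tabs_of_ne {m : Mem} {a : ℕ} (h : a ≠ 9) : tabs m a = m a :=
  iter_frame (fun _ _ => tabStep_of_ne h) _ _

theorem offs_apply {m : Mem} {edges : List (Fin n × Fin n)} {children : Fin b → List (Fin b)}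
    {elems : Fin b → List (Fin n)} {r : Fin b} {off : ℕ → ℕ}
    (h : Layout (m 0) edges children elems r off) (h0 : m 4 0 = off 0) {i : ℕ} (hi : i ≤ b) :
    offs m 4 i = off i := by
  have hb : nbag m = b := by rw [nbag, h.length_edges, h.bags]
  have key (k : ℕ) (hk : k ≤ b) : ∀ i ≤ k, iter (fun i m => write m 4 (i + 1)
      (m 4 i + 2 + (dataOf m).nch i + (dataOf m).size i)) k m 4 i = off i := by
    induction k with
    | zero => intro i hi; rw [Nat.le_zero.1 hi]; exact h0
    | succ k ih =>
      intro i hi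
      rw [iter, write_apply]
      split
      · subst i
        rw [dataOf_nch, dataOf_size, ih (by omega) k le_rfl,
          iter_frame (a := 0) fun _ _ => write_of_ne (by omega), h.nch ⟨k, hk⟩, h.size ⟨k, hk⟩, h.off_succ ⟨k, hk⟩]
      · exact ih (by omega) i (by omega)
  rw [offs, hb]
  exact key b le_rfl i hi

/-- Each round takes a maximum by truncated subtraction. The base is at least 2 since colours and
degrees need the digits 0 and 1; its minimality is what later bounds it by the width plus two. -/
theorem base_apply {m : Mem} (h : m 5 0 = 2) : 2 ≤ base m 5 0 ∧
    (∀ i < nbag m, (dataOf m).size i < base m 5 0) ∧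
    ∀ B, 2 ≤ B → (∀ i < nbag m, (dataOf m).size i < B) → base m 5 0 ≤ B := by
  rw [base]
  induction nbag m with
  | zero => exact ⟨h.ge, fun i hi => absurd hi (Nat.not_lt_zero i), fun B hB _ => h.le.trans hB⟩
  | succ k ih =>
    have h0 (a : ℕ) (ha : a ≠ 5) := iter_frame (F := fun i m =>
      write m 5 0 (m 5 0 + ((dataOf m).size i + 1 - m 5 0))) (a := a) (fun _ _ => write_of_ne ha) k m
    rw [iter, write_apply, if_pos rfl]
    have hs : (dataOf (iter (fun i m => write m 5 0 (m 5 0 + ((dataOf m).size i + 1 - m 5 0))) k m)).size k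
        = (dataOf m).size k := by
      rw [dataOf_size, dataOf_size, h0 0 (by omega), h0 4 (by omega)]
    rw [hs]
    obtain ⟨h1, h2, h3⟩ := ih
    refine ⟨by omega, fun i hi => ?_, fun B hB hB' => ?_⟩
    · rcases Nat.lt_succ_iff_lt_or_eq.1 hi with hi | rfl
      · have := h2 i hi
        omega
      · omega
    · have := h3 B hB fun i hi => hB' i (by omega)
      have := hB' k (by omega)
      omega

theorem bmul_eq {N a c : ℕ} (h : a ≤ N) : bmul N a c = a * c := by
  have : (Finset.range N).filter (· < a) = Finset.range a := by
    ext x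
    simp only [Finset.mem_filter, Finset.mem_range]
    omega
  rw [bmul, ← Finset.sum_filter, this, Finset.sum_const, smul_eq_mul, Finset.card_range]

theorem bdiv_eq {N a c : ℕ} (h : a ≤ N) (hc : 0 < c) : bdiv N a c = a / c := by
  have : (Finset.range N).filter (fun i => bmul N (i + 1) c ≤ a) = Finset.range (a / c) := by
    ext x
    simp only [Finset.mem_filter, Finset.mem_range]
    constructor
    · rintro ⟨hx, h'⟩
      rw [bmul_eq hx] at h'
      exact (Nat.le_div_iff_mul_le hc).2 h'
    · intro h'
      have := (Nat.div_le_self a c).trans h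
      exact ⟨by omega, by rw [bmul_eq (by omega)]; exact (Nat.le_div_iff_mul_le hc).1 h'⟩
  rw [bdiv, ← Finset.sum_filter, this, Finset.sum_const, smul_eq_mul, Finset.card_range, mul_one]

/-- Each power arises by one multiplication by the base, for which loops of that length suffice.
This is why the bound is first set to the base, and to the number of codes only after the latter has
been computed. -/
theorem pows_apply {m : Mem} (h : m 6 0 = 1) (hb : bnd m = m 5 0) {j : ℕ}
    (hj : j ≤ m 5 0 + (m 5 0 + m 5 0)) : pows m 6 j = m 5 0 ^ j := by
  have key (k : ℕ) : ∀ j ≤ k,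
      iter (fun j m => write m 6 (j + 1) (bmul (bnd m) (m 5 0) (m 6 j))) k m 6 j = m 5 0 ^ j := by
    induction k with
    | zero => intro j hj; rw [Nat.le_zero.1 hj, pow_zero]; exact h
    | succ k ih =>
      intro j hj
      rw [iter, write_apply]
      split
      · subst j
        rw [ih k le_rfl, bnd_iter_write fun _ _ => write_of_ne (by omega),
          iter_frame (a := 5) fun _ _ => write_of_ne (by omega), bmul_eq hb.ge, pow_succ, mul_comm]
      · exact ih j (by omega)
  exact key _ j hj

end RAM

/-! ### The order of the nodes and the filling of the table -/

namespace RAM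

/-- The recursion reads the table only at the children of `i`, so entries of other nodes may change
without affecting it. -/
theorem Data.step_congr_tab {Δ : Data} {T : ℕ → ℕ → ℕ} {i : ℕ}
    (h : ∀ a < Δ.nch i, ∀ e < Δ.N, T (Δ.child i a) e = Δ.tab (Δ.child i a) e) (c : ℕ) :
    ({Δ with tab := T} : Data).step i c = Δ.step i c := by
  classical
  refine Finset.sup_congr rfl fun c₁ h₁ => Finset.sup_congr rfl fun c₂ h₂ => ?_
  have hp (a : ℕ) : pick c₁ c₂ a < Δ.N := by
    rw [pick]
    split
    exacts [Finset.mem_range.1 h₁, Finset.mem_range.1 h₂]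
  refine if_congr (and_congr (forall₃_congr fun a _ ha => and_congr ?_ Iff.rfl) Iff.rfl)
    (congrArg (1 + ·) (Finset.sum_congr rfl fun a _ => ?_)) rfl
  · rw [← h a ha _ (hp a)]
  · change (if a < Δ.nch i then T (Δ.child i a) (pick c₁ c₂ a) - 1 +
      Δ.gain i (Δ.child i a) (pick c₁ c₂ a) else 0) = _
    split_ifs with ha
    · rw [h a ha _ (hp a)]
    · rfl

theorem dataOf_of_frame {m m' : Mem} (h : ∀ a ≠ 9, m' a = m a) :
    dataOf m' = {dataOf m with tab := (dataOf m').tab} := by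
  have hb : bnd m' = bnd m := by rw [bnd, h 1 (by omega), bnd]
  simp only [dataOf, hb, h 0 (by omega), h 2 (by omega), h 3 (by omega), h 4 (by omega),
    h 5 (by omega), h 6 (by omega)]

theorem tab_write {m : Mem} {i j c c' v : ℕ} (hc : c < bnd m) (hc' : c' < bnd m) :
    (dataOf (write m 9 (bmul (bnd m) (bnd m) i + c) v)).tab j c' =
      if j = i ∧ c' = c then v else (dataOf m).tab j c' := by
  have h : bnd m * j + c' = bnd m * i + c ↔ j = i ∧ c' = c := by
    constructor
    · intro h
      have h1 := congrArg (· / bnd m) h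
      have h2 := congrArg (· % bnd m) h
      simp only [Nat.mul_add_mod, Nat.mod_eq_of_lt hc, Nat.mod_eq_of_lt hc',
        Nat.mul_add_div (Nat.zero_lt_of_lt hc), Nat.div_eq_of_lt hc, Nat.div_eq_of_lt hc',
        Nat.add_zero] at h1 h2
      exact ⟨h1, h2⟩
    · rintro ⟨rfl, rfl⟩
      rfl
  simp only [dataOf, bnd_write (show 1 ≠ 9 by omega), write_apply, bmul_eq le_rfl, h]

theorem dataOf_tab_eq {m m' : Mem} (h : ∀ a ≠ 9, m' a = m a) {i : ℕ}
    (hi : ∀ a < (dataOf m).nch i, ∀ e < bnd m,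
      (dataOf m').tab ((dataOf m).child i a) e = (dataOf m).tab ((dataOf m).child i a) e) (c : ℕ) :
    (dataOf m').step i c = (dataOf m).step i c := by
  rw [dataOf_of_frame h]
  exact Data.step_congr_tab hi c

/-- The entries of `i` are overwritten while later ones are still being computed; this is harmless
because no child equals `i`. -/
theorem tabStep_tab {m : Mem} {k i : ℕ} (hk : m 7 (m 8 0 - 1 - k) = i)
    (hi : ∀ a < (dataOf m).nch i, (dataOf m).child i a ≠ i) :
    (∀ j ≠ i, ∀ c < bnd m, (dataOf (tabStep k m)).tab j c = (dataOf m).tab j c) ∧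
    ∀ c < bnd m, (dataOf (tabStep k m)).tab i c = (dataOf m).step i c := by
  rw [tabStep]
  set F : ℕ → Mem → Mem := fun c m => write m 9 (bmul (bnd m) (bnd m) (m 7 (m 8 0 - 1 - k)) + c)
    ((dataOf m).step (m 7 (m 8 0 - 1 - k)) c) with hF
  have key : ∀ l ≤ bnd m,
      (∀ j ≠ i, ∀ c < bnd m, (dataOf (iter F l m)).tab j c = (dataOf m).tab j c) ∧
      ∀ c < l, (dataOf (iter F l m)).tab i c = (dataOf m).step i c := by
    intro l hl
    induction l with
    | zero => exact ⟨fun _ _ _ _ => rfl, fun c hc => absurd hc (Nat.not_lt_zero c)⟩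
    | succ l ih =>
      obtain ⟨h1, h2⟩ := ih (by omega)
      have hf (a : ℕ) (ha : a ≠ 9) : iter F l m a = m a := iter_frame (fun _ _ => write_of_ne ha) l m
      have hb : bnd (iter F l m) = bnd m := by rw [bnd, hf 1 (by omega), bnd]
      have hs (c : ℕ) : (dataOf (iter F l m)).step i c = (dataOf m).step i c :=
        dataOf_tab_eq hf (fun a ha e he => h1 _ (hi a ha) e he) c
      have hw (j c : ℕ) (hc : c < bnd m) : (dataOf (iter F (l + 1) m)).tab j c =
          if j = i ∧ c = l then (dataOf m).step i l else (dataOf (iter F l m)).tab j c := by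
        rw [iter, hF]
        simp only
        rw [← hF, hf 7 (by omega), hf 8 (by omega), hk, hs, tab_write (by omega) (by omega)]
      refine ⟨fun j hj c hc => ?_, fun c hc => ?_⟩
      · rw [hw j c hc, if_neg fun h => hj h.1, h1 j hj c hc]
      · rw [hw i c (by omega)]
        split_ifs with h
        · rw [h.2]
        · exact h2 c (by omega)
  exact key _ le_rfl

/-- Nodes come without repetition and after their children, so every later round writes only entries
that the recursion at earlier nodes does not read. The equation therefore survives in the final
table, on both of its sides. -/
theorem tabs_tab {m : Mem} {node : ℕ → ℕ} (hnode : ∀ k < m 8 0, m 7 (m 8 0 - 1 - k) = node k)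
    (hinj : ∀ k < m 8 0, ∀ l < k, node l ≠ node k)
    (hch : ∀ k < m 8 0, ∀ a < (dataOf m).nch (node k), ∃ l < k, node l = (dataOf m).child (node k) a)
    {k : ℕ} (hk : k < m 8 0) {c : ℕ} (hc : c < bnd m) :
    (dataOf (tabs m)).tab (node k) c = (dataOf (tabs m)).step (node k) c := by
  have key : ∀ l ≤ m 8 0, ∀ k < l, ∀ c < bnd m,
      (dataOf (iter tabStep l m)).tab (node k) c = (dataOf (iter tabStep l m)).step (node k) c := by
    intro l hl
    induction l with
    | zero => exact fun k hk => absurd hk (Nat.not_lt_zero k)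
    | succ l ih =>
      have ih := ih (by omega)
      have hf (a : ℕ) (ha : a ≠ 9) : iter tabStep l m a = m a :=
        iter_frame (fun _ _ => tabStep_of_ne ha) l m
      have hb : bnd (iter tabStep l m) = bnd m := by rw [bnd, hf 1 (by omega), bnd]
      have hnc : (dataOf (iter tabStep l m)).nch = (dataOf m).nch := by rw [dataOf_of_frame hf]
      have hcd : (dataOf (iter tabStep l m)).child = (dataOf m).child := by rw [dataOf_of_frame hf]
      have hne : ∀ k ≤ l, ∀ a < (dataOf m).nch (node k), (dataOf m).child (node k) a ≠ node l := by
        intro k hk a ha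
        obtain ⟨l', hl', h⟩ := hch k (by omega) a ha
        rw [← h]
        exact hinj l (by omega) l' (by omega)
      obtain ⟨h1, h2⟩ := tabStep_tab (m := iter tabStep l m) (k := l) (i := node l)
        (by rw [hf 7 (by omega), hf 8 (by omega), hnode l (by omega)])
        (by rw [hnc, hcd]; exact hne l le_rfl)
      rw [hb] at h1 h2
      have hs (k : ℕ) (hk : k ≤ l) (c : ℕ) : (dataOf (iter tabStep (l + 1) m)).step (node k) c =
          (dataOf (iter tabStep l m)).step (node k) c :=
        dataOf_tab_eq (fun a ha => tabStep_of_ne ha) (fun a ha e he => by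
          rw [hnc] at ha
          rw [hb] at he
          rw [hcd]
          exact h1 _ (hne k hk a ha) e he) c
      intro k hk c hc
      rw [hs k (by omega), iter]
      rcases Nat.lt_succ_iff_lt_or_eq.1 hk with hk | rfl
      · rw [h1 _ (hinj l (by omega) k hk) c hc, ih k hk c hc]
      · exact h2 c hc
  exact key _ le_rfl k hk c hc

/-- The queue of the breadth-first search from `r` after `k` steps. -/
def nodes {α : Type*} (children : α → List α) (r : α) : ℕ → List α
  | 0 => [r]
  | k + 1 => nodes children r k ++ (nodes children r k)[k]?.elim [] children

section nodes

variable {α : Type*} {children : α → List α} {r : α}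

theorem nodes_prefix {k l : ℕ} (h : k ≤ l) : nodes children r k <+: nodes children r l := by
  induction h with
  | refl => exact List.prefix_rfl
  | step _ ih => exact ih.trans (List.prefix_append _ _)

theorem zero_lt_length_nodes (k : ℕ) : 0 < (nodes children r k).length :=
  lt_of_lt_of_le (by simp [nodes]) (nodes_prefix (Nat.zero_le k)).length_le

theorem nodes_zero (k : ℕ) : (nodes children r k)[0]'(zero_lt_length_nodes k) = r :=
  ((nodes_prefix (children := children) (r := r) (Nat.zero_le k)).getElem (by simp [nodes])).symm

theorem getElem_nodes {k l p : ℕ} (h : k ≤ l) (hp : p < (nodes children r k).length) :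
    (nodes children r l)[p]'(hp.trans_le (nodes_prefix h).length_le) = (nodes children r k)[p] :=
  ((nodes_prefix h).getElem hp).symm

/-- Once the search has caught up with the end of the queue, the queue never grows again; so
position `p` is filled before step `p`. -/
theorem lt_length_nodes {k p : ℕ} (hk : p ≤ k) (hp : p < (nodes children r k).length) :
    p < (nodes children r p).length := by
  by_contra! h
  have : nodes children r k = nodes children r p := by
    clear hp
    induction hk with
    | refl => rfl
    | step hk ih =>
      rw [nodes, ih, List.getElem?_eq_none (h.trans hk), Option.elim_none, List.append_nil]
  rw [this] at hp
  omega

theorem exists_getElem_nodes_of_mem_children {k p : ℕ} (hk : p < k)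
    (hp : p < (nodes children r k).length) {j : α} (hj : j ∈ children ((nodes children r k)[p])) :
    ∃ (l : ℕ) (hl : l < (nodes children r k).length), p < l ∧ (nodes children r k)[l] = j := by
  have hp' := lt_length_nodes hk.le hp
  rw [getElem_nodes hk.le hp'] at hj
  obtain ⟨q, hq, rfl⟩ := List.getElem_of_mem hj
  have hs : nodes children r (p + 1) = nodes children r p ++ children (nodes children r p)[p] := by
    rw [nodes, List.getElem?_eq_getElem hp', Option.elim_some]
  have hl : (nodes children r p).length + q < (nodes children r (p + 1)).length := by
    rw [hs, List.length_append]
    omega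
  refine ⟨_, hl.trans_le (nodes_prefix hk).length_le, by omega, ?_⟩
  rw [getElem_nodes hk hl]
  simp [hs]

theorem exists_mem_children_of_nodes {k p : ℕ} (h0 : 0 < p) (hp : p < (nodes children r k).length) :
    ∃ (l : ℕ) (hl : l < (nodes children r k).length), l < k ∧
      (nodes children r k)[p] ∈ children (nodes children r k)[l] := by
  induction k with
  | zero => simp only [nodes, List.length_singleton] at hp; omega
  | succ k ih =>
    by_cases hp' : p < (nodes children r k).length
    · obtain ⟨l, hl, hlk, h⟩ := ih hp'
      refine ⟨l, hl.trans_le (nodes_prefix k.le_succ).length_le, by omega, ?_⟩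
      rw [getElem_nodes k.le_succ hp', getElem_nodes k.le_succ hl]
      exact h
    · by_cases hk : k < (nodes children r k).length
      · refine ⟨k, hk.trans_le (nodes_prefix k.le_succ).length_le, by omega, ?_⟩
        rw [getElem_nodes k.le_succ hk]
        simp only [nodes, List.getElem?_eq_getElem hk, Option.elim_some]
        rw [List.getElem_append_right (by omega)]
        exact List.getElem_mem _
      · rw [nodes, List.getElem?_eq_none (by omega), Option.elim_none, List.append_nil] at hp
        exact absurd hp hp'

/-- A child appended at step `k` is not the root. If it had been in the queue before, it would have
been appended at an earlier step, by another node, against uniqueness of parents. -/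
theorem nodup_nodes (hn : ∀ i, (children i).Nodup) (hr : ∀ i, r ∉ children i)
    (hu : ∀ i k j, j ∈ children i → j ∈ children k → i = k) (k : ℕ) : (nodes children r k).Nodup := by
  induction k with
  | zero => exact List.nodup_singleton r
  | succ k ih =>
    by_cases hk : k < (nodes children r k).length
    · rw [nodes, List.getElem?_eq_getElem hk, Option.elim_some]
      refine ih.append (hn _) fun j hj hj' => ?_
      obtain ⟨p, hp, rfl⟩ := List.getElem_of_mem hj
      rcases Nat.eq_zero_or_pos p with rfl | h0
      · exact hr _ (nodes_zero (children := children) (r := r) k ▸ hj')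
      · obtain ⟨l, hl, hlk, h⟩ := exists_mem_children_of_nodes h0 hp
        exact hlk.ne ((ih.getElem_inj_iff).1 (hu _ _ _ h hj'))
    · rw [nodes, List.getElem?_eq_none (by omega), Option.elim_none, List.append_nil]
      exact ih

end nodes

/-- Two cells behind the end are written in every step, possibly with meaningless contents; only the
growth of the length decides which of them belong to the queue. -/
theorem queueStep_apply {m : Mem} {l : List (Fin b)} {children : Fin b → List (Fin b)} {k : ℕ}
    (hlen : ∀ i, (children i).length ≤ 2)
    (hnch : ∀ i : Fin b, (dataOf m).nch i = (children i).length)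
    (hchild : ∀ (i : Fin b) (a : ℕ) (h : a < (children i).length), (dataOf m).child i a = (children i)[a])
    (h8 : m 8 0 = l.length) (h7 : ∀ p (h : p < l.length), m 7 p = l[p]) :
    queueStep k m 8 0 = (l ++ l[k]?.elim [] children).length ∧
    ∀ p (h : p < (l ++ l[k]?.elim [] children).length),
      queueStep k m 7 p = (l ++ l[k]?.elim [] children)[p] := by
  have e8 : queueStep k m 8 0 = m 8 0 + if k < m 8 0 then
      (dataOf (queuePut 1 k (queuePut 0 k m))).nch (queuePut 1 k (queuePut 0 k m) 7 k) else 0 := by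
    rw [queueStep, queueGrow, write_apply, if_pos rfl]
    rfl
  have e7 (p : ℕ) : queueStep k m 7 p = if p = m 8 0 + 1 then
      (dataOf m).child (queuePut 0 k m 7 k) 1 else if p = m 8 0 then (dataOf m).child (m 7 k) 0
      else m 7 p := by
    have h8 : queuePut 0 k m 8 0 = m 8 0 := by rw [queuePut, write_of_ne (by omega)]
    have h7 : queuePut 0 k m 7 p = if p = m 8 0 then (dataOf m).child (m 7 k) 0 else m 7 p := by
      rw [queuePut, write_apply]
      rfl
    rw [queueStep, queueGrow, write_of_ne (by omega), queuePut, write_apply, h8, h7]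
    rfl
  have f7 (p : ℕ) (hp : p < m 8 0) : queuePut 0 k m 7 p = m 7 p := by
    rw [queuePut, write_apply, if_neg (by omega)]
  have f7' (p : ℕ) (hp : p < m 8 0) : queuePut 1 k (queuePut 0 k m) 7 p = m 7 p := by
    rw [queuePut, write_apply, if_neg, f7 p hp]
    rw [queuePut, write_of_ne (by omega)]
    omega
  by_cases hk : k < l.length
  · have h7k := h7 k hk
    rw [List.getElem?_eq_getElem hk, Option.elim_some]
    constructor
    · rw [e8, if_pos (by omega), f7' k (by omega), h7k, List.length_append, h8, ← hnch]
      rfl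
    · intro p hp
      rw [e7]
      by_cases hp' : p < l.length
      · rw [if_neg (by omega), if_neg (by omega), h7 p hp', List.getElem_append_left hp']
      · rw [List.length_append] at hp
        have := hlen l[k]
        rw [List.getElem_append_right (by omega), f7 k (by omega), h7k]
        split_ifs with h h'
        · rw [hchild _ 1 (by omega)]
          simp only [h, h8, Nat.add_sub_cancel_left]
        · rw [hchild _ 0 (by omega)]
          simp only [h', h8, Nat.sub_self]
        · omega
  · rw [List.getElem?_eq_none (by omega), Option.elim_none, List.append_nil]
    constructor
    · rw [e8, if_neg (by omega), h8, Nat.add_zero]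
    · intro p hp
      rw [e7, if_neg (by omega), if_neg (by omega), h7 p hp]

theorem queue_apply {m : Mem} {r : Fin b} {children : Fin b → List (Fin b)}
    (hlen : ∀ i, (children i).length ≤ 2)
    (hnch : ∀ i : Fin b, (dataOf m).nch i = (children i).length)
    (hchild : ∀ (i : Fin b) (a : ℕ) (h : a < (children i).length), (dataOf m).child i a = (children i)[a])
    (h8 : m 8 0 = 1) (h7 : m 7 0 = r) :
    queue m 8 0 = (nodes children r (nbag m)).length ∧
    ∀ p (h : p < (nodes children r (nbag m)).length),
      queue m 7 p = (nodes children r (nbag m))[p] := by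
  rw [queue]
  induction nbag m with
  | zero =>
    refine ⟨h8, fun p hp => ?_⟩
    simp only [nodes, List.length_singleton, Nat.lt_one_iff] at hp
    subst hp
    exact h7
  | succ k ih =>
    have hf (a : ℕ) (h : a ≠ 7) (h' : a ≠ 8) : iter queueStep k m a = m a :=
      iter_frame (fun _ _ => queueStep_of_ne h h') k m
    have hn : (dataOf (iter queueStep k m)).nch = (dataOf m).nch := by
      simp only [dataOf, hf 0 (by omega) (by omega), hf 4 (by omega) (by omega)]
    have hc : (dataOf (iter queueStep k m)).child = (dataOf m).child := by
      simp only [dataOf, hf 0 (by omega) (by omega), hf 4 (by omega) (by omega)]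
    exact queueStep_apply hlen (hn ▸ hnch) (hc ▸ hchild) ih.1 ih.2

end RAM

/-! ### The assembled program -/

namespace RAM

variable {n b : ℕ} {G : SimpleGraph (Fin n)} {D : G.TreeDecomposition (Fin b)} {r : Fin b}
  {edges : List (Fin n × Fin n)} {children : Fin b → List (Fin b)} {elems : Fin b → List (Fin n)}
  {off : ℕ → ℕ}

theorem nodup_nodes_of_isChild (hn : ∀ i, (children i).Nodup)
    (hc : ∀ i j, j ∈ children i ↔ D.IsChild r i j) (k : ℕ) : (nodes children r k).Nodup :=
  nodup_nodes hn (fun i h => by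
    have := ((hc i r).1 h).2
    rw [SimpleGraph.dist_self] at this
    omega) (fun i k j hi hk => ((hc i j).1 hi).parent_unique ((hc k j).1 hk)) k

theorem length_nodes_le (hn : ∀ i, (children i).Nodup)
    (hc : ∀ i j, j ∈ children i ↔ D.IsChild r i j) (k : ℕ) : (nodes children r k).length ≤ b := by
  have := (nodup_nodes_of_isChild hn hc k).length_le_card
  rwa [Fintype.card_fin] at this

/-- Without repetitions the queue has at most `b` entries, so `b` steps expand all of them. The
queue is then closed under children and contains the root. -/
theorem mem_nodes (hn : ∀ i, (children i).Nodup) (hc : ∀ i j, j ∈ children i ↔ D.IsChild r i j)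
    (i : Fin b) : i ∈ nodes children r b := by
  have h := desc_root (D := D) (r := r) i
  induction h with
  | refl => exact List.mem_of_getElem (nodes_zero b)
  | tail _ h ih =>
    obtain ⟨p, hp, rfl⟩ := List.getElem_of_mem ih
    obtain ⟨l, hl, -, rfl⟩ := exists_getElem_nodes_of_mem_children
      (hp.trans_le (length_nodes_le hn hc b)) hp ((hc _ _).2 h)
    exact List.getElem_mem _

theorem dig_dataOf {m : Mem} {K c j : ℕ} (h5 : m 5 0 = K) (h6 : m 6 j = K ^ j) (hK : 0 < K)
    (hc : c ≤ bnd m) : (dataOf m).dig c j = c / K ^ j % K := by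
  have h1 := (Nat.div_le_self c (K ^ j)).trans hc
  have h2 := (Nat.div_le_self (c / K ^ j) K).trans h1
  simp only [dataOf]
  rw [h5, h6, bdiv_eq hc (pow_pos hK j), bdiv_eq h1 hK, bmul_eq h2]
  have := Nat.div_add_mod (c / K ^ j) K
  rw [mul_comm] at this
  omega

theorem mul_add_injective {u v u' v' : Fin n} (h : (u : ℕ) * n + v = u' * n + v') : u = u' ∧ v = v' := by
  have hn : 0 < n := u.pos
  have h1 := congrArg (· / n) h
  have h2 := congrArg (· % n) h
  simp only [mul_comm _ n, Nat.mul_add_mod, Nat.mul_add_div hn, Nat.mod_eq_of_lt (Fin.isLt _),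
    Nat.div_eq_of_lt (Fin.isLt _), Nat.add_zero] at h1 h2
  exact ⟨Fin.ext h1, Fin.ext h2⟩

theorem adjs_rows_apply {m : Mem} (hL : Layout (m 0) edges children elems r off)
    (h2 : m 2 0 = 0) (h3 : ∀ x, m 3 x = 0)
    (hG : ∀ u v : Fin n, s(u, v) ∈ (edges.map fun e => s(e.1, e.2)) ↔ G.Adj u v) (u v : Fin n) :
    adjs (rows m) 3 (adjs (rows m) 2 u + v) ≠ 0 ↔ G.Adj u v := by
  have hr (u : Fin n) : rows m 2 u = u * n := by
    rw [rows_apply h2 (by rw [hL.order]; exact u.2.le), hL.order]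
  rw [adjs_apply (by rwa [rows_of_ne (by omega)]), adjs_of_ne (by omega), rows_of_ne (a := 0) (by omega),
    hL.length_edges, ← hG, List.mem_map, hr]
  constructor
  · rintro ⟨t, ht, h⟩
    refine ⟨edges[t], List.getElem_mem ht, ?_⟩
    rw [hL.fst t ht, hL.snd t ht, hr, hr] at h
    rcases h with h | h
    · obtain ⟨rfl, rfl⟩ := mul_add_injective h
      rfl
    · obtain ⟨rfl, rfl⟩ := mul_add_injective h
      exact Sym2.eq_swap
  · rintro ⟨e, he, h⟩
    obtain ⟨t, ht, rfl⟩ := List.getElem_of_mem he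
    refine ⟨t, ht, ?_⟩
    rw [hL.fst t ht, hL.snd t ht, hr, hr]
    rcases Sym2.eq_iff.1 h with ⟨rfl, rfl⟩ | ⟨rfl, rfl⟩
    · exact Or.inl rfl
    · exact Or.inr rfl

theorem exists_program_table : ∃ (q : Program) (A : ℕ), ∀ {n b : ℕ} {G : SimpleGraph (Fin n)}
    {D : G.TreeDecomposition (Fin b)} {r : Fin b} {edges : List (Fin n × Fin n)}
    {children : Fin b → List (Fin b)} {elems : Fin b → List (Fin n)} {off : ℕ → ℕ} (s : State),
    Layout (s.arr 0) edges children elems r off → (∀ a ≠ 0, ∀ x, s.arr a x = 0) →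
    (∀ u v : Fin n, s(u, v) ∈ (edges.map fun e => s(e.1, e.2)) ↔ G.Adj u v) →
    (∀ i, (children i).Nodup) → (∀ i j, j ∈ children i ↔ D.IsChild r i j) →
    (∀ i, (children i).length ≤ 2) →
    (∀ i, (elems i).Nodup) → (∀ i v, v ∈ elems i ↔ v ∈ D.bag i) →
    ∃ (K t : ℕ) (s' : State), Exec q s t s' ∧ (∀ B, 2 ≤ B → (∀ i, (elems i).length < B) → K ≤ B) ∧
      t ≤ (n + edges.length + b + 3 * K + 1) * (K ^ (3 * K) + 2) ^ A ∧ s'.arr 0 = s.arr 0 ∧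
      (dataOf s'.arr).Reads D r children elems K ∧
      ∀ i : Fin b, ∀ c < bnd s'.arr, (dataOf s'.arr).tab i c = (dataOf s'.arr).step i c := by
  obtain ⟨q, A, hq⟩ := phase_rows.runs.seq phase_adjs.runs |>.seq phase_offInit.runs
    |>.seq phase_offs.runs |>.seq phase_baseInit.runs |>.seq phase_base.runs
    |>.seq phase_bndBase.runs |>.seq phase_powInit.runs |>.seq phase_pows.runs
    |>.seq phase_bndPow.runs |>.seq phase_queueInit.runs |>.seq phase_queue.runs
    |>.seq phase_tabs.runs
  refine ⟨q, A, fun {n b G D r edges children elems off} s hL h0 hG hcn hc hc2 hen he => ?_⟩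
  set m := s.arr with hm
  set m₂ := adjs (rows m) with hm₂
  set m₄ := offs (offInit m₂) with hm₄
  set m₆ := base (baseInit m₄) with hm₆
  set K := m₆ 5 0 with hK
  set m₇ := bndBase m₆ with hm₇
  set m₈ := powInit m₇ with hm₈
  set m₉ := pows m₈ with hm₉
  set m₁₀ := bndPow m₉ with hm₁₀
  set m₁₁ := queueInit m₁₀ with hm₁₁
  set m₁₂ := queue m₁₁ with hm₁₂
  have f₂ (a : ℕ) (h : a ≠ 2) (h' : a ≠ 3) : m₂ a = m a := by
    rw [hm₂, adjs_of_ne h', rows_of_ne h]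
  have f₄ (a : ℕ) (h : a ≠ 4) : m₄ a = m₂ a := by rw [hm₄, offs_of_ne h, offInit_of_ne h]
  have f₆ (a : ℕ) (h : a ≠ 5) : m₆ a = m₄ a := by rw [hm₆, base_of_ne h, baseInit_of_ne h]
  have f₉ (a : ℕ) (h : a ≠ 6) (h' : a ≠ 1) : m₉ a = m₆ a := by
    rw [hm₉, pows_of_ne h, hm₈, powInit_of_ne h, hm₇, bndBase_of_ne h']
  have f₁₀ (a : ℕ) (h : a ≠ 1) : m₁₀ a = m₉ a := by rw [hm₁₀, bndPow_of_ne h]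
  have f₁₁ (a : ℕ) (h : a ≠ 7) (h' : a ≠ 8) : m₁₁ a = m₁₀ a := by rw [hm₁₁, queueInit_of_ne h h']
  have f₁₂ (a : ℕ) (h : a ≠ 7) (h' : a ≠ 8) : m₁₂ a = m₁₀ a := by
    rw [hm₁₂, queue_of_ne h h', f₁₁ a h h']
  have f₁₃ (a : ℕ) (h : a ≠ 9) : tabs m₁₂ a = m₁₂ a := tabs_of_ne h
  have e₀ : m₁₀ 0 = m 0 := by
    rw [f₁₀ 0 (by omega), f₉ 0 (by omega) (by omega), f₆ 0 (by omega), f₄ 0 (by omega),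
      f₂ 0 (by omega) (by omega)]
  have e₂ : m₁₀ 2 = m₂ 2 := by
    rw [f₁₀ 2 (by omega), f₉ 2 (by omega) (by omega), f₆ 2 (by omega), f₄ 2 (by omega)]
  have e₃ : m₁₀ 3 = m₂ 3 := by
    rw [f₁₀ 3 (by omega), f₉ 3 (by omega) (by omega), f₆ 3 (by omega), f₄ 3 (by omega)]
  have e₄ : m₁₀ 4 = m₄ 4 := by rw [f₁₀ 4 (by omega), f₉ 4 (by omega) (by omega), f₆ 4 (by omega)]
  have e₅ : m₁₀ 5 0 = K := by rw [f₁₀ 5 (by omega), f₉ 5 (by omega) (by omega)]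
  have e₆ : m₁₀ 6 = m₉ 6 := f₁₀ 6 (by omega)
  have hb {m' : Mem} (h : m' 0 = m 0) : nbag m' = b := by
    rw [nbag, h, hL.length_edges, hL.bags]
  have hoff (i : Fin b) : m₄ 4 i = off i := by
    refine offs_apply (edges := edges) (children := children) (elems := elems) (r := r) (b := b)
      ?_ ?_ i.2.le
    · rwa [offInit_of_ne (by omega), f₂ 0 (by omega) (by omega)]
    · rw [offInit, write_apply, if_pos rfl, f₂ 0 (by omega) (by omega), hL.off_zero, hL.length_edges]
  have g₄ : baseInit m₄ 0 = m 0 := by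
    rw [baseInit_of_ne (by omega), f₄ 0 (by omega), f₂ 0 (by omega) (by omega)]
  have hsz (i : Fin b) : (dataOf (baseInit m₄)).size i = (elems i).length := by
    rw [dataOf_size, g₄, baseInit_of_ne (by omega), hoff, hL.nch, hL.size]
  obtain ⟨hK2, hKs, hKB⟩ := base_apply (m := baseInit m₄) (by rw [baseInit, write_apply, if_pos rfl])
  rw [← hm₆, ← hK] at hK2 hKs hKB
  rw [hb g₄] at hKs hKB
  have b₇ : bnd m₇ = K := by rw [bnd, hm₇, bndBase, write_apply, if_pos rfl]
  have b₈ : bnd m₈ = K := by rw [← b₇, bnd, hm₈, powInit_of_ne (by omega), bnd]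
  have k₈ : m₈ 5 0 = K := by rw [hm₈, powInit_of_ne (by omega), hm₇, bndBase_of_ne (by omega)]
  have b₉ : bnd m₉ = K := by rw [← b₈, bnd, hm₉, pows_of_ne (by omega), bnd]
  have hpow (j : ℕ) (hj : j ≤ 3 * K) : m₉ 6 j = K ^ j := by
    rw [← k₈]
    refine pows_apply (by rw [hm₈, powInit, write_apply, if_pos rfl]) (by rw [b₈, k₈]) ?_
    rw [k₈]
    omega
  have b₁₀ : bnd m₁₀ = K ^ (3 * K) := by
    rw [bnd, hm₁₀, bndPow, write_apply, if_pos rfl, f₉ 5 (by omega) (by omega), ← hK,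
      show K + (K + K) = 3 * K by omega, hpow _ le_rfl]
  have b₁₁ : bnd m₁₁ = K ^ (3 * K) := by rw [← b₁₀, bnd, f₁₁ 1 (by omega) (by omega), bnd]
  have b₁₂ : bnd m₁₂ = K ^ (3 * K) := by rw [← b₁₀, bnd, f₁₂ 1 (by omega) (by omega), bnd]
  have b₁₃ : bnd (tabs m₁₂) = K ^ (3 * K) := by rw [← b₁₂, bnd, f₁₃ 1 (by omega), bnd]
  have hKS : K ≤ K ^ (3 * K) := Nat.le_self_pow (by omega) K
  have hnch (m' : Mem) (h₀ : m' 0 = m 0) (h₄ : m' 4 = m₄ 4) (i : Fin b) :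
      (dataOf m').nch i = (children i).length := by
    rw [dataOf_nch, h₀, h₄, hoff, hL.nch]
  have hchild (m' : Mem) (h₀ : m' 0 = m 0) (h₄ : m' 4 = m₄ 4) (i : Fin b) (a : ℕ)
      (h : a < (children i).length) : (dataOf m').child i a = (children i)[a] := by
    rw [← hL.child i a h]
    simp only [dataOf]
    rw [h₀, h₄, hoff]
  obtain ⟨hT, hl⟩ := queue_apply (m := m₁₁) (r := r) (children := children) hc2
    (hnch m₁₁ (by rw [f₁₁ 0 (by omega) (by omega), e₀]) (by rw [f₁₁ 4 (by omega) (by omega), e₄]))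
    (hchild m₁₁ (by rw [f₁₁ 0 (by omega) (by omega), e₀]) (by rw [f₁₁ 4 (by omega) (by omega), e₄]))
    (by rw [hm₁₁, queueInit, write_apply, if_pos rfl])
    (by rw [hm₁₁, queueInit, write_of_ne (by omega), write_apply, if_pos rfl, e₀, hL.length_edges,
      hL.root])
  rw [← hm₁₂, hb (by rw [f₁₁ 0 (by omega) (by omega), e₀])] at hT hl
  have hTb : m₁₂ 8 0 ≤ b := hT.trans_le (length_nodes_le hcn hc b)
  have hreads : (dataOf (tabs m₁₂)).Reads D r children elems K := by
    have d₀ : tabs m₁₂ 0 = m 0 := by rw [f₁₃ 0 (by omega), f₁₂ 0 (by omega) (by omega), e₀]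
    have d₂ : tabs m₁₂ 2 = m₂ 2 := by rw [f₁₃ 2 (by omega), f₁₂ 2 (by omega) (by omega), e₂]
    have d₃ : tabs m₁₂ 3 = m₂ 3 := by rw [f₁₃ 3 (by omega), f₁₂ 3 (by omega) (by omega), e₃]
    have d₄ : tabs m₁₂ 4 = m₄ 4 := by rw [f₁₃ 4 (by omega), f₁₂ 4 (by omega) (by omega), e₄]
    have d₅ : tabs m₁₂ 5 0 = K := by rw [f₁₃ 5 (by omega), f₁₂ 5 (by omega) (by omega), e₅]
    have d₆ : tabs m₁₂ 6 = m₉ 6 := by rw [f₁₃ 6 (by omega), f₁₂ 6 (by omega) (by omega), e₆]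
    refine ⟨hcn, hc, hc2, hen, he, fun i => (hsz i).symm.trans_lt (hKs i i.2), hK2, b₁₃,
      hnch _ d₀ d₄, hchild _ d₀ d₄, fun i => ?_, fun i q h => ?_, fun u v => ?_,
      fun c hc j hj => dig_dataOf d₅ (by rw [d₆, hpow j hj.le]) (by omega) (le_of_lt hc)⟩
    · rw [dataOf_size, d₀, d₄, hoff, hL.nch, hL.size]
    · rw [← hL.elem i q h]
      simp only [dataOf]
      rw [d₀, d₄, hoff, hL.nch]
    · rw [← adjs_rows_apply hL (h0 2 (by omega) 0) (h0 3 (by omega)) hG]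
      simp only [dataOf]
      rw [d₂, d₃]
  have htab (i : Fin b) (c : ℕ) (hc' : c < bnd (tabs m₁₂)) :
      (dataOf (tabs m₁₂)).tab i c = (dataOf (tabs m₁₂)).step i c := by
    have hnd := nodup_nodes_of_isChild hcn hc b
    obtain ⟨p, hp, rfl⟩ := List.getElem_of_mem (mem_nodes hcn hc i)
    -- The table is filled by reading the queue backwards, so the entry at `p` is treated in the
    -- round with number length minus one minus `p`.
    rw [← hl p hp]
    have := tabs_tab (m := m₁₂) (node := fun k => m₁₂ 7 (m₁₂ 8 0 - 1 - k)) (fun _ _ => rfl)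
      (fun k hk l hlk h => ?_) (fun k hk a ha => ?_) (k := m₁₂ 8 0 - 1 - p) (by omega)
      (c := c) (by omega)
    · simpa only [show m₁₂ 8 0 - 1 - (m₁₂ 8 0 - 1 - p) = p by omega] using this
    · rw [hl _ (by omega), hl _ (by omega), Fin.val_inj, hnd.getElem_inj_iff] at h
      omega
    · have hk' : m₁₂ 8 0 - 1 - k < (nodes children r b).length := by omega
      have h₀ : m₁₂ 0 = m 0 := by rw [f₁₂ 0 (by omega) (by omega), e₀]
      have h₄ : m₁₂ 4 = m₄ 4 := by rw [f₁₂ 4 (by omega) (by omega), e₄]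
      rw [hl _ hk', hnch _ h₀ h₄] at ha
      rw [hl _ hk', hchild _ h₀ h₄ _ a ha]
      obtain ⟨l, hl', hlt, h⟩ := exists_getElem_nodes_of_mem_children (by omega) hk' (List.getElem_mem ha)
      refine ⟨m₁₂ 8 0 - 1 - l, by omega, ?_⟩
      rw [show m₁₂ 8 0 - 1 - (m₁₂ 8 0 - 1 - l) = l by omega, hl l hl', h]
  -- Before the bound is first set, its cell still holds 0.
  have z (m' : Mem) (h : m' 1 = m 1) : bnd m' ≤ K ^ (3 * K) := by
    rw [bnd, h, h0 1 (by omega)]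
    exact Nat.zero_le _
  -- The sum dominates the length of each outer loop (vertices, edges, bags, digits, queue), and the
  -- number of codes dominates all values of the stored bound.
  obtain ⟨t, s', hex, ht, ha⟩ := hq s (n + edges.length + b + 3 * K) (K ^ (3 * K))
    ⟨⟨⟨⟨⟨⟨⟨⟨⟨⟨⟨⟨⟨by change m 0 0 ≤ _; rw [hL.order]; omega, z m rfl⟩,
      ⟨by change rows m 0 1 ≤ _; rw [rows_of_ne (by omega), hL.length_edges]; omega, z _ (rows_of_ne (by omega))⟩⟩,
      ⟨Nat.zero_le _, z m₂ (f₂ 1 (by omega) (by omega))⟩⟩,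
      ⟨by rw [hb]; omega; rw [offInit_of_ne (by omega)]; exact f₂ 0 (by omega) (by omega),
        z _ ((offInit_of_ne (by omega)).trans (f₂ 1 (by omega) (by omega)))⟩⟩,
      ⟨Nat.zero_le _, z m₄ ((f₄ 1 (by omega)).trans (f₂ 1 (by omega) (by omega)))⟩⟩,
      ⟨by rw [hb g₄]; omega, z _ ((baseInit_of_ne (by omega)).trans
        ((f₄ 1 (by omega)).trans (f₂ 1 (by omega) (by omega))))⟩⟩,
      ⟨Nat.zero_le _, z m₆ ((f₆ 1 (by omega)).trans
        ((f₄ 1 (by omega)).trans (f₂ 1 (by omega) (by omega))))⟩⟩,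
      ⟨Nat.zero_le _, b₇.trans_le hKS⟩⟩,
      ⟨by change m₈ 5 0 + (m₈ 5 0 + m₈ 5 0) ≤ _; omega, b₈.trans_le hKS⟩⟩,
      ⟨Nat.zero_le _, b₉.trans_le hKS⟩⟩,
      ⟨Nat.zero_le _, b₁₀.le⟩⟩,
      ⟨by change nbag m₁₁ ≤ _; rw [hb (by rw [f₁₁ 0 (by omega) (by omega), e₀])]; omega, b₁₁.le⟩⟩,
      ⟨by change m₁₂ 8 0 ≤ _; omega, b₁₂.le⟩⟩
  have ha : s'.arr = tabs m₁₂ := ha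
  refine ⟨K, t, s', hex, fun B hB h => hKB B hB fun i hi => ?_, ht, ?_, ha ▸ hreads, ha ▸ htab⟩
  · exact (hsz ⟨i, hi⟩).trans_lt (h _)
  · rw [ha, f₁₃ 0 (by omega), f₁₂ 0 (by omega) (by omega), e₀]

end RAM

/-! ### The running time -/

theorem Nat.exists_forall_pow_le_two_pow (a : ℕ) : ∃ k₀ : ℕ, ∀ k ≥ k₀, k ^ a ≤ 2 ^ k := by
  have h := tendsto_pow_const_div_const_pow_of_one_lt a (one_lt_two (α := ℝ))
  obtain ⟨k₀, hk₀⟩ := Filter.eventually_atTop.1 (h.eventually_le_const one_pos)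
  refine ⟨k₀, fun k hk => ?_⟩
  have := hk₀ k hk
  rw [div_le_one (by positivity)] at this
  exact_mod_cast this

theorem Nat.exists_forall_pow_mul_le_four_pow (a : ℕ) :
    ∃ C : ℕ, ∀ w : ℕ, (w + 2) ^ (a * (w + 2)) ≤ C * 4 ^ (w ^ 2 + w) := by
  obtain ⟨k₀, hk₀⟩ := Nat.exists_forall_pow_le_two_pow a
  refine ⟨32 + (k₀ + 2) ^ (a * k₀), fun w => ?_⟩
  rcases le_total k₀ (w + 2) with hw | hw
  · calc (w + 2) ^ (a * (w + 2)) = ((w + 2) ^ a) ^ (w + 2) := pow_mul ..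
      _ ≤ (2 ^ (w + 2)) ^ (w + 2) := Nat.pow_le_pow_left (hk₀ _ hw) _
      -- In the next step 5 + 2(w² + w) exceeds (w + 2)² by exactly (w - 1)².
      _ = 2 ^ ((w + 2) * (w + 2)) := (pow_mul ..).symm
      _ ≤ 2 ^ (5 + 2 * (w ^ 2 + w)) := Nat.pow_le_pow_right (by omega) (by
        zify
        nlinarith [sq_nonneg ((w : ℤ) - 1)])
      _ = 32 * 4 ^ (w ^ 2 + w) := by rw [pow_add, pow_mul]; norm_num
      _ ≤ _ := Nat.mul_le_mul_right _ (by omega)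
  · calc (w + 2) ^ (a * (w + 2)) ≤ (k₀ + 2) ^ (a * (w + 2)) := Nat.pow_le_pow_left (by omega) _
      _ ≤ (k₀ + 2) ^ (a * k₀) := Nat.pow_le_pow_right (by omega) (Nat.mul_le_mul_left a hw)
      _ ≤ (32 + (k₀ + 2) ^ (a * k₀)) * 1 := by omega
      _ ≤ _ := Nat.mul_le_mul_left _ (Nat.one_le_pow _ _ (by omega))

namespace SimpleGraph.TreeDecomposition

theorem card_bag_le {V I : Type*} {G : SimpleGraph V} [Fintype I] (D : G.TreeDecomposition I) (i : I) :
    (D.bag i).card ≤ D.width + 1 := by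
  have := Finset.le_sup (f := fun i => (D.bag i).card) (Finset.mem_univ i)
  rw [width]
  omega

/-- Every edge lies inside some bag, so reading the edges also costs only linear time up to a factor
depending on the width. -/
theorem length_edges_le {n b : ℕ} {G : SimpleGraph (Fin n)} (D : G.TreeDecomposition (Fin b))
    {edges : List (Fin n × Fin n)} (hn : (edges.map fun e => s(e.1, e.2)).Nodup)
    (hG : ∀ u v : Fin n, s(u, v) ∈ (edges.map fun e => s(e.1, e.2)) → G.Adj u v) :
    edges.length ≤ b * (D.width + 1) ^ 2 := by
  have hn' : edges.Nodup := hn.of_map _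
  rw [← List.toFinset_card_of_nodup hn']
  have hsub : edges.toFinset ⊆ Finset.univ.biUnion fun i => D.bag i ×ˢ D.bag i := by
    intro e he
    obtain ⟨i, hi⟩ := D.arc_coverage e.1 e.2
      (hG _ _ (List.mem_map.2 ⟨e, List.mem_toFinset.1 he, rfl⟩))
    exact Finset.mem_biUnion.2 ⟨i, Finset.mem_univ i, Finset.mem_product.2 hi⟩
  refine (Finset.card_le_card hsub).trans ((Finset.card_biUnion_le_card_mul _ _ _ fun i _ => ?_).trans_eq
    (by rw [Finset.card_univ, Fintype.card_fin]))
  rw [Finset.card_product, sq]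
  exact Nat.mul_le_mul (D.card_bag_le i) (D.card_bag_le i)

end SimpleGraph.TreeDecomposition

namespace RAM

theorem ev_output : Ev (fun m (_ : Unit) => (Finset.range (bnd m)).sup
    ((dataOf m).tab (m 0 (3 + (m 0 1 + m 0 1)))) - 1) := by
  have h {Γ : Type} [Ctx Γ] : Ev (fun m (_ : Γ) => m 0 1) := .load 0 (.const 1)
  exact .sub (Ev.sup (h := fun m (_ : Unit) c => (dataOf m).tab (m 0 (3 + (m 0 1 + m 0 1))) c)
    (.tab (.load 0 (.add (.const 3) (.add h h))) .last)) (.const 1)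

theorem exists_program : ∃ (q : Program) (A : ℕ), ∀ (n b : ℕ) (G : SimpleGraph (Fin n))
    (D : G.TreeDecomposition (Fin b)) (r : Fin b), G.IsBipartite → D.IsNice r →
    ∀ x : List ℕ, IsInputWord G D r x → ∃ t k : ℕ, Computes q x t k ∧
      G.IsMaxAlternatingCycleFreeMatchingSize k ∧
      t ≤ (n + b * (D.width + 1) ^ 2 + b + 3 * (D.width + 2) + 2) *
        ((D.width + 2) ^ (3 * (D.width + 2)) + 2) ^ A := by
  obtain ⟨q, A, hq⟩ := exists_program_table
  obtain ⟨q', A', hq'⟩ := ev_output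
  refine ⟨.seq q (q' id 0), max A A', fun n b G D r hbip hnice x hx => ?_⟩
  obtain ⟨edges, children, elems, hed, hG, hc, he, hx⟩ := hx
  have hmap {m : ℕ} (l : List (Fin m)) : List.flatMap (fun a : Fin m => [(a : ℕ)]) l = l.map Fin.val :=
    List.map_eq_flatMap.symm
  simp only [List.bind_eq_flatMap, List.pure_def, List.map_id', hmap] at hx
  obtain ⟨off, hL⟩ := exists_layout edges children elems r
  rw [← hx] at hL
  have hL' : Layout ((State.init x).arr 0) edges children elems r off := hL
  have hlen (i : Fin b) : (children i).length ≤ 2 := by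
    have h := hnice.at_most_two i
    have hs : {j | D.IsChild r i j} = ((children i).toFinset : Set (Fin b)) := by
      ext j
      simp [(hc i).2]
    rw [hs, Set.encard_coe_eq_coe_finsetCard, List.toFinset_card_of_nodup (hc i).1] at h
    exact_mod_cast h
  obtain ⟨K, t, s, hex, hK, ht, h0, hreads, htab⟩ := hq (State.init x) hL'
    (fun a ha x => if_neg ha) hG (fun i => (hc i).1) (fun i => (hc i).2) hlen (fun i => (he i).1)
    (fun i => (he i).2)
  obtain ⟨t', s', hex', ht', hv, -, -⟩ := hq' id 0 (fun k hk => absurd hk (Nat.not_lt_zero k)) s ()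
    trivial
  have hroot : s.arr 0 (3 + (s.arr 0 1 + s.arr 0 1)) = r := by
    rw [h0, hL'.length_edges, hL'.root]
  beta_reduce at hv
  rw [hroot] at hv
  refine ⟨_, _, ⟨s', .seq hex hex', hv⟩, hreads.isMax htab hnice.root.le hbip, ?_⟩
  -- The width plus two is at least 2 and exceeds every bag size, so minimality of the base applies.
  have hKw : K ≤ D.width + 2 := hK _ (by omega) fun i => by
    have := D.card_bag_le i
    rw [← List.toFinset_card_of_nodup (he i).1, show (elems i).toFinset = D.bag i by
      ext v; simp [(he i).2]]
    omega
  have hKK : K ^ (3 * K) ≤ (D.width + 2) ^ (3 * (D.width + 2)) :=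
    (Nat.pow_le_pow_left hKw _).trans (Nat.pow_le_pow_right (by omega) (by omega))
  have hE := D.length_edges_le hed fun u v => (hG u v).1
  have h1 : (K ^ (3 * K) + 2) ^ A ≤ ((D.width + 2) ^ (3 * (D.width + 2)) + 2) ^ max A A' :=
    (Nat.pow_le_pow_left (by omega) A).trans (bound_mono (le_max_left A A'))
  have h2 : (bnd s.arr + 2) ^ A' ≤ ((D.width + 2) ^ (3 * (D.width + 2)) + 2) ^ max A A' := by
    rw [show bnd s.arr = K ^ (3 * K) from hreads.N_eq]
    exact (Nat.pow_le_pow_left (by omega) A').trans (bound_mono (le_max_right A A'))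
  calc t + t' ≤ (n + edges.length + b + 3 * K + 1) *
        ((D.width + 2) ^ (3 * (D.width + 2)) + 2) ^ max A A' +
        ((D.width + 2) ^ (3 * (D.width + 2)) + 2) ^ max A A' :=
        add_le_add (ht.trans (Nat.mul_le_mul_left _ h1)) (ht'.trans h2)
    _ = (n + edges.length + b + 3 * K + 2) *
        ((D.width + 2) ^ (3 * (D.width + 2)) + 2) ^ max A A' := by ring
    _ ≤ _ := Nat.mul_le_mul_right _ (by omega)

end RAM

theorem theorem5 :
    ∃ P : RAM.Program, ∀ c : ℕ, ∃ C : ℝ,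
      ∀ (n b : ℕ) (G : SimpleGraph (Fin n)) (D : G.TreeDecomposition (Fin b)) (r : Fin b),
        G.IsBipartite → D.IsNice r → b ≤ c * n →
        ∀ x : List ℕ, SimpleGraph.IsInputWord G D r x →
          ∃ t k : ℕ, RAM.Computes P x t k ∧ G.IsMaxAlternatingCycleFreeMatchingSize k ∧
            (t : ℝ) ≤ C * (4 ^ (D.width ^ 2 + D.width) * (max D.width 2 : ℝ) ^ 3 *
              Real.log (max D.width 2 : ℝ) * n) := by
  obtain ⟨P, A, hP⟩ := RAM.exists_program
  -- The 2 comes from the factor (w + 2)² of the outer loops, and 4A from the `A`-th power of the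
  -- number of codes plus two, which is at most (w + 2)^(4(w + 2)).
  obtain ⟨C, hC⟩ := Nat.exists_forall_pow_mul_le_four_pow (2 + 4 * A)
  refine ⟨P, fun c => ⟨5 * (c + 1) * C, fun n b G D r hbip hnice hb x hx => ?_⟩⟩
  obtain ⟨t, k, hcomp, hmax, ht⟩ := hP n b G D r hbip hnice x hx
  refine ⟨t, k, hcomp, hmax, ?_⟩
  set w := D.width
  -- The root is a bag, so there is at least one bag and hence at least one vertex. This absorbs the
  -- additive terms without `n`.
  have hn : 1 ≤ n := by
    have := r.pos
    by_contra! h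
    rw [Nat.lt_one_iff.1 h] at hb
    omega
  have h1 : n + b * (w + 1) ^ 2 + b + 3 * (w + 2) + 2 ≤ 5 * (c + 1) * n * (w + 2) ^ 2 := by
    have h2 : b * (w + 1) ^ 2 ≤ c * n * (w + 1) ^ 2 := Nat.mul_le_mul_right _ hb
    have h3 : 1 * (w + 2) ^ 2 ≤ n * (w + 2) ^ 2 := Nat.mul_le_mul_right _ hn
    nlinarith [Nat.zero_le (c * n * w), Nat.zero_le (c * n * w ^ 2), Nat.zero_le (n * w),
      Nat.zero_le (n * w ^ 2), Nat.zero_le (c * n)]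
  have h2 : (w + 2) ^ (3 * (w + 2)) + 2 ≤ (w + 2) ^ (4 * (w + 2)) := by
    have h3 : 2 ≤ (w + 2) ^ (3 * (w + 2)) :=
      (Nat.le_add_left 2 w).trans (Nat.le_self_pow (by omega) _)
    calc (w + 2) ^ (3 * (w + 2)) + 2 ≤ (w + 2) ^ (3 * (w + 2)) * (w + 2) := by nlinarith
      _ = (w + 2) ^ (3 * (w + 2) + 1) := (pow_succ ..).symm
      _ ≤ _ := Nat.pow_le_pow_right (by omega) (by omega)
  have h3 : t ≤ 5 * (c + 1) * C * (4 ^ (w ^ 2 + w) * n) :=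
    calc t ≤ 5 * (c + 1) * n * (w + 2) ^ 2 * ((w + 2) ^ (4 * (w + 2))) ^ A :=
          ht.trans (Nat.mul_le_mul h1 (Nat.pow_le_pow_left h2 A))
      _ = 5 * (c + 1) * n * (w + 2) ^ (2 + 4 * (w + 2) * A) := by
        rw [← pow_mul, pow_add, mul_assoc]
      _ ≤ 5 * (c + 1) * n * (w + 2) ^ ((2 + 4 * A) * (w + 2)) :=
          Nat.mul_le_mul_left _ (Nat.pow_le_pow_right (by omega) (by nlinarith))
      _ ≤ 5 * (c + 1) * n * (C * 4 ^ (w ^ 2 + w)) := Nat.mul_le_mul_left _ (hC w)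
      _ = _ := by ring
  -- The polynomial and logarithmic factors of the claim are not needed; it suffices that they are
  -- at least 8 log 2 > 1.
  have hlog : (1 : ℝ) ≤ (max w 2 : ℝ) ^ 3 * Real.log (max w 2 : ℝ) := by
    have h4 : (2 : ℝ) ≤ max (w : ℝ) 2 := le_max_right _ _
    have h5 : Real.log 2 ≤ Real.log (max (w : ℝ) 2) := Real.log_le_log two_pos h4
    have h6 : (2 : ℝ) ^ 3 ≤ (max (w : ℝ) 2) ^ 3 := pow_le_pow_left₀ two_pos.le h4 3
    nlinarith [Real.log_two_gt_d9]
  calc (t : ℝ) ≤ 5 * (c + 1) * C * (4 ^ (w ^ 2 + w) * n) := by exact_mod_cast h3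
    _ ≤ 5 * (c + 1) * C * (4 ^ (w ^ 2 + w) * n * ((max w 2 : ℝ) ^ 3 * Real.log (max w 2 : ℝ))) :=
        mul_le_mul_of_nonneg_left (le_mul_of_one_le_right (by positivity) hlog) (by positivity)
    _ = _ := by ring
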